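/- **Setting.** Let $G$ be a finite connected simple graph with vertex set $\{1,\dots,N\}$, $N\ge 2$, and let $L_G=(l_{pj})$ be its Laplacian matrix (degree matrix minus adjacency matrix). Let $n,d,m\ge 0$ be integers and $A\in\mathbb R^{n\times n}$. A *node family with Jacobian $A$* is a map $f(x;\varepsilon)$ with values in $\mathbb R^n$ which is $C^\infty$ on $U\times\Omega$ for some open neighbourhoods of the origin $U\subseteq\mathbb R^n$, $\Omega\subseteq\mathbb R^d$, and satisfies $f(0;\varepsilon)=0$ for all $\varepsilon\in\Omega$ and $D_xf(0;0)=A$. For $\alpha\ge0$ and an $n\times n$ matrix $D$, consider on $(\mathbb R^n)^N$ the network system $$\dot X=F(X;\varepsilon)-\alpha(L_G\otimes D)X,\qquad\text{i.e.}\quad \dot x_p=f(x_p;\varepsilon)-\alpha\sum_{j=1}^N l_{pj}Dx_j ,\quad p=1,\dots,N, \tag{1}$$ whose Jacobian at $X=0$, $\varepsilon=0$ is $J=\mathrm{id}_N\otimes A-\alpha L_G\otimes D$. A matrix $D$, not necessarily symmetric, is positive-definite if $x^TDx>0$ for all $x\neq0$. The center subspace $\mathcal E^c$ and the hyperbolic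 subspace $\mathcal E^h$ of $J$ are the sums of the (real) generalized eigenspaces for the eigenvalues with zero, respectively nonzero, real part. A *local parameterized center manifold of class $C^k$* ($k\ge1$) of (1) is a local $C^k$ center manifold at the origin of the augmented system consisting of (1) and $\dot\varepsilon=0$, whose center subspace is $\mathcal E^c\times\mathbb R^d$: the graph of a map $\Psi$ from $\mathcal E^c\times\mathbb R^d$ to $\mathcal E^h$, of class $C^k$ near $0$, with $\Psi(0)=0$ and $D\Psi(0)=0$, which near the origin is invariant and contains every solution that stays near the origin for all times in $\mathbb R$. Its dimension is $\dim\mathcal E^c$. Its *parameterized reduced vector field* is the map, defined near the origin, $R(X_c;\varepsilon)=\Pi^c\big(F(X;\varepsilon)-\alpha(L_G\otimes D)X\big)$ with $X=X_c+\Psi(X_c;\varepsilon)$, where $\Pi^c$ is the projection onto $\mathcal E^c$ along $\mathcal E^h$. For finite-dimensional real vector spaces $W,W'$, let $\mathcal P_2^\rho(W;W')$ be the space of polynomial maps $W\to W'$ with terms of degree $2$ through $\rho$, and let $h^{[2,\rho]}$ denote the terms of degree $2$ through $\rho$ of the Taylor expansion of $h$ at the origin, in all variables (state and parameter). For an integer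 $\rho\ge1$, $G$ is *$\rho$-versatile for $(\lambda,v)$* if $\lambda>0$ is a simple eigenvalue of $L_G$ with eigenvector $v=(\nu_1,\dots,\nu_N)$ and $\sum_{p=1}^N\nu_p^\ell\neq0$ for all $\ell=2,\dots,\rho+1$. **Theorem.** Suppose that there are $m$ mutually orthogonal vectors $x_1,\dots,x_m\in\mathbb R^n$ with $\langle x_i,Ax_i\rangle>0$ for all $i$. (A) There exist a positive-definite matrix $D$ and a number $\alpha^*>0$ such that for every node family $f$ with Jacobian $A$ the system (1) with $\alpha=\alpha^*$ has a local parameterized center manifold (of class $C^k$, for every finite $k\ge1$), and its dimension is at least $m$. (B) Suppose that $G$ is $\rho$-versatile for the pair $(\lambda,v)$. Then for every $\delta>0$ there exist a matrix $A'$ with $\|A'-A\|<\delta$, a positive-definite matrix $D$ and a number $\alpha^*>0$ such that $\dim\mathcal E^c=m$ for the Jacobian of (1) with $A'$ in place of $A$ and $\alpha=\alpha^*$, and such that for every node family $f$ with Jacobian $A'$ (for instance $f_0(x;\varepsilon)+(A'-A)x$, where $f_0$ is a node family with Jacobian $A$) the following holds for the system (1) with $\alpha=\alpha^*$: 1. The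 system has a local parameterized center manifold (of class $C^k$, for every finite $k\ge1$), of dimension exactly $m$. 2. For every local parameterized center manifold of class $C^k$, $k\ge1$, the reduced vector field $R$ is of class $C^k$ near the origin, $R(0;\varepsilon)=0$ for all $\varepsilon$ sufficiently close to $0$, and $D_{X_c}R(0;0):\mathcal E^c\to\mathcal E^c$ is nilpotent. 3. $R^{[2,\rho]}$ can take any value as $f^{[2,\rho]}$ is varied: for every $P\in\mathcal P_2^\rho(\mathcal E^c\times\mathbb R^d;\mathcal E^c)$ with $P(0;\varepsilon)=0$ for all $\varepsilon$ there is a $q\in\mathcal P_2^\rho(\mathbb R^n\times\mathbb R^d;\mathbb R^n)$ with $q(0;\varepsilon)=0$ for all $\varepsilon$ such that, when $f$ is replaced by the node family $f+q$, which has Jacobian $A'$ too, every local parameterized center manifold of class $C^k$, $k\ge\rho$, has a reduced vector field $R$ with $R^{[2,\rho]}=P$. -/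

import Mathlib

open scoped ContDiff Topology

/-! ## Center and hyperbolic subspaces of a linear map -/

section Spectral

variable {Z : Type*} [AddCommGroup Z] [Module ℝ Z]

/-- The real generalized eigenspace of `T` for the pair of complex numbers `a ± b i`, that is
`⋃ k, ker ((T - a)² + b²)^k`. For `b = 0` it is the generalized eigenspace of the real number
`a`. -/
def realGenEigenspace (T : Module.End ℝ Z) (a b : ℝ) : Submodule ℝ Z :=
  Module.End.maxGenEigenspace ((T - algebraMap ℝ (Module.End ℝ Z) a) ^ 2) (-(b ^ 2))

/-- The center subspace of `T`: the sum of the real generalized eigenspaces belonging to the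
eigenvalues with zero real part. -/
def centerSubspace (T : Module.End ℝ Z) : Submodule ℝ Z :=
  ⨆ b : ℝ, realGenEigenspace T 0 b

/-- The hyperbolic subspace of `T`: the sum of the real generalized eigenspaces belonging to the
eigenvalues with nonzero real part. -/
def hyperbolicSubspace (T : Module.End ℝ Z) : Submodule ℝ Z :=
  ⨆ (a : ℝ) (_ : a ≠ 0) (b : ℝ), realGenEigenspace T a b

open Polynomial in
theorem mem_realGenEigenspace_iff (T : Module.End ℝ Z) (a b : ℝ) (x : Z) :
    x ∈ realGenEigenspace T a b ↔
      ∃ k : ℕ, aeval T (((X - C a) ^ 2 + C (b ^ 2) : ℝ[X]) ^ k) x = 0 := by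
  have h : aeval T ((X - C a) ^ 2 + C (b ^ 2) : ℝ[X]) =
      (T - algebraMap ℝ (Module.End ℝ Z) a) ^ 2 - (-(b ^ 2)) • (1 : Module.End ℝ Z) := by
    rw [map_add, aeval_C, map_pow, map_sub, aeval_X, aeval_C, neg_smul, sub_neg_eq_add,
      Algebra.algebraMap_eq_smul_one (b ^ 2)]
  rw [realGenEigenspace, Module.End.mem_maxGenEigenspace, ← h]
  simp_rw [← map_pow (aeval T) ((X - C a) ^ 2 + C (b ^ 2) : ℝ[X])]

open Polynomial in
theorem root_of_quad {a b : ℝ} {z : ℂ} {k : ℕ}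
    (h : aeval z (((X - C a) ^ 2 + C (b ^ 2) : ℝ[X]) ^ k) = 0) : z.re = a := by
  simp only [map_pow, map_add, map_sub, aeval_X, aeval_C, Complex.coe_algebraMap] at h
  have h1 := eq_zero_of_pow_eq_zero h
  have h2 : (z - a + b * Complex.I) * (z - a - b * Complex.I) = 0 := by
    ring_nf
    rw [Complex.I_sq]
    linear_combination h1
  rcases mul_eq_zero.1 h2 with h3 | h3
  · have := congrArg Complex.re h3
    simp at this
    linarith
  · have := congrArg Complex.re h3
    simp at this
    linarith

open Polynomial in
theorem exists_poly_of_mem_iSup (T : Module.End ℝ Z) (S : Set ℝ) {x : Z}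
    (hx : x ∈ ⨆ (a : ℝ) (_ : a ∈ S) (b : ℝ), realGenEigenspace T a b) :
    ∃ q : ℝ[X], (∀ z : ℂ, aeval z q = 0 → z.re ∈ S) ∧ aeval T q x = 0 := by
  let W : Submodule ℝ Z :=
    { carrier := {x | ∃ q : ℝ[X], (∀ z : ℂ, aeval z q = 0 → z.re ∈ S) ∧ aeval T q x = 0}
      add_mem' := by
        rintro x y ⟨q, hq, hqx⟩ ⟨r, hr, hry⟩
        refine ⟨q * r, fun z hz => ?_, ?_⟩
        · rw [map_mul] at hz
          rcases mul_eq_zero.1 hz with h | h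
          exacts [hq z h, hr z h]
        · rw [map_add]
          nth_rewrite 1 [mul_comm q r]
          simp only [map_mul, Module.End.mul_apply, hqx, hry, map_zero, add_zero]
      zero_mem' := ⟨1, fun z hz => by simp at hz, by simp⟩
      smul_mem' := by
        rintro c x ⟨q, hq, hqx⟩
        exact ⟨q, hq, by rw [map_smul, hqx, smul_zero]⟩ }
  have hW : (⨆ (a : ℝ) (_ : a ∈ S) (b : ℝ), realGenEigenspace T a b) ≤ W := by
    refine iSup_le fun a => iSup_le fun ha => iSup_le fun b => ?_
    intro y hy
    obtain ⟨k, hk⟩ := (mem_realGenEigenspace_iff T a b y).1 hy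
    exact ⟨_, fun z hz => by rw [root_of_quad hz]; exact ha, hk⟩
  exact hW hx

theorem centerSubspace_eq (T : Module.End ℝ Z) :
    centerSubspace T = ⨆ (a : ℝ) (_ : a ∈ ({0} : Set ℝ)) (b : ℝ), realGenEigenspace T a b := by
  simp [centerSubspace]

open Polynomial in
theorem ker_aeval_le (T : Module.End ℝ Z) (p : ℝ[X]) (hp : p ≠ 0) :
    LinearMap.ker (aeval T p) ≤ centerSubspace T ⊔ hyperbolicSubspace T := by
  induction p using UniqueFactorizationMonoid.induction_on_coprime with
  | h0 => exact absurd rfl hp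
  | @h1 u hu =>
    obtain ⟨c, hc, rfl⟩ := Polynomial.isUnit_iff.1 hu
    intro x hx
    have hx' : c • x = 0 := by
      simpa [aeval_C, Module.algebraMap_end_apply] using hx
    rw [(smul_eq_zero.1 hx').resolve_left hc.ne_zero]
    exact Submodule.zero_mem _
  | @hpr q i hq =>
    obtain ⟨z, hz⟩ : ∃ z : ℂ, aeval z q = 0 :=
      IsAlgClosed.exists_aeval_eq_zero _ q (degree_pos_of_irreducible hq.irreducible).ne'
    have hdvd : q ∣ (X - C z.re) ^ 2 + C (z.im ^ 2) := by
      have h1 : minpoly ℝ z ∣ (X - C z.re) ^ 2 + C (z.im ^ 2) := by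
        apply minpoly.dvd
        simp only [map_pow, map_add, map_sub, aeval_X, aeval_C, Complex.coe_algebraMap]
        have : z - z.re = z.im * Complex.I := by
          rw [sub_eq_iff_eq_add, add_comm]; exact (Complex.re_add_im z).symm
        rw [this, mul_pow, Complex.I_sq]
        ring
      rw [← minpoly.eq_of_irreducible hq.irreducible hz] at h1
      exact dvd_of_mul_right_dvd h1
    obtain ⟨r, hr⟩ := pow_dvd_pow_of_dvd hdvd i
    intro x hx
    have hx2 : x ∈ realGenEigenspace T z.re z.im := by
      refine (mem_realGenEigenspace_iff T _ _ x).2 ⟨i, ?_⟩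
      rw [hr, mul_comm, map_mul, Module.End.mul_apply, LinearMap.mem_ker.1 hx, map_zero]
    by_cases h : z.re = 0
    · rw [h] at hx2
      exact Submodule.mem_sup_left
        (le_iSup (fun b => realGenEigenspace T 0 b) z.im hx2)
    · have h3 : realGenEigenspace T z.re z.im ≤ hyperbolicSubspace T :=
        le_iSup_of_le z.re (le_iSup_of_le h (le_iSup (fun b => realGenEigenspace T z.re b) z.im))
      exact Submodule.mem_sup_right (h3 hx2)
  | @hcp a b hab ha hb =>
    rw [← sup_ker_aeval_eq_ker_aeval_mul_of_coprime T hab.isCoprime]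
    exact sup_le (ha (left_ne_zero_of_mul hp)) (hb (right_ne_zero_of_mul hp))

/-- A finite-dimensional space is the direct sum of the center and the hyperbolic subspace. -/
theorem isCompl_center_hyperbolic [FiniteDimensional ℝ Z] (T : Module.End ℝ Z) :
    IsCompl (centerSubspace T) (hyperbolicSubspace T) := by
  constructor
  · rw [Submodule.disjoint_def]
    intro x hx hy
    rw [centerSubspace_eq] at hx
    obtain ⟨q, hq, hqx⟩ := exists_poly_of_mem_iSup T _ hx
    obtain ⟨r, hr, hrx⟩ := exists_poly_of_mem_iSup T {a | a ≠ 0} hy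
    have hcop : IsCoprime q r := by
      refine isCoprime_of_irreducible_dvd ?_ ?_
      · rintro ⟨rfl, -⟩
        simpa using hq 1 (by simp)
      · rintro p hp ⟨s, rfl⟩ ⟨t, rfl⟩
        obtain ⟨z, hz⟩ : ∃ z : ℂ, Polynomial.aeval z p = 0 :=
          IsAlgClosed.exists_aeval_eq_zero _ p (Polynomial.degree_pos_of_irreducible hp).ne'
        exact hr z (by rw [map_mul, hz, zero_mul]) (hq z (by rw [map_mul, hz, zero_mul]))
    exact Submodule.disjoint_def.1 (Polynomial.disjoint_ker_aeval_of_isCoprime T hcop) x hqx hrx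
  · rw [codisjoint_iff, eq_top_iff]
    intro x _
    refine ker_aeval_le T (minpoly ℝ T) (minpoly.ne_zero (Algebra.IsIntegral.isIntegral T)) ?_
    rw [LinearMap.mem_ker, minpoly.aeval, LinearMap.zero_apply]

/-- The projection onto the center subspace along the hyperbolic subspace. -/
noncomputable def centerProj [FiniteDimensional ℝ Z] (T : Module.End ℝ Z) :
    Z →ₗ[ℝ] centerSubspace T :=
  Submodule.projectionOnto _ _ (isCompl_center_hyperbolic T)

theorem mem_centerSubspace_prodMap_zero {P : Type*} [AddCommGroup P] [Module ℝ P]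
    (T : Module.End ℝ Z) (x : centerSubspace T) (e : P) :
    ((x : Z), e) ∈ centerSubspace (LinearMap.prodMap T (0 : Module.End ℝ P)) := by
  have h1 : ∀ y : Z, y ∈ centerSubspace T →
      (y, (0 : P)) ∈ centerSubspace (LinearMap.prodMap T (0 : Module.End ℝ P)) := by
    intro y hy
    have : centerSubspace T ≤ (centerSubspace (LinearMap.prodMap T (0 : Module.End ℝ P))).comap
        (LinearMap.inl ℝ Z P) := by
      refine iSup_le fun b => ?_
      intro w hw
      obtain ⟨k, hk⟩ := (mem_realGenEigenspace_iff T 0 b w).1 hw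
      refine le_iSup (fun b => realGenEigenspace (LinearMap.prodMap T (0 : Module.End ℝ P)) 0 b)
        b ((mem_realGenEigenspace_iff _ 0 b _).2 ⟨k, ?_⟩)
      have hc : ∀ q : Polynomial ℝ, ∀ w : Z,
          Polynomial.aeval (LinearMap.prodMap T (0 : Module.End ℝ P)) q (w, 0) =
            (Polynomial.aeval T q w, 0) := by
        intro q
        induction q using Polynomial.induction_on with
        | C a => intro w; simp [Module.algebraMap_end_apply]
        | add p q hp hq => intro w; simp [hp, hq]
        | monomial n a ih =>
          intro w
          rw [pow_succ, ← mul_assoc, map_mul, map_mul, Module.End.mul_apply, Module.End.mul_apply]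
          simpa using ih (T w)
      rw [LinearMap.inl_apply, hc, hk]
      rfl
    exact this hy
  have h2 : ((0 : Z), e) ∈ centerSubspace (LinearMap.prodMap T (0 : Module.End ℝ P)) := by
    refine le_iSup (fun b => realGenEigenspace (LinearMap.prodMap T (0 : Module.End ℝ P)) 0 b)
        0 ((mem_realGenEigenspace_iff _ 0 0 _).2 ⟨1, ?_⟩)
    simp [pow_two]
  have := Submodule.add_mem _ (h1 x x.2) h2
  simpa using this

end Spectral

/-! ## Local center manifolds -/

section CenterManifold

variable {Z : Type*} [NormedAddCommGroup Z] [NormedSpace ℝ Z]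

/-- The graph in `Z` of a map from the center subspace to the hyperbolic subspace. -/
def centerGraph (J : Z →L[ℝ] Z)
    (Ψ : centerSubspace (J : Module.End ℝ Z) → hyperbolicSubspace (J : Module.End ℝ Z)) : Set Z :=
  {z | ∃ c : centerSubspace (J : Module.End ℝ Z), z = (c : Z) + (Ψ c : Z)}

/-- The graph of `Ψ` is, near the origin, a `C^k` center manifold of `ż = S z`, where `S` is a
vector field defined near the equilibrium `0`, with linearization `J` there. -/
structure IsLocalCenterManifold (k : ℕ) (S : Z → Z) (J : Z →L[ℝ] Z)
    (Ψ : centerSubspace (J : Module.End ℝ Z) → hyperbolicSubspace (J : Module.End ℝ Z)) :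
    Prop where
  equilibrium : S 0 = 0
  linearization : HasFDerivAt S J 0
  smooth : ContDiffAt ℝ k Ψ 0
  through_zero : Ψ 0 = 0
  tangent : HasFDerivAt Ψ
    (0 : centerSubspace (J : Module.End ℝ Z) →L[ℝ] hyperbolicSubspace (J : Module.End ℝ Z)) 0
  /-- A solution that stays in a suitable neighbourhood of the origin over a time interval and
  meets the graph at one time of this interval lies on the graph throughout the interval. -/
  locally_invariant : ∃ O ∈ 𝓝 (0 : Z), ∀ (γ : ℝ → Z) (a b : ℝ),
    IsIntegralCurveOn γ (fun _ => S) (Set.Icc a b) → (∀ t ∈ Set.Icc a b, γ t ∈ O) →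
    (∃ t ∈ Set.Icc a b, γ t ∈ centerGraph J Ψ) → ∀ t ∈ Set.Icc a b, γ t ∈ centerGraph J Ψ
  /-- A solution that stays in a suitable neighbourhood of the origin for all times, positive and
  negative, lies on the graph. -/
  contains_bounded : ∃ O ∈ 𝓝 (0 : Z), ∀ γ : ℝ → Z,
    IsIntegralCurve γ (fun _ => S) → (∀ t, γ t ∈ O) → ∀ t, γ t ∈ centerGraph J Ψ

variable {P : Type*} [NormedAddCommGroup P] [NormedSpace ℝ P]

/-- The system `(ẋ, ε̇) = (H (x; ε), 0)` obtained by treating the parameter as a state variable. -/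
def augmented (H : Z × P → Z) : Z × P → Z × P := fun z => (H z, 0)

/-- The linearization `(x, ε) ↦ (J x, 0)` of the augmented system, where `J = D_x H(0; 0)`. -/
def augmentedLin (P : Type*) [NormedAddCommGroup P] [NormedSpace ℝ P] (J : Z →L[ℝ] Z) :
    Z × P →L[ℝ] Z × P :=
  J.prodMap 0

/-- The graph of `Ψ` is a local parameterized center manifold, of class `C^k`, of the family of
vector fields `H (·; ε)` with `J = D_x H(0; 0)`: a local center manifold of the augmented
system. Its dimension is that of `centerSubspace J`. -/
def IsParamCenterManifold (k : ℕ) (H : Z × P → Z) (J : Z →L[ℝ] Z)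
    (Ψ : centerSubspace (augmentedLin P J : Module.End ℝ (Z × P)) →
      hyperbolicSubspace (augmentedLin P J : Module.End ℝ (Z × P))) : Prop :=
  IsLocalCenterManifold k (augmented H) (augmentedLin P J) Ψ

/-- The point `(x, ε)` with `x` in the center subspace of `J`, as a point of the center subspace
of the augmented system. -/
def centerPoint (J : Z →L[ℝ] Z) (x : centerSubspace (J : Module.End ℝ Z)) (e : P) :
    centerSubspace (augmentedLin P J : Module.End ℝ (Z × P)) :=
  ⟨((x : Z), e), mem_centerSubspace_prodMap_zero _ x e⟩

/-- The parameterized reduced vector field `R (x; ε) = π (H (p))`, where `p` is the point of the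
parameterized center manifold over `(x, ε)` and `π` is the projection onto the center subspace
along the hyperbolic subspace. -/
noncomputable def reducedField [FiniteDimensional ℝ Z] (H : Z × P → Z) (J : Z →L[ℝ] Z)
    (Ψ : centerSubspace (augmentedLin P J : Module.End ℝ (Z × P)) →
      hyperbolicSubspace (augmentedLin P J : Module.End ℝ (Z × P))) :
    centerSubspace (J : Module.End ℝ Z) × P → centerSubspace (J : Module.End ℝ Z) :=
  fun z => centerProj (J : Module.End ℝ Z)
    (H ((centerPoint J z.1 z.2 : Z × P) + (Ψ (centerPoint J z.1 z.2) : Z × P)))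

end CenterManifold

/-! ## Polynomial maps and Taylor terms -/

section Taylor

variable {W W' : Type*} [NormedAddCommGroup W] [NormedSpace ℝ W]
  [NormedAddCommGroup W'] [NormedSpace ℝ W']

/-- Polynomial maps from `W` to `W'` with terms of degree `2` through `l`. -/
def IsPolyMap (l : ℕ) (p : W → W') : Prop :=
  ∃ c : (j : ℕ) → ContinuousMultilinearMap ℝ (fun _ : Fin j => W) W',
    ∀ w, p w = ∑ j ∈ Finset.Icc 2 l, c j (fun _ => w)

/-- The terms of degree `2` through `l` of the Taylor expansion of `h` at the origin. -/
noncomputable def taylorTerms (l : ℕ) (h : W → W') : W → W' :=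
  fun w => ∑ j ∈ Finset.Icc 2 l, ((j.factorial : ℝ)⁻¹) • iteratedFDeriv ℝ j h 0 (fun _ => w)

end Taylor

/-! ## Networks of diffusively coupled identical nodes -/

section Network

/-- Positive-definiteness, without any symmetry requirement. -/
def IsPosDefOp {n : ℕ} (D : EuclideanSpace ℝ (Fin n) →L[ℝ] EuclideanSpace ℝ (Fin n)) : Prop :=
  ∀ x, x ≠ 0 → 0 < inner ℝ x (D x)

/-- Node dynamics `ẋ = f (x; ε)`, smooth for `x ∈ U` and `ε ∈ Ω`, which has an equilibrium at the
origin for all `ε ∈ Ω`, with Jacobian `A = D_x f(0; 0)`. -/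
structure IsNodeFamily {n d : ℕ} (U : Set (EuclideanSpace ℝ (Fin n)))
    (Ω : Set (EuclideanSpace ℝ (Fin d)))
    (f : EuclideanSpace ℝ (Fin n) × EuclideanSpace ℝ (Fin d) → EuclideanSpace ℝ (Fin n))
    (A : EuclideanSpace ℝ (Fin n) →L[ℝ] EuclideanSpace ℝ (Fin n)) : Prop where
  isOpen_state : IsOpen U
  zero_mem_state : 0 ∈ U
  isOpen_param : IsOpen Ω
  zero_mem_param : 0 ∈ Ω
  smooth : ContDiffOn ℝ ∞ f (U ×ˢ Ω)
  equilibrium : ∀ e ∈ Ω, f (0, e) = 0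
  jacobian : HasFDerivAt (fun x => f (x, 0)) A 0

variable {V : Type*} [Fintype V] [DecidableEq V]

/-- The network vector field `F (X; ε) - α (L_G ⊗ D) X`, where `X` has the components `X p`,
`p` a vertex of `G`. -/
noncomputable def networkField (G : SimpleGraph V) [DecidableRel G.Adj] {n d : ℕ}
    (f : EuclideanSpace ℝ (Fin n) × EuclideanSpace ℝ (Fin d) → EuclideanSpace ℝ (Fin n))
    (α : ℝ) (D : EuclideanSpace ℝ (Fin n) →L[ℝ] EuclideanSpace ℝ (Fin n)) :
    (V → EuclideanSpace ℝ (Fin n)) × EuclideanSpace ℝ (Fin d) → V → EuclideanSpace ℝ (Fin n) :=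
  fun z p => f (z.1 p, z.2) - α • ∑ j, G.lapMatrix ℝ p j • D (z.1 j)

/-- The Jacobian `id ⊗ A - α L_G ⊗ D` of the network at the origin. -/
noncomputable def networkJacobian (G : SimpleGraph V) [DecidableRel G.Adj] {n : ℕ}
    (A : EuclideanSpace ℝ (Fin n) →L[ℝ] EuclideanSpace ℝ (Fin n))
    (α : ℝ) (D : EuclideanSpace ℝ (Fin n) →L[ℝ] EuclideanSpace ℝ (Fin n)) :
    (V → EuclideanSpace ℝ (Fin n)) →L[ℝ] (V → EuclideanSpace ℝ (Fin n)) :=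
  ContinuousLinearMap.pi fun p =>
    A.comp (ContinuousLinearMap.proj p) -
      α • ∑ j, G.lapMatrix ℝ p j • D.comp (ContinuousLinearMap.proj j)

/-- `G` is `ρ`-versatile for the eigenvalue-eigenvector pair `(lam, v)` of its Laplacian; the
eigenvalue `lam` has algebraic multiplicity one. -/
structure IsVersatile (G : SimpleGraph V) [DecidableRel G.Adj] (ρ : ℕ) (lam : ℝ) (v : V → ℝ) :
    Prop where
  pos_order : 0 < ρ
  pos_eigenvalue : 0 < lam
  simple : Module.finrank ℝ
    (Module.End.maxGenEigenspace (Matrix.toLin' (G.lapMatrix ℝ)) lam) = 1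
  ne_zero : v ≠ 0
  eigenvector : Matrix.mulVec (G.lapMatrix ℝ) v = lam • v
  power_sums : ∀ l : ℕ, 2 ≤ l → l ≤ ρ + 1 → ∑ i, v i ^ l ≠ 0

end Network

/-!
The center subspace of a network whose nodes have the Jacobian `A` and are coupled by `D` splits
along the eigenvectors of the graph Laplacian: on the states `u ⊗ y`, where `u` is an eigenvector for
the eigenvalue `μ`, the network Jacobian acts as the block `A - (α * μ) • D`
(`networkJacobian_nodeLift`, `mem_centerSubspace_networkJacobian`). With `α = 1 / lam` the block for
`lam` is `A - D`.

**The coupling.** In an orthonormal basis adapted to the given vectors, subtract from `A` a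
positive-definite `D` such that `A - D` is strictly upper triangular on the span of these vectors
and negative-definite on the orthogonal complement (`exists_posDef_nilpotent_sub`). Positivity of
`D` is possible because the diagonal entries `⟪xᵢ, A xᵢ⟫` are positive: the entries above the
diagonal are chosen to cancel the entries below in the quadratic form. So `A - D` has a center
subspace of dimension `m` and is nilpotent there, which gives the lower bound for the dimension.
For a versatile graph, a multiple `ζ` of the identity is added to `A` and to `D`. The block for `lam`
stays the same, and the block for any other `μ` is shifted by a nonzero multiple of `ζ`, so that it
is hyperbolic for all but finitely many `ζ` (`exists_network_parameters`). The center subspace then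
consists of the states `v ⊗ w` with `w` in the center subspace of `A - D`.

**Existence of center manifolds** is proved by the method of Lyapunov and Perron
(`exists_isLocalCenterManifold`). The nonlinearity is cut off, and the center manifold consists of
the initial values of those solutions of the modified equation that grow slower than the hyperbolic
rates. They are unique for a given center component (`IsTrichotomy.eq_of_small`), exist by a
contraction argument in a space with an exponential weight (`IsTrichotomy.exists_solution_of_small`),
and depend smoothly on the center component, as long as the weight, which is enlarged with every
derivative, stays within the spectral gap (`IsTrichotomy.exists_contDiff_family`).

**The reduced vector field.** The equilibria `(0, ε)` stay near the origin, hence lie on the center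
manifold, and the reduced vector field vanishes there. Its linearization is the restriction of the
network Jacobian to the center subspace. For the terms of higher order, the Taylor expansion of a
center manifold is unique, and its terms of degree at most `l` depend only on those of the vector
field (`IsLocalCenterManifold.sub_isLittleO`): the leading term of a difference is a polynomial
equivariant under the linear flow, and polynomials of the slowly growing center flow cannot take
nonzero values on a solution in the hyperbolic subspace. Therefore adding terms of degree `l + 1` to
the node dynamics changes the terms of degree `l + 1` of the reduced vector field by their center
component and leaves the lower ones unchanged (`IsParamCenterManifold.reducedField_sub_isLittleO`).
On the states `v ⊗ w` the node `p` contributes a term of degree `i` in the state with the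
factor `v p ^ i`, and the projection to the center subspace weights the nodes with `v p` again. The
center component so contains the power sum `∑ p, v p ^ (i + 1)`, which is nonzero for a versatile
graph, and every term can be prescribed (`exists_multilinear_sum_smul_eq`), one degree after another
(`IsVersatile.exists_taylorTerms_eq`).
-/

universe v

/-! ### Spectral subspaces -/

section SpectralSubspaces

variable {Z : Type*} [AddCommGroup Z] [Module ℝ Z]

/-- The spectral subspace of `T` for a set `S` of real parts: the sum of the real generalized
eigenspaces of the eigenvalues with real part in `S`. -/
def spectralSubspace (T : Module.End ℝ Z) (S : Set ℝ) : Submodule ℝ Z :=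
  ⨆ (a : ℝ) (_ : a ∈ S) (b : ℝ), realGenEigenspace T a b

theorem spectralSubspace_singleton (T : Module.End ℝ Z) :
    spectralSubspace T {0} = centerSubspace T := (centerSubspace_eq T).symm

theorem spectralSubspace_compl_singleton (T : Module.End ℝ Z) :
    spectralSubspace T {0}ᶜ = hyperbolicSubspace T := rfl

theorem spectralSubspace_mono (T : Module.End ℝ Z) {S S' : Set ℝ} (h : S ⊆ S') :
    spectralSubspace T S ≤ spectralSubspace T S' :=
  biSup_mono fun _ ha => h ha

theorem spectralSubspace_union (T : Module.End ℝ Z) (S S' : Set ℝ) :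
    spectralSubspace T (S ∪ S') = spectralSubspace T S ⊔ spectralSubspace T S' :=
  iSup_union

/-- A linear map that intertwines `T` and `T'` maps spectral subspaces to spectral subspaces. -/
theorem map_mem_spectralSubspace {Z' : Type*} [AddCommGroup Z'] [Module ℝ Z']
    {T : Module.End ℝ Z} {T' : Module.End ℝ Z'} (L : Z →ₗ[ℝ] Z')
    (hL : ∀ z, L (T z) = T' (L z)) (S : Set ℝ) {x : Z} (hx : x ∈ spectralSubspace T S) :
    L x ∈ spectralSubspace T' S := by
  have hpoly : ∀ (q : Polynomial ℝ) (z : Z),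
      L (Polynomial.aeval T q z) = Polynomial.aeval T' q (L z) := by
    intro q
    induction q using Polynomial.induction_on with
    | C a => intro z; simp [Module.algebraMap_end_apply]
    | add p q hp hq => intro z; simp [hp, hq]
    | monomial n a ih =>
      intro z
      rw [pow_succ, ← mul_assoc, map_mul, map_mul, Module.End.mul_apply, Module.End.mul_apply]
      simpa [hL] using ih (T z)
  suffices spectralSubspace T S ≤ (spectralSubspace T' S).comap L from this hx
  refine iSup₂_le fun a ha => iSup_le fun b => fun w hw => ?_
  obtain ⟨k, hk⟩ := (mem_realGenEigenspace_iff T a b w).1 hw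
  have : L w ∈ realGenEigenspace T' a b :=
    (mem_realGenEigenspace_iff T' a b _).2 ⟨k, by rw [← hpoly, hk, map_zero]⟩
  exact Submodule.mem_iSup_of_mem a (Submodule.mem_iSup_of_mem ha (Submodule.mem_iSup_of_mem b this))

theorem disjoint_spectralSubspace (T : Module.End ℝ Z) {S S' : Set ℝ} (h : Disjoint S S') :
    Disjoint (spectralSubspace T S) (spectralSubspace T S') := by
  rw [Submodule.disjoint_def]
  intro x hx hy
  obtain ⟨q, hq, hqx⟩ := exists_poly_of_mem_iSup T _ hx
  obtain ⟨r, hr, hrx⟩ := exists_poly_of_mem_iSup T _ hy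
  have hcop : IsCoprime q r := by
    refine isCoprime_of_irreducible_dvd ?_ ?_
    · rintro ⟨rfl, rfl⟩
      exact Set.disjoint_left.1 h (hq 1 (by simp)) (hr 1 (by simp))
    · rintro p hp ⟨s, rfl⟩ ⟨t, rfl⟩
      obtain ⟨z, hz⟩ : ∃ z : ℂ, Polynomial.aeval z p = 0 :=
        IsAlgClosed.exists_aeval_eq_zero _ p (Polynomial.degree_pos_of_irreducible hp).ne'
      exact Set.disjoint_left.1 h (hq z (by rw [map_mul, hz, zero_mul]))
        (hr z (by rw [map_mul, hz, zero_mul]))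
  exact Submodule.disjoint_def.1 (Polynomial.disjoint_ker_aeval_of_isCoprime T hcop) x hqx hrx

theorem isCompl_spectralSubspace [FiniteDimensional ℝ Z] (T : Module.End ℝ Z) (S : Set ℝ) :
    IsCompl (spectralSubspace T S) (spectralSubspace T Sᶜ) := by
  refine ⟨disjoint_spectralSubspace T disjoint_compl_right, codisjoint_iff.2 ?_⟩
  rw [← spectralSubspace_union, Set.union_compl_self, ← Set.union_compl_self ({0} : Set ℝ),
    spectralSubspace_union, spectralSubspace_singleton, spectralSubspace_compl_singleton]
  exact (isCompl_center_hyperbolic T).sup_eq_top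

end SpectralSubspaces

section SpectralProjections

variable {Z : Type*} [NormedAddCommGroup Z] [NormedSpace ℝ Z] [FiniteDimensional ℝ Z]

/-- The projection onto the spectral subspace of `J` for `S`, along the one for `Sᶜ`. -/
noncomputable def spectralProj (J : Z →L[ℝ] Z) (S : Set ℝ) : Z →L[ℝ] Z :=
  LinearMap.toContinuousLinearMap
    ((spectralSubspace (J : Module.End ℝ Z) S).subtype ∘ₗ
      Submodule.projectionOnto _ _ (isCompl_spectralSubspace (J : Module.End ℝ Z) S))

variable (J : Z →L[ℝ] Z) (S : Set ℝ)

theorem spectralProj_mem (z : Z) :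
    spectralProj J S z ∈ spectralSubspace (J : Module.End ℝ Z) S := by
  simp [spectralProj]

variable {S} in
theorem spectralProj_of_mem {z : Z} (hz : z ∈ spectralSubspace (J : Module.End ℝ Z) S) :
    spectralProj J S z = z := by
  have := Submodule.projectionOnto_apply_left (isCompl_spectralSubspace (J : Module.End ℝ Z) S)
    ⟨z, hz⟩
  simp [spectralProj, this]

variable {S} in
theorem spectralProj_of_mem_disjoint {S' : Set ℝ} (h : Disjoint S S') {z : Z}
    (hz : z ∈ spectralSubspace (J : Module.End ℝ Z) S') :
    spectralProj J S z = 0 := by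
  have hz' := spectralSubspace_mono (J : Module.End ℝ Z) h.subset_compl_left hz
  have := Submodule.projectionOnto_apply_right
    (isCompl_spectralSubspace (J : Module.End ℝ Z) S) ⟨z, hz'⟩
  simp [spectralProj, this]

theorem exists_center_stable_unstable (z : Z) :
    ∃ c ∈ spectralSubspace (J : Module.End ℝ Z) {0},
    ∃ s ∈ spectralSubspace (J : Module.End ℝ Z) (Set.Iio 0),
    ∃ u ∈ spectralSubspace (J : Module.End ℝ Z) (Set.Ioi 0), z = c + s + u := by
  have h : z ∈ spectralSubspace (J : Module.End ℝ Z) {0} ⊔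
      spectralSubspace (J : Module.End ℝ Z) {0}ᶜ := by
    rw [(isCompl_spectralSubspace (J : Module.End ℝ Z) {0}).sup_eq_top]
    trivial
  rw [← Set.Iio_union_Ioi, spectralSubspace_union] at h
  obtain ⟨c, hc, y, hy, rfl⟩ := Submodule.mem_sup.1 h
  obtain ⟨s, hs, u, hu, rfl⟩ := Submodule.mem_sup.1 hy
  exact ⟨c, hc, s, hs, u, hu, (add_assoc _ _ _).symm⟩

end SpectralProjections

/-! ### Exponential growth rates -/

section Growth

variable {Z : Type*} [NormedAddCommGroup Z] [NormedSpace ℝ Z]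

open NormedSpace in
theorem hasDerivAt_exp_smul_apply [CompleteSpace Z] (J : Z →L[ℝ] Z) (x : Z) (t : ℝ) :
    HasDerivAt (fun t : ℝ => exp (t • J) x) (J (exp (t • J) x)) t :=
  (hasDerivAt_exp_smul_const' (𝕂 := ℝ) J t).clm_apply (hasDerivAt_const t x) |>.congr_deriv
    (by simp)

/-- A scalar solution of `f' = l f + g` grows no faster than the larger of `e^{(Re l) t}` and
`g`. -/
theorem exists_exp_bound_of_hasDerivAt {f g : ℝ → ℂ} {l : ℂ} {τ C : ℝ} (hl : l.re < τ)
    (hf : ∀ t, HasDerivAt f (l * f t + g t) t) (hg : ∀ t, 0 ≤ t → ‖g t‖ ≤ C * Real.exp (τ * t)) :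
    ∃ C', ∀ t, 0 ≤ t → ‖f t‖ ≤ C' * Real.exp (τ * t) := by
  have hC : 0 ≤ C := by simpa using (norm_nonneg _).trans (hg 0 le_rfl)
  set κ := τ - l.re with hκ
  have hκ0 : 0 < κ := by rw [hκ]; linarith
  refine ⟨‖f 0‖ + C / κ, fun T hT => ?_⟩
  -- `e^{-l t} f t` has the derivative `e^{-l t} g t`, so it is dominated by the primitive `hB`
  have hd : ∀ t : ℝ, HasDerivAt (fun t : ℝ => Complex.exp (-l * t) * f t)
      (Complex.exp (-l * t) * g t) t := by
    intro t
    have h1 : HasDerivAt (fun t : ℝ => Complex.exp (-l * t)) (Complex.exp (-l * t) * (-l)) t := by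
      have h2 : HasDerivAt (fun t : ℝ => -l * (t : ℂ)) (-l) t := by
        simpa using (Complex.ofRealCLM.hasDerivAt (x := t)).const_mul (-l)
      exact h2.cexp
    refine (h1.mul (hf t)).congr_deriv ?_
    ring
  have hnorm : ∀ t : ℝ, ‖Complex.exp (-l * t)‖ = Real.exp (-l.re * t) := by
    intro t; rw [Complex.norm_exp]; simp
  have hB : ∀ t : ℝ, HasDerivAt (fun t : ℝ => ‖f 0‖ + C / κ * (Real.exp (κ * t) - 1))
      (C * Real.exp (κ * t)) t := by
    intro t
    have h1 : HasDerivAt (fun t : ℝ => Real.exp (κ * t)) (Real.exp (κ * t) * κ) t := by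
      simpa using ((hasDerivAt_id t).const_mul κ).exp
    refine (((h1.sub_const 1).const_mul (C / κ)).const_add ‖f 0‖).congr_deriv ?_
    field_simp
  have key := image_norm_le_of_norm_deriv_right_le_deriv_boundary
    (f := fun t : ℝ => Complex.exp (-l * t) * f t) (f' := fun t => Complex.exp (-l * t) * g t)
    (a := 0) (b := T) (fun t _ => (hd t).continuousAt.continuousWithinAt)
    (fun t _ => (hd t).hasDerivWithinAt)
    (B := fun t => ‖f 0‖ + C / κ * (Real.exp (κ * t) - 1)) (by simp) hB
    (fun t ht => ?_) (x := T) (by simp [hT])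
  · rw [norm_mul, hnorm] at key
    have h2 : ‖f T‖ = Real.exp (l.re * T) * (Real.exp (-l.re * T) * ‖f T‖) := by
      rw [← mul_assoc, ← Real.exp_add]; simp
    have h3 : Real.exp (κ * T) = Real.exp (τ * T) * Real.exp (-(l.re * T)) := by
      rw [← Real.exp_add]; congr 1; rw [hκ]; ring
    have h4 : Real.exp (l.re * T) ≤ Real.exp (τ * T) :=
      Real.exp_le_exp.2 (mul_le_mul_of_nonneg_right hl.le hT)
    have h5 : Real.exp (l.re * T) * Real.exp (-(l.re * T)) = 1 := by
      rw [← Real.exp_add]; simp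
    rw [h2]
    calc Real.exp (l.re * T) * (Real.exp (-l.re * T) * ‖f T‖)
        ≤ Real.exp (l.re * T) * (‖f 0‖ + C / κ * (Real.exp (κ * T) - 1)) := by gcongr
      _ ≤ Real.exp (l.re * T) * (‖f 0‖ + C / κ * Real.exp (κ * T)) := by gcongr; linarith
      _ = Real.exp (l.re * T) * ‖f 0‖ + C / κ * Real.exp (τ * T) := by
        rw [h3]; linear_combination (C / κ * Real.exp (τ * T)) * h5
      _ ≤ Real.exp (τ * T) * ‖f 0‖ + C / κ * Real.exp (τ * T) := by gcongr
      _ = _ := by ring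
  · rw [norm_mul, hnorm]
    calc Real.exp (-l.re * t) * ‖g t‖ ≤ Real.exp (-l.re * t) * (C * Real.exp (τ * t)) := by
          gcongr; exact hg t ht.1
      _ = C * Real.exp (κ * t) := by
          rw [mul_left_comm, ← Real.exp_add]; congr 2; rw [hκ]; ring

/-- Precomposition with `J`, on the complex space of complex-valued functionals. -/
noncomputable def precompEnd (J : Z →L[ℝ] Z) : Module.End ℂ (Z →L[ℝ] ℂ) where
  toFun φ := φ.comp J
  map_add' _ _ := rfl
  map_smul' _ _ := rfl

open Polynomial in
theorem aeval_precompEnd (J : Z →L[ℝ] Z) (q : ℝ[X]) (φ : Z →L[ℝ] ℂ) (x : Z) :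
    aeval (precompEnd J) (q.map (algebraMap ℝ ℂ)) φ x = φ (aeval (J : Module.End ℝ Z) q x) := by
  induction q using Polynomial.induction_on generalizing φ x with
  | C a => simp [Module.algebraMap_end_apply]
  | add p q hp hq =>
    rw [Polynomial.map_add, map_add, map_add, LinearMap.add_apply, LinearMap.add_apply, map_add,
      add_apply, hp, hq]
  | monomial n a ih =>
    have h1 : aeval (J : Module.End ℝ Z) (C a * X ^ (n + 1)) x =
        aeval (J : Module.End ℝ Z) (C a * X ^ n) (J x) := by
      rw [pow_succ, ← mul_assoc, map_mul, Module.End.mul_apply, aeval_X]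
      rfl
    rw [h1, ← ih, pow_succ', mul_left_comm, Polynomial.map_mul, map_mul, Module.End.mul_apply,
      map_X, aeval_X]
    rfl

open Polynomial NormedSpace in
/-- Growth of a functional `φ` along the flow, when `φ ∘ p(J)` vanishes along it and the roots of `p`
have real part less than `τ`. The proof is by induction on the degree: a root `l` of `p` is split
off, `φ` solves a scalar equation with rate `l`, and its inhomogeneity `φ ∘ (J - l)` is annihilated
by the other factor. -/
theorem exists_exp_bound_functional [CompleteSpace Z] (J : Z →L[ℝ] Z) (x : Z) {τ : ℝ} (p : ℂ[X])
    (hp : p ≠ 0) (hroot : ∀ z, p.IsRoot z → z.re < τ) (φ : Z →L[ℝ] ℂ)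
    (h : ∀ t : ℝ, aeval (precompEnd J) p φ (exp (t • J) x) = 0) :
    ∃ C, ∀ t, 0 ≤ t → ‖φ (exp (t • J) x)‖ ≤ C * Real.exp (τ * t) := by
  induction hn : p.natDegree generalizing p φ with
  | zero =>
    obtain ⟨c, rfl⟩ := natDegree_eq_zero.1 hn
    have hc : c ≠ 0 := by rintro rfl; simp at hp
    refine ⟨0, fun t _ => ?_⟩
    have := h t
    simp only [aeval_C, Module.algebraMap_end_apply, smul_apply, smul_eq_mul,
      mul_eq_zero, hc, false_or] at this
    simp [this]
  | succ n ih =>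
    obtain ⟨l, hl⟩ := IsAlgClosed.exists_root p (by
      rw [degree_eq_natDegree hp, hn]; exact_mod_cast Nat.succ_ne_zero n)
    obtain ⟨r, rfl⟩ := dvd_iff_isRoot.2 hl
    have hr : r ≠ 0 := right_ne_zero_of_mul hp
    obtain ⟨C, hC⟩ := ih r hr (fun z hz => hroot z (by simp [hz.eq_zero]))
      (aeval (precompEnd J) (X - Polynomial.C l) φ) (fun t => by
        rw [← Module.End.mul_apply, ← map_mul, mul_comm]; exact h t)
      (by rw [natDegree_mul (X_sub_C_ne_zero l) hr, natDegree_X_sub_C] at hn; omega)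
    refine exists_exp_bound_of_hasDerivAt (hroot l hl) (fun t => ?_) hC
    refine (φ.hasFDerivAt.comp_hasDerivAt t (hasDerivAt_exp_smul_apply J x t)).congr_deriv ?_
    have h1 : aeval (precompEnd J) (X - Polynomial.C l) φ = φ.comp J - l • φ := by
      rw [map_sub, aeval_X, aeval_C, LinearMap.sub_apply, Module.algebraMap_end_apply]
      rfl
    rw [h1]
    simp

open Polynomial NormedSpace in
/-- If `q(J) x = 0` and the roots of `q` have real part less than `τ`, then the solution with initial
value `x` grows at most like `exp (τ t)`. -/
theorem exists_exp_bound_of_poly [FiniteDimensional ℝ Z] (J : Z →L[ℝ] Z) (x : Z) {τ : ℝ}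
    (q : ℝ[X]) (hroot : ∀ z : ℂ, aeval z q = 0 → z.re < τ)
    (h : aeval (J : Module.End ℝ Z) q x = 0) :
    ∃ C, ∀ t, 0 ≤ t → ‖exp (t • J) x‖ ≤ C * Real.exp (τ * t) := by
  have : CompleteSpace Z := FiniteDimensional.complete ℝ Z
  have hcomm : ∀ t : ℝ, aeval (J : Module.End ℝ Z) q (exp (t • J) x) = 0 := by
    intro t
    have hc : Commute (J : Module.End ℝ Z) ((exp (t • J) : Z →L[ℝ] Z) : Module.End ℝ Z) := by
      have h1 : Commute J (exp (t • J)) := ((Commute.refl J).smul_right t).exp_right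
      ext z
      exact DFunLike.congr_fun h1.eq z
    have hc2 : ∀ r : ℝ[X], Commute (aeval (J : Module.End ℝ Z) r)
        ((exp (t • J) : Z →L[ℝ] Z) : Module.End ℝ Z) := by
      intro r
      induction r using Polynomial.induction_on' with
      | add p q hp hq => rw [map_add]; exact hp.add_left hq
      | monomial n a =>
        rw [aeval_monomial]
        exact (Algebra.commute_algebraMap_left a _).mul_left (hc.pow_left n)
    have := DFunLike.congr_fun (hc2 q).eq x
    simp only [Module.End.mul_apply, h, map_zero] at this
    exact this
  have hq0 : q ≠ 0 := by
    rintro rfl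
    have := hroot ((τ + 1 : ℝ) : ℂ) (by simp)
    simp at this
    linarith
  let b := Module.finBasis ℝ Z
  have hb : ∀ i, ∃ C, ∀ t, 0 ≤ t → ‖b.coord i (exp (t • J) x)‖ ≤ C * Real.exp (τ * t) := by
    intro i
    obtain ⟨C, hC⟩ := exists_exp_bound_functional J x (τ := τ) (q.map (algebraMap ℝ ℂ))
      (by rwa [Ne, Polynomial.map_eq_zero]) (fun z hz => hroot z (by
        rwa [IsRoot, eval_map_algebraMap] at hz))
      (Complex.ofRealCLM.comp (LinearMap.toContinuousLinearMap (b.coord i)))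
      (fun t => by rw [aeval_precompEnd, hcomm, map_zero])
    exact ⟨C, fun t ht => by simpa using hC t ht⟩
  choose C hC using hb
  refine ⟨∑ i, C i * ‖b i‖, fun t ht => ?_⟩
  calc ‖exp (t • J) x‖ = ‖∑ i, b.coord i (exp (t • J) x) • b i‖ := by
        conv_lhs => rw [← b.sum_repr (exp (t • J) x)]
        rfl
    _ ≤ ∑ i, ‖b.coord i (exp (t • J) x) • b i‖ := norm_sum_le _ _
    _ ≤ ∑ i, C i * Real.exp (τ * t) * ‖b i‖ := by
        gcongr with i
        rw [norm_smul]
        gcongr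
        exact hC i t ht
    _ = _ := by rw [Finset.sum_mul]; exact Finset.sum_congr rfl fun i _ => by ring

end Growth

/-! ### Exponential trichotomies -/

section Trichotomy

variable {Z : Type*} [NormedAddCommGroup Z] [NormedSpace ℝ Z]

open NormedSpace in
/-- An exponential trichotomy of the flow `exp (t J)`: projections onto a center, a stable and an
unstable part that commute with `J`, where the center part grows at most like `exp (η |t|)` and the
stable (unstable) part decays like `exp (-β |t|)` in forward (backward) time. -/
structure IsTrichotomy (J Pc Ps Pu : Z →L[ℝ] Z) (η β C : ℝ) : Prop where
  rate_pos : 0 < η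
  gap_pos : 0 < β
  const_pos : 0 < C
  sum : ∀ z, Pc z + Ps z + Pu z = z
  comm_c : ∀ z, Pc (J z) = J (Pc z)
  comm_s : ∀ z, Ps (J z) = J (Ps z)
  comm_u : ∀ z, Pu (J z) = J (Pu z)
  cc : ∀ z, Pc (Pc z) = Pc z
  ss : ∀ z, Ps (Ps z) = Ps z
  uu : ∀ z, Pu (Pu z) = Pu z
  cs : ∀ z, Pc (Ps z) = 0
  cu : ∀ z, Pc (Pu z) = 0
  sc : ∀ z, Ps (Pc z) = 0
  su : ∀ z, Ps (Pu z) = 0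
  uc : ∀ z, Pu (Pc z) = 0
  us : ∀ z, Pu (Ps z) = 0
  center : ∀ t z, ‖exp (t • J) (Pc z)‖ ≤ C * Real.exp (η * |t|) * ‖z‖
  stable : ∀ t z, 0 ≤ t → ‖exp (t • J) (Ps z)‖ ≤ C * Real.exp (-(β * t)) * ‖z‖
  unstable : ∀ t z, 0 ≤ t → ‖exp ((-t) • J) (Pu z)‖ ≤ C * Real.exp (-(β * t)) * ‖z‖

/-- Time reversal exchanges the stable and the unstable part. -/
theorem IsTrichotomy.reverse {J Pc Ps Pu : Z →L[ℝ] Z} {η β C : ℝ}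
    (h : IsTrichotomy J Pc Ps Pu η β C) : IsTrichotomy (-J) Pc Pu Ps η β C where
  rate_pos := h.rate_pos
  gap_pos := h.gap_pos
  const_pos := h.const_pos
  sum z := by rw [add_right_comm]; exact h.sum z
  comm_c z := by simp [h.comm_c]
  comm_s z := by simp [h.comm_u]
  comm_u z := by simp [h.comm_s]
  cc := h.cc
  ss := h.uu
  uu := h.ss
  cs := h.cu
  cu := h.cs
  sc := h.uc
  su := h.us
  uc := h.sc
  us := h.su
  center t z := by
    have := h.center (-t) z
    rwa [abs_neg, neg_smul, ← smul_neg] at this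
  stable t z ht := by
    have := h.unstable t z ht
    rwa [neg_smul, ← smul_neg] at this
  unstable t z ht := by
    have := h.stable t z ht
    rwa [neg_smul, smul_neg, neg_neg]

open Polynomial in
/-- An element of a spectral subspace of `J` is annihilated by a polynomial in `-J` with roots in the
reflected region: this gives growth estimates in backward time. -/
theorem exists_poly_neg (J : Z →L[ℝ] Z) {S : Set ℝ} {x : Z}
    (hx : x ∈ spectralSubspace (J : Module.End ℝ Z) S) :
    ∃ q : ℝ[X], (∀ z : ℂ, aeval z q = 0 → -z.re ∈ S) ∧
      aeval ((-J : Z →L[ℝ] Z) : Module.End ℝ Z) q x = 0 := by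
  obtain ⟨q, hq, hqx⟩ := exists_poly_of_mem_iSup _ S hx
  refine ⟨q.comp (-X), fun z hz => ?_, ?_⟩
  · rw [aeval_comp] at hz
    simpa using hq _ hz
  · rw [aeval_comp, map_neg, aeval_X]
    have : -((-J : Z →L[ℝ] Z) : Module.End ℝ Z) = (J : Module.End ℝ Z) := by
      ext z; simp
    rw [this, hqx]

open Polynomial in
theorem exists_neg_bound_of_roots {q : ℝ[X]} (hq : ∀ z : ℂ, aeval z q = 0 → z.re < 0) :
    ∃ β > 0, ∀ z : ℂ, aeval z q = 0 → z.re < -β := by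
  have hq0 : q ≠ 0 := by
    rintro rfl
    simpa using hq 0 (by simp)
  have hfin : {z : ℂ | aeval z q = 0}.Finite := by
    refine Set.Finite.subset (Polynomial.rootSet_finite q ℂ) fun z hz => ?_
    rw [Polynomial.mem_rootSet]
    exact ⟨hq0, hz⟩
  have h : ∀ᶠ β in 𝓝[>] (0 : ℝ), ∀ z ∈ {z : ℂ | aeval z q = 0}, z.re < -β := by
    rw [Filter.eventually_all_finite hfin]
    intro z hz
    have h1 : z.re < 0 := hq z hz
    filter_upwards [Ioo_mem_nhdsGT (show (0 : ℝ) < -z.re by linarith)] with β hβ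
    linarith [hβ.2]
  obtain ⟨β, h1, h2⟩ := (h.and self_mem_nhdsWithin).exists
  exact ⟨β, h2, h1⟩

variable [FiniteDimensional ℝ Z]

open NormedSpace in
/-- Pointwise exponential bounds are uniform, by linearity and finite dimension. -/
theorem exists_uniform_exp_bound (T P : Z →L[ℝ] Z) {τ : ℝ}
    (h : ∀ z, ∃ C, ∀ t, 0 ≤ t → ‖exp (t • T) (P z)‖ ≤ C * Real.exp (τ * t)) :
    ∃ C, ∀ t z, 0 ≤ t → ‖exp (t • T) (P z)‖ ≤ C * Real.exp (τ * t) * ‖z‖ := by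
  let b := Module.finBasis ℝ Z
  choose c hc using fun i => h (b i)
  refine ⟨∑ i, c i * ‖LinearMap.toContinuousLinearMap (b.coord i)‖, fun t z ht => ?_⟩
  have hc0 : ∀ i, 0 ≤ c i := fun i => by simpa using (norm_nonneg _).trans (hc i 0 le_rfl)
  have h1 : exp (t • T) (P z) = ∑ i, b.coord i z • exp (t • T) (P (b i)) := by
    conv_lhs => rw [← b.sum_repr z, map_sum, map_sum]
    simp only [map_smul, Module.Basis.coord_apply]
  rw [h1]
  refine (norm_sum_le _ _).trans ?_
  rw [Finset.sum_mul, Finset.sum_mul]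
  refine Finset.sum_le_sum fun i _ => ?_
  rw [norm_smul]
  calc ‖b.coord i z‖ * ‖exp (t • T) (P (b i))‖
      ≤ (‖LinearMap.toContinuousLinearMap (b.coord i)‖ * ‖z‖) * (c i * Real.exp (τ * t)) := by
        gcongr
        · exact (LinearMap.toContinuousLinearMap (b.coord i)).le_opNorm z
        · exact hc i t ht
    _ = _ := by ring

open NormedSpace in
/-- On the subspace of the eigenvalues with negative real part, the flow decays exponentially. -/
theorem exists_stable_bound (J P : Z →L[ℝ] Z)
    (hP : ∀ z, P z ∈ spectralSubspace (J : Module.End ℝ Z) (Set.Iio 0)) :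
    ∃ β > 0, ∃ C, ∀ t z, 0 ≤ t → ‖exp (t • J) (P z)‖ ≤ C * Real.exp (-(β * t)) * ‖z‖ := by
  have h1 : ∀ z, ∃ β > 0, ∃ C, ∀ t, 0 ≤ t → ‖exp (t • J) (P z)‖ ≤ C * Real.exp (-(β * t)) := by
    intro z
    obtain ⟨q, hq, hqx⟩ := exists_poly_of_mem_iSup _ _ (hP z)
    obtain ⟨β, hβ, h⟩ := exists_neg_bound_of_roots hq
    obtain ⟨C, hC⟩ := exists_exp_bound_of_poly J (P z) q h hqx
    exact ⟨β, hβ, C, fun t ht => by simpa using hC t ht⟩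
  let b := Module.finBasis ℝ Z
  choose β hβ c hc using fun i => h1 (b i)
  obtain ⟨γ, hγ, hγ0⟩ : ∃ γ > 0, ∀ i, γ ≤ β i := by
    have h : ∀ᶠ γ in 𝓝[>] (0 : ℝ), ∀ i, γ ≤ β i := by
      rw [Filter.eventually_all]
      intro i
      filter_upwards [Ioo_mem_nhdsGT (hβ i)] with γ hγ using hγ.2.le
    obtain ⟨γ, h1, h2⟩ := (h.and self_mem_nhdsWithin).exists
    exact ⟨γ, h2, h1⟩
  obtain ⟨C, hC⟩ := exists_uniform_exp_bound J P (τ := -γ) (fun z => by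
    refine ⟨∑ i, |b.coord i z| * c i, fun t ht => ?_⟩
    have hc0 : ∀ i, 0 ≤ c i := fun i => by simpa using (norm_nonneg _).trans (hc i 0 le_rfl)
    have h1 : exp (t • J) (P z) = ∑ i, b.coord i z • exp (t • J) (P (b i)) := by
      conv_lhs => rw [← b.sum_repr z, map_sum, map_sum]
      simp only [map_smul, Module.Basis.coord_apply]
    rw [h1, Finset.sum_mul]
    refine (norm_sum_le _ _).trans (Finset.sum_le_sum fun i _ => ?_)
    rw [norm_smul, mul_assoc, Real.norm_eq_abs]
    gcongr
    refine (hc i t ht).trans ?_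
    have := hc0 i
    gcongr
    nlinarith [hγ0 i])
  exact ⟨γ, hγ, C, fun t z ht => by simpa using hC t z ht⟩

/-- The spectral projections of a linear map form an exponential trichotomy, with a spectral gap
`β` that does not depend on the growth rate `η` of the center part. -/
theorem exists_isTrichotomy (J : Z →L[ℝ] Z) :
    ∃ β > 0, ∀ η > 0, ∃ C, IsTrichotomy J (spectralProj J {0}) (spectralProj J (Set.Iio 0))
      (spectralProj J (Set.Ioi 0)) η β C := by
  obtain ⟨β₁, hβ₁, C₁, h₁⟩ := exists_stable_bound J (spectralProj J (Set.Iio 0))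
    (spectralProj_mem J _)
  obtain ⟨β₂, hβ₂, C₂, h₂⟩ := exists_stable_bound (-J) (spectralProj J (Set.Ioi 0)) (fun z => by
    have h := spectralProj_mem J (Set.Ioi 0) z
    suffices spectralSubspace (J : Module.End ℝ Z) (Set.Ioi 0) ≤
        spectralSubspace ((-J : Z →L[ℝ] Z) : Module.End ℝ Z) (Set.Iio 0) from this h
    refine iSup_le fun a => iSup_le fun ha => iSup_le fun b => fun w hw => ?_
    refine Submodule.mem_iSup_of_mem (-a) (Submodule.mem_iSup_of_mem
      (by simpa using ha) (Submodule.mem_iSup_of_mem b ?_))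
    have he : (((-J : Z →L[ℝ] Z) : Module.End ℝ Z) - algebraMap ℝ (Module.End ℝ Z) (-a)) ^ 2 =
        ((J : Module.End ℝ Z) - algebraMap ℝ (Module.End ℝ Z) a) ^ 2 := by
      have : ((-J : Z →L[ℝ] Z) : Module.End ℝ Z) = -(J : Module.End ℝ Z) := by ext z; simp
      rw [this, map_neg, ← neg_sq]
      congr 1
      abel
    rw [realGenEigenspace, he]
    exact hw)
  refine ⟨min β₁ β₂, lt_min hβ₁ hβ₂, fun η hη => ?_⟩
  obtain ⟨C₃, h₃⟩ := exists_uniform_exp_bound J (spectralProj J {0}) (τ := η) (fun z => by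
    obtain ⟨q, hq, hqx⟩ := exists_poly_of_mem_iSup _ _ (spectralProj_mem J {0} z)
    exact exists_exp_bound_of_poly J _ q (fun w hw => by rw [hq w hw]; exact hη) hqx)
  obtain ⟨C₄, h₄⟩ := exists_uniform_exp_bound (-J) (spectralProj J {0}) (τ := η) (fun z => by
    obtain ⟨q, hq, hqx⟩ := exists_poly_neg J (spectralProj_mem J {0} z)
    exact exists_exp_bound_of_poly (-J) _ q (fun w hw => by
      have : -w.re = 0 := hq w hw
      linarith) hqx)
  have d1 : Disjoint ({0} : Set ℝ) (Set.Iio 0) := by simp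
  have d2 : Disjoint ({0} : Set ℝ) (Set.Ioi 0) := by simp
  have d3 : Disjoint (Set.Iio (0 : ℝ)) (Set.Ioi 0) :=
    Set.disjoint_left.2 fun a h1 h2 => lt_asymm (Set.mem_Iio.1 h1) (Set.mem_Ioi.1 h2)
  have hcomm : ∀ (S : Set ℝ) z, z ∈ spectralSubspace (J : Module.End ℝ Z) S →
      J z ∈ spectralSubspace (J : Module.End ℝ Z) S := fun S z hz =>
    map_mem_spectralSubspace (J : Z →ₗ[ℝ] Z) (fun _ => rfl) S hz
  have hC : 0 < max (max C₁ C₂) (max (max C₃ C₄) 1) := by positivity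
  refine ⟨max (max C₁ C₂) (max (max C₃ C₄) 1), hη, lt_min hβ₁ hβ₂, hC,
    fun z => ?_, fun z => ?_, fun z => ?_, fun z => ?_,
    fun z => spectralProj_of_mem J (spectralProj_mem J _ z),
    fun z => spectralProj_of_mem J (spectralProj_mem J _ z),
    fun z => spectralProj_of_mem J (spectralProj_mem J _ z),
    fun z => spectralProj_of_mem_disjoint J d1 (spectralProj_mem J _ z),
    fun z => spectralProj_of_mem_disjoint J d2 (spectralProj_mem J _ z),
    fun z => spectralProj_of_mem_disjoint J d1.symm (spectralProj_mem J _ z),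
    fun z => spectralProj_of_mem_disjoint J d3 (spectralProj_mem J _ z),
    fun z => spectralProj_of_mem_disjoint J d2.symm (spectralProj_mem J _ z),
    fun z => spectralProj_of_mem_disjoint J d3.symm (spectralProj_mem J _ z),
    fun t z => ?_, fun t z ht => ?_, fun t z ht => ?_⟩
  · obtain ⟨c, hc, s, hs, u, hu, rfl⟩ := exists_center_stable_unstable J z
    simp [spectralProj_of_mem J hc, spectralProj_of_mem J hs, spectralProj_of_mem J hu,
      spectralProj_of_mem_disjoint J d1 hs, spectralProj_of_mem_disjoint J d2 hu,
      spectralProj_of_mem_disjoint J d1.symm hc, spectralProj_of_mem_disjoint J d3 hu,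
      spectralProj_of_mem_disjoint J d2.symm hc, spectralProj_of_mem_disjoint J d3.symm hs]
  · obtain ⟨c, hc, s, hs, u, hu, rfl⟩ := exists_center_stable_unstable J z
    simp [spectralProj_of_mem J hc, spectralProj_of_mem J (hcomm _ _ hc),
      spectralProj_of_mem_disjoint J d1 hs, spectralProj_of_mem_disjoint J d2 hu,
      spectralProj_of_mem_disjoint J d1 (hcomm _ _ hs),
      spectralProj_of_mem_disjoint J d2 (hcomm _ _ hu)]
  · obtain ⟨c, hc, s, hs, u, hu, rfl⟩ := exists_center_stable_unstable J z
    simp [spectralProj_of_mem J hs, spectralProj_of_mem J (hcomm _ _ hs),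
      spectralProj_of_mem_disjoint J d1.symm hc, spectralProj_of_mem_disjoint J d3 hu,
      spectralProj_of_mem_disjoint J d1.symm (hcomm _ _ hc),
      spectralProj_of_mem_disjoint J d3 (hcomm _ _ hu)]
  · obtain ⟨c, hc, s, hs, u, hu, rfl⟩ := exists_center_stable_unstable J z
    simp [spectralProj_of_mem J hu, spectralProj_of_mem J (hcomm _ _ hu),
      spectralProj_of_mem_disjoint J d2.symm hc, spectralProj_of_mem_disjoint J d3.symm hs,
      spectralProj_of_mem_disjoint J d2.symm (hcomm _ _ hc),
      spectralProj_of_mem_disjoint J d3.symm (hcomm _ _ hs)]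
  · rcases le_total 0 t with ht | ht
    · rw [abs_of_nonneg ht]
      refine (h₃ t z ht).trans ?_
      gcongr
      simp
    · rw [abs_of_nonpos ht]
      have := h₄ (-t) z (by linarith)
      rw [neg_smul, smul_neg, neg_neg] at this
      refine this.trans ?_
      gcongr
      simp
  · refine (h₁ t z ht).trans ?_
    gcongr
    · simp
    · exact min_le_left _ _
  · have := h₂ t z ht
    rw [smul_neg, ← neg_smul] at this
    refine this.trans ?_
    gcongr
    · simp
    · exact min_le_right _ _

end Trichotomy

/-! ### Exponentially bounded solutions of linear equations -/

section Perron

open NormedSpace Filter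

variable {Z : Type*} [NormedAddCommGroup Z] [NormedSpace ℝ Z]

/-- The mean value inequality for a derivative that is bounded by an exponential. -/
theorem norm_le_of_deriv_le_exp {y y' : ℝ → Z} {a b M κ : ℝ} (hab : a ≤ b) (hκ : 0 < κ)
    (hy : ∀ s, HasDerivAt y (y' s) s)
    (hb : ∀ s ∈ Set.Ico a b, ‖y' s‖ ≤ M * Real.exp (κ * s)) :
    ‖y b‖ ≤ ‖y a‖ + M / κ * (Real.exp (κ * b) - Real.exp (κ * a)) := by
  have hB : ∀ s : ℝ, HasDerivAt
      (fun s : ℝ => ‖y a‖ + M / κ * (Real.exp (κ * s) - Real.exp (κ * a)))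
      (M * Real.exp (κ * s)) s := by
    intro s
    have h1 : HasDerivAt (fun t : ℝ => Real.exp (κ * t)) (Real.exp (κ * s) * κ) s := by
      simpa using ((hasDerivAt_id s).const_mul κ).exp
    refine (((h1.sub_const _).const_mul (M / κ)).const_add ‖y a‖).congr_deriv ?_
    field_simp
  exact image_norm_le_of_norm_deriv_right_le_deriv_boundary
    (fun t _ => (hy t).continuousAt.continuousWithinAt) (fun t _ => (hy t).hasDerivWithinAt)
    (by simp) hB hb (Set.right_mem_Icc.2 hab)

variable {J Pc Ps Pu : Z →L[ℝ] Z} {η β C : ℝ}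

theorem exp_comm_apply {J P : Z →L[ℝ] Z} (h : ∀ z, P (J z) = J (P z)) (t : ℝ) (z : Z) :
    P (exp (t • J) z) = exp (t • J) (P z) := by
  have h1 : Commute P J := ContinuousLinearMap.ext h
  exact DFunLike.congr_fun ((h1.smul_right t).exp_right).eq z

theorem hasDerivAt_reverse {u g : ℝ → Z} (hu : ∀ t, HasDerivAt u (J (u t) + g t) t) (t : ℝ) :
    HasDerivAt (fun t => u (-t)) ((-J) (u (-t)) + -g (-t)) t := by
  have := (hu (-t)).scomp t (hasDerivAt_neg t)
  refine this.congr_deriv ?_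
  simp [add_comm]

/-- The factor by which the solution operator of `u' = J u + g` may enlarge `g`, in the norms with
weight `exp (μ |t|)` for any `μ` between `2 η` and `β / 2`. The center part contributes `1 / η`, the
stable and the unstable part contribute `2 / β` each. -/
noncomputable def perronConst (η β C : ℝ) : ℝ := C * (1 / η + 4 / β)

theorem IsTrichotomy.perronConst_pos (h : IsTrichotomy J Pc Ps Pu η β C) :
    0 < perronConst η β C := by
  have := h.const_pos
  have := h.rate_pos
  have := h.gap_pos
  unfold perronConst
  positivity

/-- Transported back to time zero along the linear flow, the stable part of a slowly growing curve
tends to zero in the far past. -/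
theorem IsTrichotomy.tendsto_stable (h : IsTrichotomy J Pc Ps Pu η β C) {u : ℝ → Z} {μ K : ℝ}
    (hμβ : μ < β) (hK : ∀ t, ‖u t‖ ≤ K * Real.exp (μ * |t|)) :
    Tendsto (fun a => exp ((-a) • J) (Ps (u a))) atBot (𝓝 0) := by
  have hC := h.const_pos
  have hlim : Tendsto (fun a : ℝ => C * K * Real.exp ((β - μ) * a)) atBot (𝓝 (C * K * 0)) := by
    refine Tendsto.const_mul _ (Real.tendsto_exp_atBot.comp ?_)
    exact tendsto_id.const_mul_atBot (by linarith)
  rw [mul_zero] at hlim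
  refine squeeze_zero_norm' ?_ hlim
  filter_upwards [eventually_le_atBot 0] with a ha
  refine (h.stable (-a) (u a) (by linarith)).trans ?_
  calc C * Real.exp (-(β * -a)) * ‖u a‖
      ≤ C * Real.exp (-(β * -a)) * (K * Real.exp (μ * |a|)) := by
        gcongr
        exact hK a
    _ = C * K * (Real.exp (-(β * -a)) * Real.exp (μ * |a|)) := by ring
    _ = _ := by
        rw [← Real.exp_add, abs_of_nonpos ha]
        congr 2
        ring

theorem IsTrichotomy.tendsto_unstable (h : IsTrichotomy J Pc Ps Pu η β C) {u : ℝ → Z} {μ K : ℝ}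
    (hμβ : μ < β) (hK : ∀ t, ‖u t‖ ≤ K * Real.exp (μ * |t|)) :
    Tendsto (fun a => exp ((-a) • J) (Pu (u a))) atTop (𝓝 0) := by
  have := h.reverse.tendsto_stable (u := fun t => u (-t)) hμβ (fun t => by simpa using hK (-t))
  refine (this.comp tendsto_neg_atTop_atBot).congr fun a => ?_
  simp

variable [CompleteSpace Z]

theorem exp_smul_add_apply (J : Z →L[ℝ] Z) (s t : ℝ) (z : Z) :
    exp (s • J) (exp (t • J) z) = exp ((s + t) • J) z := by
  let _ : NormedAlgebra ℚ (Z →L[ℝ] Z) := NormedAlgebra.restrictScalars ℚ ℝ (Z →L[ℝ] Z)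
  rw [add_smul, exp_add_of_commute (((Commute.refl J).smul_left s).smul_right t)]
  rfl

theorem hasDerivAt_exp_sub_apply (J : Z →L[ℝ] Z) {v : ℝ → Z} {v' : Z} (t s : ℝ)
    (hv : HasDerivAt v v' s) :
    HasDerivAt (fun s => exp ((t - s) • J) (v s)) (exp ((t - s) • J) (v' - J (v s))) s := by
  have h1 : HasDerivAt (fun s : ℝ => exp ((t - s) • J)) (-(exp ((t - s) • J) * J)) s := by
    have := (hasDerivAt_exp_smul_const (𝕂 := ℝ) J (t - s)).scomp s
      ((hasDerivAt_id s).const_sub t)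
    refine this.congr_deriv ?_
    simp
  refine (h1.clm_apply hv).congr_deriv ?_
  simp [sub_eq_neg_add]

/-- The stable part of a solution of `u' = J u + g` that does not grow too fast in backward time is
bounded by the inhomogeneity. -/
theorem IsTrichotomy.stable_estimate (h : IsTrichotomy J Pc Ps Pu η β C) {u g : ℝ → Z} {μ G : ℝ}
    (hμ : 0 ≤ μ) (hμβ : μ < β) (hu : ∀ t, HasDerivAt u (J (u t) + g t) t)
    (hg : ∀ t, ‖g t‖ ≤ G * Real.exp (μ * |t|))
    (hlim : Tendsto (fun a => exp ((-a) • J) (Ps (u a))) atBot (𝓝 0)) (t : ℝ) :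
    ‖Ps (u t)‖ ≤ C * G / (β - μ) * Real.exp (μ * |t|) := by
  have hC := h.const_pos
  have hκ : 0 < β - μ := by linarith
  have hG : 0 ≤ G := by simpa using (norm_nonneg _).trans (hg 0)
  have hy : ∀ s, HasDerivAt (fun s => exp ((t - s) • J) (Ps (u s)))
      (exp ((t - s) • J) (Ps (g s))) s := by
    intro s
    refine (hasDerivAt_exp_sub_apply J t s (Ps.hasFDerivAt.comp_hasDerivAt s (hu s))).congr_deriv ?_
    rw [map_add, h.comm_s, Function.comp_apply, add_sub_cancel_left]
  have hb : ∀ a ≤ t, ‖Ps (u t)‖ ≤ ‖exp ((t - a) • J) (Ps (u a))‖ +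
      C * G / (β - μ) * Real.exp (μ * |t|) := by
    intro a ha
    have h1 := norm_le_of_deriv_le_exp (M := C * G * Real.exp (μ * |t| - (β - μ) * t)) ha hκ hy ?_
    · simp only [sub_self, zero_smul, exp_zero, one_apply_eq_self] at h1
      refine h1.trans (add_le_add le_rfl ?_)
      calc C * G * Real.exp (μ * |t| - (β - μ) * t) / (β - μ) *
            (Real.exp ((β - μ) * t) - Real.exp ((β - μ) * a))
          ≤ C * G * Real.exp (μ * |t| - (β - μ) * t) / (β - μ) * Real.exp ((β - μ) * t) := by
            gcongr
            linarith [Real.exp_pos ((β - μ) * a)]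
        _ = C * G / (β - μ) * Real.exp (μ * |t|) := by
            rw [Real.exp_sub]
            field_simp
    · intro s hs
      refine (h.stable (t - s) (g s) (by linarith [hs.2])).trans ?_
      have h2 : |s| ≤ |t| + (t - s) := by
        have := abs_sub_abs_le_abs_sub s t
        rw [abs_sub_comm, abs_of_nonneg (by linarith [hs.2] : 0 ≤ t - s)] at this
        linarith
      calc C * Real.exp (-(β * (t - s))) * ‖g s‖
          ≤ C * Real.exp (-(β * (t - s))) * (G * Real.exp (μ * (|t| + (t - s)))) := by
            gcongr
            refine (hg s).trans ?_
            gcongr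
        _ = C * G * (Real.exp (-(β * (t - s))) * Real.exp (μ * (|t| + (t - s)))) := by ring
        _ = C * G * (Real.exp (μ * |t| - (β - μ) * t) * Real.exp ((β - μ) * s)) := by
            rw [← Real.exp_add, ← Real.exp_add]
            congr 2
            ring
        _ = _ := by ring
  have hlim2 : Tendsto (fun a => ‖exp ((t - a) • J) (Ps (u a))‖ +
      C * G / (β - μ) * Real.exp (μ * |t|)) atBot
      (𝓝 (0 + C * G / (β - μ) * Real.exp (μ * |t|))) := by
    refine Tendsto.add_const _ ?_
    have h1 := ((exp (t • J) : Z →L[ℝ] Z).continuous.tendsto 0).comp hlim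
    rw [map_zero] at h1
    refine (tendsto_zero_iff_norm_tendsto_zero.1 h1).congr fun a => ?_
    rw [Function.comp_apply, exp_smul_add_apply, sub_eq_add_neg]
  rw [zero_add] at hlim2
  exact ge_of_tendsto hlim2 ((eventually_le_atBot t).mono hb)

/-- The center part of a solution of `u' = J u + g` is bounded by its initial value and the
inhomogeneity. -/
theorem IsTrichotomy.center_estimate_of_nonneg (h : IsTrichotomy J Pc Ps Pu η β C) {u g : ℝ → Z}
    {μ G : ℝ} (hμ : η < μ) (hu : ∀ t, HasDerivAt u (J (u t) + g t) t)
    (hg : ∀ t, ‖g t‖ ≤ G * Real.exp (μ * |t|)) (t : ℝ) (ht : 0 ≤ t) :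
    ‖Pc (u t)‖ ≤ (C * ‖Pc (u 0)‖ + C * G / (μ - η)) * Real.exp (μ * |t|) := by
  have hC := h.const_pos
  have hη := h.rate_pos
  have hκ : 0 < μ - η := by linarith
  have hG : 0 ≤ G := by simpa using (norm_nonneg _).trans (hg 0)
  have hy : ∀ s, HasDerivAt (fun s => exp ((t - s) • J) (Pc (u s)))
      (exp ((t - s) • J) (Pc (g s))) s := by
    intro s
    refine (hasDerivAt_exp_sub_apply J t s (Pc.hasFDerivAt.comp_hasDerivAt s (hu s))).congr_deriv ?_
    rw [map_add, h.comm_c, Function.comp_apply, add_sub_cancel_left]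
  have h1 := norm_le_of_deriv_le_exp (M := C * G * Real.exp (η * t)) ht hκ hy ?_
  · simp only [sub_self, zero_smul, exp_zero, one_apply_eq_self, sub_zero] at h1
    rw [abs_of_nonneg ht]
    have h2 : ‖exp (t • J) (Pc (u 0))‖ ≤ C * Real.exp (μ * t) * ‖Pc (u 0)‖ := by
      have := h.center t (Pc (u 0))
      rw [h.cc, abs_of_nonneg ht] at this
      refine this.trans ?_
      gcongr
    refine h1.trans ?_
    calc ‖exp (t • J) (Pc (u 0))‖ + C * G * Real.exp (η * t) / (μ - η) *
            (Real.exp ((μ - η) * t) - Real.exp ((μ - η) * 0))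
        ≤ C * Real.exp (μ * t) * ‖Pc (u 0)‖ + C * G * Real.exp (η * t) / (μ - η) *
            Real.exp ((μ - η) * t) := by
          gcongr
          linarith [Real.exp_pos ((μ - η) * 0)]
      _ = C * Real.exp (μ * t) * ‖Pc (u 0)‖ + C * G / (μ - η) *
            (Real.exp (η * t) * Real.exp ((μ - η) * t)) := by ring
      _ = _ := by
          rw [← Real.exp_add, show η * t + (μ - η) * t = μ * t by ring]
          ring
  · intro s hs
    have h2 := h.center (t - s) (g s)
    rw [abs_of_nonneg (by linarith [hs.2])] at h2
    refine h2.trans ?_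
    have h3 := hg s
    rw [abs_of_nonneg hs.1] at h3
    calc C * Real.exp (η * (t - s)) * ‖g s‖
        ≤ C * Real.exp (η * (t - s)) * (G * Real.exp (μ * s)) := by gcongr
      _ = C * G * (Real.exp (η * (t - s)) * Real.exp (μ * s)) := by ring
      _ = C * G * (Real.exp (η * t) * Real.exp ((μ - η) * s)) := by
          rw [← Real.exp_add, ← Real.exp_add]
          congr 2
          ring
      _ = _ := by ring

theorem IsTrichotomy.center_estimate (h : IsTrichotomy J Pc Ps Pu η β C) {u g : ℝ → Z}
    {μ G : ℝ} (hμ : η < μ) (hu : ∀ t, HasDerivAt u (J (u t) + g t) t)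
    (hg : ∀ t, ‖g t‖ ≤ G * Real.exp (μ * |t|)) (t : ℝ) :
    ‖Pc (u t)‖ ≤ (C * ‖Pc (u 0)‖ + C * G / (μ - η)) * Real.exp (μ * |t|) := by
  rcases le_total 0 t with ht | ht
  · exact h.center_estimate_of_nonneg hμ hu hg t ht
  · have := h.reverse.center_estimate_of_nonneg hμ (hasDerivAt_reverse hu)
      (fun s => by simpa using hg (-s)) (-t) (by linarith)
    simpa using this

/-- A priori estimate for the solutions of `u' = J u + g` without a stable or unstable homogeneous
component: the limits `hs` and `hn` exclude such components. -/
theorem IsTrichotomy.estimate_of_tendsto (h : IsTrichotomy J Pc Ps Pu η β C) {u g : ℝ → Z}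
    {μ G : ℝ} (hμ : 2 * η ≤ μ) (hμβ : μ ≤ β / 2) (hu : ∀ t, HasDerivAt u (J (u t) + g t) t)
    (hg : ∀ t, ‖g t‖ ≤ G * Real.exp (μ * |t|))
    (hs : Tendsto (fun a => exp ((-a) • J) (Ps (u a))) atBot (𝓝 0))
    (hn : Tendsto (fun a => exp ((-a) • J) (Pu (u a))) atTop (𝓝 0)) (t : ℝ) :
    ‖u t‖ ≤ (C * ‖Pc (u 0)‖ + perronConst η β C * G) * Real.exp (μ * |t|) := by
  have hC := h.const_pos
  have hη := h.rate_pos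
  have hβ := h.gap_pos
  have hG : 0 ≤ G := by simpa using (norm_nonneg _).trans (hg 0)
  have h1 := h.center_estimate (by linarith) hu hg t
  have h2 := h.stable_estimate (by linarith) (by linarith) hu hg hs t
  have h3 := h.reverse.stable_estimate (μ := μ) (G := G) (by linarith) (by linarith)
    (hasDerivAt_reverse hu) (fun s => by simpa using hg (-s)) (by
      refine (hn.comp tendsto_neg_atBot_atTop).congr fun a => ?_
      simp) (-t)
  simp only [neg_neg, abs_neg] at h3
  have h4 : C * G / (μ - η) ≤ C * G / η := by gcongr; linarith
  have h5 : C * G / (β - μ) ≤ C * G / (β / 2) := by gcongr; linarith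
  have h6 : C * ‖Pc (u 0)‖ + C * G / (μ - η) + C * G / (β - μ) + C * G / (β - μ) ≤
      C * ‖Pc (u 0)‖ + perronConst η β C * G := by
    have : perronConst η β C * G = C * G / η + C * G / (β / 2) + C * G / (β / 2) := by
      unfold perronConst
      field_simp
      ring
    linarith
  calc ‖u t‖ = ‖Pc (u t) + Ps (u t) + Pu (u t)‖ := by rw [h.sum]
    _ ≤ ‖Pc (u t)‖ + ‖Ps (u t)‖ + ‖Pu (u t)‖ := norm_add₃_le
    _ ≤ (C * ‖Pc (u 0)‖ + C * G / (μ - η) + C * G / (β - μ) + C * G / (β - μ)) *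
        Real.exp (μ * |t|) := by linarith
    _ ≤ _ := by gcongr

/-- A priori estimate for exponentially bounded solutions of `u' = J u + g`. -/
theorem IsTrichotomy.estimate (h : IsTrichotomy J Pc Ps Pu η β C) {u g : ℝ → Z}
    {μ G K : ℝ} (hμ : 2 * η ≤ μ) (hμβ : μ ≤ β / 2) (hu : ∀ t, HasDerivAt u (J (u t) + g t) t)
    (hg : ∀ t, ‖g t‖ ≤ G * Real.exp (μ * |t|)) (hK : ∀ t, ‖u t‖ ≤ K * Real.exp (μ * |t|)) (t : ℝ) :
    ‖u t‖ ≤ (C * ‖Pc (u 0)‖ + perronConst η β C * G) * Real.exp (μ * |t|) := by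
  have hβ := h.gap_pos
  exact h.estimate_of_tendsto hμ hμβ hu hg (h.tendsto_stable (by linarith) hK)
    (h.tendsto_unstable (by linarith) hK) t

/-- A priori estimate for exponentially bounded solutions of `u' = J u + g` when `g` contains a
small multiple of `u`. -/
theorem IsTrichotomy.estimate_of_small (h : IsTrichotomy J Pc Ps Pu η β C) {u g : ℝ → Z}
    {μ ε G K : ℝ} (hμ : 2 * η ≤ μ) (hμβ : μ ≤ β / 2)
    (hε : perronConst η β C * ε ≤ 1 / 2) (hε0 : 0 ≤ ε)
    (hu : ∀ t, HasDerivAt u (J (u t) + g t) t)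
    (hg : ∀ t, ‖g t‖ ≤ ε * ‖u t‖ + G * Real.exp (μ * |t|))
    (hK : ∀ t, ‖u t‖ ≤ K * Real.exp (μ * |t|)) (t : ℝ) :
    ‖u t‖ ≤ 2 * (C * ‖Pc (u 0)‖ + perronConst η β C * G) * Real.exp (μ * |t|) := by
  set A := C * ‖Pc (u 0)‖ + perronConst η β C * G with hA
  have hK0 : 0 ≤ K := by simpa using (norm_nonneg _).trans (hK 0)
  -- each application of the linear estimate halves the distance to the claimed constant
  have key : ∀ (n : ℕ) t, ‖u t‖ ≤ (2 * A + |K - 2 * A| / 2 ^ n) * Real.exp (μ * |t|) := by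
    intro n
    induction n with
    | zero =>
      intro t
      refine (hK t).trans ?_
      gcongr
      have := le_abs_self (K - 2 * A)
      simp only [pow_zero, div_one]
      linarith
    | succ n ih =>
      intro t
      set M := 2 * A + |K - 2 * A| / 2 ^ n with hM
      have hM0 : 0 ≤ M := by simpa using (norm_nonneg _).trans (ih 0)
      refine (h.estimate hμ hμβ hu (G := ε * M + G) (fun s => ?_) hK t).trans ?_
      · refine (hg s).trans ?_
        rw [add_mul, mul_assoc]
        gcongr
        exact ih s
      · refine mul_le_mul_of_nonneg_right ?_ (Real.exp_pos _).le
        have h1 : perronConst η β C * ε * M ≤ 1 / 2 * M := by gcongr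
        have h2 : |K - 2 * A| / 2 ^ (n + 1) = 1 / 2 * (|K - 2 * A| / 2 ^ n) := by
          rw [pow_succ]; field_simp
        rw [h2]
        linarith
  have hlim : Tendsto (fun n : ℕ => (2 * A + |K - 2 * A| / 2 ^ n) * Real.exp (μ * |t|)) atTop
      (𝓝 ((2 * A + 0) * Real.exp (μ * |t|))) := by
    refine (Tendsto.const_add _ ?_).mul_const _
    exact tendsto_const_nhds.div_atTop (tendsto_pow_atTop_atTop_of_one_lt one_lt_two)
  rw [add_zero] at hlim
  exact ge_of_tendsto' hlim fun n => key n t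

/-- Exponentially bounded solutions of `u' = J u + N (t, u)` are determined by the center part of
their initial values, if the Lipschitz constant of `N` is small. -/
theorem IsTrichotomy.eq_of_small (h : IsTrichotomy J Pc Ps Pu η β C) {u v : ℝ → Z}
    {N : ℝ → Z → Z} {μ ε K K' : ℝ} (hμ : 2 * η ≤ μ) (hμβ : μ ≤ β / 2)
    (hε : perronConst η β C * ε ≤ 1 / 2) (hε0 : 0 ≤ ε)
    (hN : ∀ t z z', ‖N t z - N t z'‖ ≤ ε * ‖z - z'‖)
    (hu : ∀ t, HasDerivAt u (J (u t) + N t (u t)) t)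
    (hv : ∀ t, HasDerivAt v (J (v t) + N t (v t)) t)
    (hK : ∀ t, ‖u t‖ ≤ K * Real.exp (μ * |t|)) (hK' : ∀ t, ‖v t‖ ≤ K' * Real.exp (μ * |t|))
    (h0 : Pc (u 0) = Pc (v 0)) : u = v := by
  funext t
  have := h.estimate_of_small (u := fun t => u t - v t)
    (g := fun t => N t (u t) - N t (v t)) (G := 0) (K := K + K') hμ hμβ hε hε0
    (fun t => ((hu t).sub (hv t)).congr_deriv (by rw [map_sub]; abel))
    (fun t => by simpa using hN t _ _)
    (fun t => by
      rw [add_mul]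
      exact (norm_sub_le _ _).trans (add_le_add (hK t) (hK' t))) t
  simpa [h0, sub_eq_zero] using this

/-- Existence of exponentially bounded solutions of `u' = J u + g` with prescribed center part of
the initial value. By variation of constants, where the stable part of the inhomogeneity is integrated
from `-∞` and the unstable part from `∞`. -/
theorem IsTrichotomy.exists_solution (h : IsTrichotomy J Pc Ps Pu η β C) {g : ℝ → Z}
    {μ G : ℝ} (hμ : 2 * η ≤ μ) (hμβ : μ ≤ β / 2) (hg : Continuous g)
    (hG : ∀ t, ‖g t‖ ≤ G * Real.exp (μ * |t|)) (ξ : Z) (hξ : Pc ξ = ξ) :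
    ∃ u : ℝ → Z, (∀ t, HasDerivAt u (J (u t) + g t) t) ∧ Pc (u 0) = ξ ∧
      ∃ K, ∀ t, ‖u t‖ ≤ K * Real.exp (μ * |t|) := by
  have hC := h.const_pos
  have hη := h.rate_pos
  have hβ := h.gap_pos
  have hκ : 0 < β - μ := by linarith
  have hexp : Continuous fun s : ℝ => (exp ((-s) • J) : Z →L[ℝ] Z) :=
    (differentiable_exp_smul_const ℝ J).continuous.comp continuous_neg
  have hcont : ∀ P : Z →L[ℝ] Z, Continuous fun s => exp ((-s) • J) (P (g s)) := fun P =>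
    hexp.clm_apply (P.continuous.comp hg)
  have hcont1 : Continuous fun s => exp ((-s) • J) (g s) := hexp.clm_apply hg
  have hints : MeasureTheory.IntegrableOn (fun s => exp ((-s) • J) (Ps (g s))) (Set.Iic 0) := by
    refine MeasureTheory.Integrable.mono' ((integrableOn_exp_mul_Iic hκ 0).const_mul (C * G))
      (hcont Ps).aestronglyMeasurable ?_
    refine (MeasureTheory.ae_restrict_iff' measurableSet_Iic).2 (.of_forall fun s hs => ?_)
    have hs : s ≤ 0 := hs
    refine (h.stable (-s) (g s) (by linarith)).trans ?_
    calc C * Real.exp (-(β * -s)) * ‖g s‖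
        ≤ C * Real.exp (-(β * -s)) * (G * Real.exp (μ * |s|)) := by gcongr; exact hG s
      _ = C * G * (Real.exp (-(β * -s)) * Real.exp (μ * |s|)) := by ring
      _ = _ := by rw [← Real.exp_add, abs_of_nonpos hs]; congr 2; ring
  have hintu : MeasureTheory.IntegrableOn (fun s => exp ((-s) • J) (Pu (g s))) (Set.Ioi 0) := by
    refine MeasureTheory.Integrable.mono'
      ((integrableOn_exp_mul_Ioi (neg_neg_of_pos hκ) 0).const_mul (C * G))
      (hcont Pu).aestronglyMeasurable ?_
    refine (MeasureTheory.ae_restrict_iff' measurableSet_Ioi).2 (.of_forall fun s hs => ?_)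
    have hs : 0 < s := hs
    refine (h.unstable s (g s) hs.le).trans ?_
    calc C * Real.exp (-(β * s)) * ‖g s‖
        ≤ C * Real.exp (-(β * s)) * (G * Real.exp (μ * |s|)) := by gcongr; exact hG s
      _ = C * G * (Real.exp (-(β * s)) * Real.exp (μ * |s|)) := by ring
      _ = _ := by rw [← Real.exp_add, abs_of_pos hs]; congr 2; ring
  -- The solution is `exp (t J) (y t)`: the initial value `ξ + Is - Iu` replaces the integrals of the
  -- stable and the unstable part from `0` by those from `-∞` and `∞`.
  set Is := ∫ s in Set.Iic (0 : ℝ), exp ((-s) • J) (Ps (g s)) with hIs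
  set Iu := ∫ s in Set.Ioi (0 : ℝ), exp ((-s) • J) (Pu (g s)) with hIu
  set y : ℝ → Z := fun t => ξ + Is - Iu + ∫ s in (0 : ℝ)..t, exp ((-s) • J) (g s) with hy
  have hinv : ∀ (t : ℝ) (z : Z), exp (t • J) (exp ((-t) • J) z) = z := by
    intro t z
    rw [exp_smul_add_apply]
    simp
  have hinv' : ∀ (t : ℝ) (z : Z), exp ((-t) • J) (exp (t • J) z) = z := by
    intro t z
    rw [exp_smul_add_apply]
    simp
  have hode : ∀ t, HasDerivAt (fun t => exp (t • J) (y t)) (J (exp (t • J) (y t)) + g t) t := by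
    intro t
    have h1 : HasDerivAt y (exp ((-t) • J) (g t)) t :=
      (hcont1.integral_hasStrictDerivAt 0 t).hasDerivAt.const_add _
    refine ((hasDerivAt_exp_smul_const' (𝕂 := ℝ) J t).clm_apply h1).congr_deriv ?_
    rw [hinv]
    rfl
  -- the projections commute with the flow, hence with the integrals
  have hPI : ∀ (P : Z →L[ℝ] Z) (hP : ∀ z, P (J z) = J (P z)) (a : ℝ),
      P (∫ s in (0 : ℝ)..a, exp ((-s) • J) (g s)) = ∫ s in (0 : ℝ)..a, exp ((-s) • J) (P (g s)) := by
    intro P hP a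
    rw [← ContinuousLinearMap.intervalIntegral_comp_comm P (hcont1.intervalIntegrable 0 a)]
    exact intervalIntegral.integral_congr fun s _ => exp_comm_apply hP _ _
  have hPIs : ∀ (P : Z →L[ℝ] Z) (hP : ∀ z, P (J z) = J (P z)),
      P Is = ∫ s in Set.Iic (0 : ℝ), exp ((-s) • J) (P (Ps (g s))) := by
    intro P hP
    rw [hIs, ← ContinuousLinearMap.integral_comp_comm P hints]
    simp_rw [exp_comm_apply hP]
  have hPIu : ∀ (P : Z →L[ℝ] Z) (hP : ∀ z, P (J z) = J (P z)),
      P Iu = ∫ s in Set.Ioi (0 : ℝ), exp ((-s) • J) (P (Pu (g s))) := by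
    intro P hP
    rw [hIu, ← ContinuousLinearMap.integral_comp_comm P hintu]
    simp_rw [exp_comm_apply hP]
  have e1 : Pc Is = 0 := by rw [hPIs Pc h.comm_c]; simp [h.cs]
  have e2 : Ps Is = Is := by rw [hPIs Ps h.comm_s]; simp only [h.ss]; rfl
  have e3 : Pu Is = 0 := by rw [hPIs Pu h.comm_u]; simp [h.us]
  have e4 : Pc Iu = 0 := by rw [hPIu Pc h.comm_c]; simp [h.cu]
  have e5 : Ps Iu = 0 := by rw [hPIu Ps h.comm_s]; simp [h.su]
  have e6 : Pu Iu = Iu := by rw [hPIu Pu h.comm_u]; simp only [h.uu]; rfl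
  have e7 : Ps ξ = 0 := by rw [← hξ, h.sc]
  have e8 : Pu ξ = 0 := by rw [← hξ, h.uc]
  refine ⟨fun t => exp (t • J) (y t), hode, ?_,
    _, h.estimate_of_tendsto hμ hμβ hode hG ?_ ?_⟩
  · simp [hy, e1, e4, hξ]
  · have h1 := MeasureTheory.intervalIntegral_tendsto_integral_Iic (0 : ℝ) hints tendsto_id
    have h2 : Tendsto (fun a => Is - ∫ s in a..0, exp ((-s) • J) (Ps (g s))) atBot (𝓝 0) := by
      have := (tendsto_const_nhds (x := Is)).sub h1
      rwa [← hIs, sub_self] at this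
    refine h2.congr fun a => ?_
    rw [exp_comm_apply h.comm_s, hinv', hy]
    simp only [map_add, map_sub, e7, e2, e5, hPI Ps h.comm_s]
    rw [intervalIntegral.integral_symm]
    abel
  · have h1 := MeasureTheory.intervalIntegral_tendsto_integral_Ioi (0 : ℝ) hintu tendsto_id
    have h2 : Tendsto (fun a => (∫ s in (0 : ℝ)..a, exp ((-s) • J) (Pu (g s))) - Iu) atTop
        (𝓝 0) := by
      have := h1.sub (tendsto_const_nhds (x := Iu))
      rwa [← hIu, sub_self] at this
    refine h2.congr fun a => ?_
    rw [exp_comm_apply h.comm_u, hinv', hy]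
    simp only [map_add, map_sub, e8, e3, e6, hPI Pu h.comm_u]
    abel

open BoundedContinuousFunction in
/-- Existence of exponentially bounded solutions of `u' = J u + N (t, u)` with prescribed center
part of the initial value, for nonlinearities with a small Lipschitz constant. -/
theorem IsTrichotomy.exists_solution_of_small (h : IsTrichotomy J Pc Ps Pu η β C)
    {N : ℝ → Z → Z} {μ ε G : ℝ} (hμ : 2 * η ≤ μ) (hμβ : μ ≤ β / 2)
    (hε : perronConst η β C * ε ≤ 1 / 2) (hε0 : 0 ≤ ε)
    (hNc : Continuous (Function.uncurry N)) (hN : ∀ t z z', ‖N t z - N t z'‖ ≤ ε * ‖z - z'‖)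
    (hN0 : ∀ t, ‖N t 0‖ ≤ G * Real.exp (μ * |t|)) (ξ : Z) (hξ : Pc ξ = ξ) :
    ∃ u : ℝ → Z, (∀ t, HasDerivAt u (J (u t) + N t (u t)) t) ∧ Pc (u 0) = ξ ∧
      ∃ K, ∀ t, ‖u t‖ ≤ K * Real.exp (μ * |t|) := by
  have hG : 0 ≤ G := by simpa using (norm_nonneg _).trans (hN0 0)
  -- the space of exponentially bounded functions is that of bounded functions times a weight
  let lift : (ℝ →ᵇ Z) → ℝ → Z := fun φ t => Real.exp (μ * |t|) • φ t
  have hlc : ∀ φ, Continuous (lift φ) := fun φ => by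
    have := φ.continuous
    fun_prop
  have hln : ∀ φ t, ‖lift φ t‖ = Real.exp (μ * |t|) * ‖φ t‖ := fun φ t => by
    rw [norm_smul, Real.norm_of_nonneg (Real.exp_pos _).le]
  have hgc : ∀ φ, Continuous fun t => N t (lift φ t) := fun φ =>
    hNc.comp (continuous_id.prodMk (hlc φ))
  have hgb : ∀ φ t, ‖N t (lift φ t)‖ ≤ (ε * ‖φ‖ + G) * Real.exp (μ * |t|) := by
    intro φ t
    have h1 := hN t (lift φ t) 0
    rw [sub_zero, hln] at h1
    have h2 := norm_sub_norm_le (N t (lift φ t)) (N t 0)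
    have h3 := mul_le_mul_of_nonneg_left (φ.norm_coe_le_norm t)
      (mul_nonneg hε0 (Real.exp_pos (μ * |t|)).le)
    linarith [hN0 t]
  choose sol hsol hsol0 hsolK using fun φ => h.exists_solution hμ hμβ (hgc φ) (hgb φ) ξ hξ
  choose K hK using hsolK
  have hwc : ∀ φ, Continuous fun t => Real.exp (-(μ * |t|)) • sol φ t := fun φ => by
    have : Continuous (sol φ) := continuous_iff_continuousAt.2 fun t => (hsol φ t).continuousAt
    fun_prop
  have hw1 : ∀ t, Real.exp (-(μ * |t|)) * Real.exp (μ * |t|) = 1 := fun t => by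
    rw [← Real.exp_add]; simp
  have hwb : ∀ φ t, ‖Real.exp (-(μ * |t|)) • sol φ t‖ ≤ K φ := fun φ t => by
    rw [norm_smul, Real.norm_of_nonneg (Real.exp_pos _).le]
    calc _ ≤ Real.exp (-(μ * |t|)) * (K φ * Real.exp (μ * |t|)) := by gcongr; exact hK φ t
      _ = K φ := by linear_combination (K φ) * hw1 t
  -- `T φ` solves the linear equation with the inhomogeneity `N (t, φ)`
  let T : (ℝ →ᵇ Z) → (ℝ →ᵇ Z) := fun φ => .ofNormedAddCommGroup _ (hwc φ) (K φ) (hwb φ)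
  have hT : ContractingWith ((1 : NNReal) / 2) T := by
    refine ⟨by norm_num [← NNReal.coe_lt_coe], LipschitzWith.of_dist_le_mul fun φ ψ => ?_⟩
    rw [BoundedContinuousFunction.dist_le (by positivity)]
    intro t
    have h1 := h.estimate (u := fun t => sol φ t - sol ψ t)
      (g := fun t => N t (lift φ t) - N t (lift ψ t)) (G := ε * dist φ ψ) (K := K φ + K ψ) hμ hμβ
      (fun t => ((hsol φ t).sub (hsol ψ t)).congr_deriv (by rw [map_sub]; abel))
      (fun t => by
        refine (hN t _ _).trans ?_
        have : lift φ t - lift ψ t = Real.exp (μ * |t|) • (φ t - ψ t) := (smul_sub _ _ _).symm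
        rw [this, norm_smul, Real.norm_of_nonneg (Real.exp_pos _).le, ← dist_eq_norm]
        have := φ.dist_coe_le_dist (g := ψ) t
        calc _ ≤ ε * (Real.exp (μ * |t|) * dist φ ψ) := by gcongr
          _ = _ := by ring)
      (fun t => by
        rw [add_mul]
        exact (norm_sub_le _ _).trans (add_le_add (hK φ t) (hK ψ t))) t
    simp only [map_sub, hsol0, sub_self, norm_zero, mul_zero, zero_add] at h1
    have h2 : dist (T φ t) (T ψ t) = Real.exp (-(μ * |t|)) * ‖sol φ t - sol ψ t‖ := by
      rw [dist_eq_norm]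
      change ‖Real.exp (-(μ * |t|)) • sol φ t - Real.exp (-(μ * |t|)) • sol ψ t‖ = _
      rw [← smul_sub, norm_smul, Real.norm_of_nonneg (Real.exp_pos _).le]
    rw [h2]
    calc _ ≤ Real.exp (-(μ * |t|)) *
          (perronConst η β C * (ε * dist φ ψ) * Real.exp (μ * |t|)) := by gcongr
      _ = perronConst η β C * ε * dist φ ψ := by
          linear_combination (perronConst η β C * (ε * dist φ ψ)) * hw1 t
      _ ≤ 1 / 2 * dist φ ψ := by gcongr
      _ = _ := by simp
  obtain ⟨φ, hφ⟩ : ∃ φ, T φ = φ := ⟨_, hT.fixedPoint_isFixedPt⟩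
  have hlift : ∀ t, lift φ t = sol φ t := by
    intro t
    have : φ t = Real.exp (-(μ * |t|)) • sol φ t := DFunLike.congr_fun hφ.symm t
    change Real.exp (μ * |t|) • φ t = _
    rw [this, smul_smul, mul_comm, hw1, one_smul]
  refine ⟨sol φ, fun t => ?_, hsol0 φ, K φ, hK φ⟩
  have := hsol φ t
  rwa [hlift] at this

end Perron

/-! ### Families of curves with exponentially bounded derivatives -/

section WeightedSmooth

set_option linter.unusedSectionVars false

variable {E ι : Type*} [NormedAddCommGroup E] [NormedSpace ℝ E] [FiniteDimensional ℝ E]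
  [Fintype ι] (b : Module.Basis ι ℝ E)
  {F F₁ F₂ F₃ : Type*} [NormedAddCommGroup F] [NormedSpace ℝ F]
  [NormedAddCommGroup F₁] [NormedSpace ℝ F₁] [NormedAddCommGroup F₂] [NormedSpace ℝ F₂]
  [NormedAddCommGroup F₃] [NormedSpace ℝ F₃]

/-- The linear map whose values on the basis `b` are `v`: a Fréchet derivative expressed by its
partial derivatives. -/
noncomputable def ofPartials (v : ι → F) : E →L[ℝ] F :=
  ∑ i, (LinearMap.toContinuousLinearMap (b.coord i)).smulRight (v i)

theorem ofPartials_apply (v : ι → F) (h : E) : ofPartials b v h = ∑ i, b.coord i h • v i := by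
  simp [ofPartials]

theorem comp_ofPartials (L : F →L[ℝ] F₁) (v : ι → F) :
    L.comp (ofPartials b v) = ofPartials b (fun i => L (v i)) := by
  ext h
  simp [ofPartials_apply]

theorem ofPartials_add (v w : ι → F) :
    ofPartials b (fun i => v i + w i) = ofPartials b v + ofPartials b w := by
  ext h
  simp [ofPartials_apply, Finset.sum_add_distrib]

theorem norm_ofPartials_le (v : ι → F) :
    ‖ofPartials b v‖ ≤ ∑ i, ‖LinearMap.toContinuousLinearMap (b.coord i)‖ * ‖v i‖ := by
  refine (norm_sum_le _ _).trans (Finset.sum_le_sum fun i _ => ?_)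
  rw [ContinuousLinearMap.norm_smulRight_apply]

/-- A family `g x` of continuous curves, bounded and Lipschitz in `x` with weight `exp (μ |t|)`. -/
structure WeightedLipschitz (μ : ℝ) (g : E → ℝ → F) : Prop where
  cont : ∀ x, Continuous (g x)
  bound : ∃ C, 0 ≤ C ∧ ∀ x t, ‖g x t‖ ≤ C * Real.exp (μ * |t|)
  lipschitz : ∃ C, 0 ≤ C ∧ ∀ x y t, ‖g x t - g y t‖ ≤ C * ‖x - y‖ * Real.exp (μ * |t|)

/-- A family `g x` of curves with `k` derivatives in `x`, all of which are bounded and Lipschitz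
with weight `exp (μ |t|)`. Derivatives are encoded by partial derivatives in the basis `b`, so that
they take values in the same space as `g`. -/
def WeightedSmooth : ℕ → ℝ → (E → ℝ → F) → Prop
  | 0, μ, g => WeightedLipschitz μ g
  | k + 1, μ, g => WeightedLipschitz μ g ∧ ∃ g' : ι → E → ℝ → F,
      (∀ x t, HasFDerivAt (fun x => g x t) (ofPartials b fun i => g' i x t) x) ∧
      ∀ i, WeightedSmooth k μ (g' i)

variable {b}

theorem WeightedLipschitz.mono {μ μ' : ℝ} (h : μ ≤ μ') {g : E → ℝ → F}
    (hg : WeightedLipschitz μ g) : WeightedLipschitz μ' g := by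
  obtain ⟨h1, ⟨C, hC, h2⟩, ⟨L, hL, h3⟩⟩ := hg
  refine ⟨h1, ⟨C, hC, fun x t => (h2 x t).trans ?_⟩, ⟨L, hL, fun x y t => (h3 x y t).trans ?_⟩⟩ <;>
  gcongr

theorem WeightedSmooth.weightedLipschitz {k : ℕ} {μ : ℝ} {g : E → ℝ → F}
    (hg : WeightedSmooth b k μ g) : WeightedLipschitz μ g := by
  cases k with
  | zero => exact hg
  | succ k => exact hg.1

theorem WeightedSmooth.mono {k : ℕ} {μ μ' : ℝ} (h : μ ≤ μ') {g : E → ℝ → F}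
    (hg : WeightedSmooth b k μ g) : WeightedSmooth b k μ' g := by
  induction k generalizing g with
  | zero => exact WeightedLipschitz.mono h hg
  | succ k ih =>
    obtain ⟨h1, g', h2, h3⟩ := hg
    exact ⟨h1.mono h, g', h2, fun i => ih (h3 i)⟩

theorem WeightedSmooth.of_succ {k : ℕ} {μ : ℝ} {g : E → ℝ → F}
    (hg : WeightedSmooth b (k + 1) μ g) : WeightedSmooth b k μ g := by
  induction k generalizing g with
  | zero => exact hg.1
  | succ k ih =>
    obtain ⟨h1, g', h2, h3⟩ := hg
    exact ⟨h1, g', h2, fun i => ih (h3 i)⟩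

theorem WeightedSmooth.contDiff {k : ℕ} {μ : ℝ} {g : E → ℝ → F}
    (hg : WeightedSmooth b k μ g) (t : ℝ) : ContDiff ℝ k (fun x => g x t) := by
  induction k generalizing g with
  | zero =>
    obtain ⟨-, -, L, hL, h⟩ := hg
    have : LipschitzWith (L * Real.exp (μ * |t|)).toNNReal (fun x => g x t) := by
      refine LipschitzWith.of_dist_le_mul fun x y => ?_
      rw [dist_eq_norm, dist_eq_norm, Real.coe_toNNReal _ (by positivity)]
      refine (h x y t).trans (le_of_eq (by ring))
    exact contDiff_zero.2 this.continuous
  | succ k ih =>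
    obtain ⟨-, g', h2, h3⟩ := hg
    push_cast
    refine contDiff_succ_iff_hasFDerivAt.2 ⟨_, ?_, fun x => h2 x t⟩
    unfold ofPartials
    refine ContDiff.sum fun i _ => ?_
    exact ((ContinuousLinearMap.smulRightL ℝ E F
      (LinearMap.toContinuousLinearMap (b.coord i))).contDiff).comp (ih (h3 i))

theorem WeightedLipschitz.add {μ : ℝ} {g₁ g₂ : E → ℝ → F} (h₁ : WeightedLipschitz μ g₁)
    (h₂ : WeightedLipschitz μ g₂) : WeightedLipschitz μ (fun x t => g₁ x t + g₂ x t) := by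
  obtain ⟨c₁, ⟨C₁, hC₁, b₁⟩, ⟨L₁, hL₁, l₁⟩⟩ := h₁
  obtain ⟨c₂, ⟨C₂, hC₂, b₂⟩, ⟨L₂, hL₂, l₂⟩⟩ := h₂
  refine ⟨fun x => (c₁ x).add (c₂ x), ⟨C₁ + C₂, by positivity, fun x t => ?_⟩,
    ⟨L₁ + L₂, by positivity, fun x y t => ?_⟩⟩
  · rw [add_mul]
    exact (norm_add_le _ _).trans (add_le_add (b₁ x t) (b₂ x t))
  · rw [add_mul, add_mul, add_sub_add_comm]
    exact (norm_add_le _ _).trans (add_le_add (l₁ x y t) (l₂ x y t))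

theorem WeightedSmooth.add {k : ℕ} {μ : ℝ} {g₁ g₂ : E → ℝ → F} (h₁ : WeightedSmooth b k μ g₁)
    (h₂ : WeightedSmooth b k μ g₂) : WeightedSmooth b k μ (fun x t => g₁ x t + g₂ x t) := by
  induction k generalizing g₁ g₂ with
  | zero => exact WeightedLipschitz.add h₁ h₂
  | succ k ih =>
    obtain ⟨a₁, g₁', d₁, s₁⟩ := h₁
    obtain ⟨a₂, g₂', d₂, s₂⟩ := h₂
    refine ⟨a₁.add a₂, fun i x t => g₁' i x t + g₂' i x t, fun x t => ?_, fun i => ih (s₁ i) (s₂ i)⟩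
    rw [ofPartials_add]
    exact (d₁ x t).add (d₂ x t)

/-- The weights of the factors of a bilinear expression add up. -/
theorem WeightedLipschitz.bilin (B : F₁ →L[ℝ] F₂ →L[ℝ] F₃) {μ₁ μ₂ : ℝ}
    {g₁ : E → ℝ → F₁} {g₂ : E → ℝ → F₂} (h₁ : WeightedLipschitz μ₁ g₁)
    (h₂ : WeightedLipschitz μ₂ g₂) :
    WeightedLipschitz (μ₁ + μ₂) (fun x t => B (g₁ x t) (g₂ x t)) := by
  obtain ⟨c₁, ⟨C₁, hC₁, b₁⟩, ⟨L₁, hL₁, l₁⟩⟩ := h₁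
  obtain ⟨c₂, ⟨C₂, hC₂, b₂⟩, ⟨L₂, hL₂, l₂⟩⟩ := h₂
  refine ⟨fun x => (B.continuous.comp (c₁ x)).clm_apply (c₂ x),
    ⟨‖B‖ * C₁ * C₂, by positivity, fun x t => ?_⟩,
    ⟨‖B‖ * (L₁ * C₂ + C₁ * L₂), by positivity, fun x y t => ?_⟩⟩
  · calc ‖B (g₁ x t) (g₂ x t)‖ ≤ ‖B‖ * ‖g₁ x t‖ * ‖g₂ x t‖ := B.le_opNorm₂ _ _
      _ ≤ ‖B‖ * (C₁ * Real.exp (μ₁ * |t|)) * (C₂ * Real.exp (μ₂ * |t|)) := by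
        gcongr
        · exact b₁ x t
        · exact b₂ x t
      _ = _ := by rw [add_mul, Real.exp_add]; ring
  · have h : B (g₁ x t) (g₂ x t) - B (g₁ y t) (g₂ y t) =
        B (g₁ x t - g₁ y t) (g₂ x t) + B (g₁ y t) (g₂ x t - g₂ y t) := by
      simp
    rw [h]
    calc ‖B (g₁ x t - g₁ y t) (g₂ x t) + B (g₁ y t) (g₂ x t - g₂ y t)‖
        ≤ ‖B‖ * ‖g₁ x t - g₁ y t‖ * ‖g₂ x t‖ + ‖B‖ * ‖g₁ y t‖ * ‖g₂ x t - g₂ y t‖ :=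
          (norm_add_le _ _).trans (add_le_add (B.le_opNorm₂ _ _) (B.le_opNorm₂ _ _))
      _ ≤ ‖B‖ * (L₁ * ‖x - y‖ * Real.exp (μ₁ * |t|)) * (C₂ * Real.exp (μ₂ * |t|)) +
          ‖B‖ * (C₁ * Real.exp (μ₁ * |t|)) * (L₂ * ‖x - y‖ * Real.exp (μ₂ * |t|)) := by
        gcongr
        · exact l₁ x y t
        · exact b₂ x t
        · exact b₁ y t
        · exact l₂ x y t
      _ = _ := by rw [add_mul, Real.exp_add]; ring

theorem WeightedSmooth.bilin (B : F₁ →L[ℝ] F₂ →L[ℝ] F₃) {k : ℕ} {μ₁ μ₂ : ℝ}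
    {g₁ : E → ℝ → F₁} {g₂ : E → ℝ → F₂} (h₁ : WeightedSmooth b k μ₁ g₁)
    (h₂ : WeightedSmooth b k μ₂ g₂) :
    WeightedSmooth b k (μ₁ + μ₂) (fun x t => B (g₁ x t) (g₂ x t)) := by
  induction k generalizing g₁ g₂ with
  | zero => exact WeightedLipschitz.bilin B h₁ h₂
  | succ k ih =>
    have h₁' := h₁.of_succ
    have h₂' := h₂.of_succ
    obtain ⟨a₁, g₁', d₁, s₁⟩ := h₁
    obtain ⟨a₂, g₂', d₂, s₂⟩ := h₂
    refine ⟨a₁.bilin B a₂, fun i x t => B (g₁ x t) (g₂' i x t) + B (g₁' i x t) (g₂ x t),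
      fun x t => ?_, fun i => (ih h₁' (s₂ i)).add (ih (s₁ i) h₂')⟩
    refine (B.hasFDerivAt_of_bilinear (d₁ x t) (d₂ x t)).congr_fderiv ?_
    ext h
    simp [ofPartials_apply, Finset.sum_add_distrib]

theorem exists_lipschitz_of_contDiff_compact {G : F₁ → F₂} (hG : ContDiff ℝ ∞ G)
    (hc : HasCompactSupport G) : ∃ L, 0 ≤ L ∧ ∀ y z, ‖G y - G z‖ ≤ L * ‖y - z‖ := by
  obtain ⟨L, hL⟩ := (hc.fderiv (𝕜 := ℝ)).exists_bound_of_continuous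
    (hG.continuous_fderiv (by simp))
  refine ⟨L, (norm_nonneg _).trans (hL 0), fun y z => ?_⟩
  exact convex_univ.norm_image_sub_le_of_norm_fderiv_le (𝕜 := ℝ)
    (fun x _ => (hG.differentiable (by simp)) x) (fun x _ => hL x) (Set.mem_univ _) (Set.mem_univ _)

/-- Composition of a compactly supported smooth map with a family of curves that has weighted
derivatives. The family itself need not be bounded. Each derivative of `u` in the chain rule brings
in its own weight, hence the factor `k + 1`. -/
theorem WeightedSmooth.comp {F₁ F₂ : Type v} [NormedAddCommGroup F₁] [NormedSpace ℝ F₁]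
    [NormedAddCommGroup F₂] [NormedSpace ℝ F₂] {G : F₁ → F₂} (hG : ContDiff ℝ ∞ G) (hc : HasCompactSupport G)
    {μ : ℝ} (hμ : 0 ≤ μ) {u : E → ℝ → F₁} {u' : ι → E → ℝ → F₁} (hcont : ∀ x, Continuous (u x))
    (hlip : ∃ C, 0 ≤ C ∧ ∀ x y t, ‖u x t - u y t‖ ≤ C * ‖x - y‖ * Real.exp (μ * |t|)) (k : ℕ)
    (hu : ∀ j < k, (∀ x t, HasFDerivAt (fun x => u x t) (ofPartials b fun i => u' i x t) x) ∧
      ∀ i, WeightedSmooth b j μ (u' i)) :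
    WeightedSmooth b k ((k + 1) * μ) (fun x t => G (u x t)) := by
  have h0 : ∀ {F₂ : Type v} [NormedAddCommGroup F₂] [NormedSpace ℝ F₂] {G : F₁ → F₂},
      ContDiff ℝ ∞ G → HasCompactSupport G → WeightedLipschitz μ (fun x t => G (u x t)) := by
    intro F₂ _ _ G hG hc
    obtain ⟨A, hA⟩ := hc.exists_bound_of_continuous hG.continuous
    have hA0 : 0 ≤ A := (norm_nonneg _).trans (hA 0)
    obtain ⟨L, hL, hL2⟩ := exists_lipschitz_of_contDiff_compact hG hc
    obtain ⟨C, hC, hC2⟩ := hlip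
    refine ⟨fun x => hG.continuous.comp (hcont x), ⟨A, hA0, fun x t => ?_⟩,
      ⟨L * C, by positivity, fun x y t => ?_⟩⟩
    · refine (hA _).trans (le_mul_of_one_le_right hA0 (Real.one_le_exp (by positivity)))
    · refine (hL2 _ _).trans ?_
      rw [mul_assoc, mul_assoc, ← mul_assoc C]
      gcongr
      exact hC2 x y t
  induction k generalizing F₂ with
  | zero => exact (h0 hG hc).mono (by simp)
  | succ k ih =>
    obtain ⟨hd, hs⟩ := hu k (Nat.lt_succ_self k)
    refine ⟨(h0 hG hc).mono (le_mul_of_one_le_left hμ (by push_cast; linarith)),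
      fun i x t => fderiv ℝ G (u x t) (u' i x t), fun x t => ?_, fun i => ?_⟩
    · rw [← comp_ofPartials]
      exact ((hG.differentiable (by simp)) _).hasFDerivAt.comp x (hd x t)
    · have h1 := ih (G := fderiv ℝ G) (hG.fderiv_right (by simp)) (hc.fderiv ℝ)
        (fun j hj => hu j (hj.trans (Nat.lt_succ_self k)))
      have := h1.bilin (ContinuousLinearMap.id ℝ (F₁ →L[ℝ] F₂)) (hs i)
      refine this.mono (le_of_eq ?_)
      push_cast
      ring

/-- First-order Taylor estimate for a map with Lipschitz derivative. -/
theorem norm_sub_sub_le_of_lipschitz_deriv {f : E → F} {f' : E → E →L[ℝ] F} {L : ℝ} (hL : 0 ≤ L)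
    (hf : ∀ x, HasFDerivAt f (f' x) x) (hf' : ∀ x y, ‖f' x - f' y‖ ≤ L * ‖x - y‖) (x y : E) :
    ‖f y - f x - f' x (y - x)‖ ≤ L * ‖y - x‖ ^ 2 := by
  have := (convex_segment (𝕜 := ℝ) x y).norm_image_sub_le_of_norm_hasFDerivWithin_le' (f := f)
    (φ := f' x) (C := L * ‖y - x‖) (fun z _ => (hf z).hasFDerivWithinAt)
    (fun z hz => (hf' z x).trans (by
      gcongr
      exact norm_sub_le_of_mem_segment hz)) (left_mem_segment ℝ x y) (right_mem_segment ℝ x y)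
  rwa [mul_assoc, ← sq] at this

theorem hasFDerivAt_of_quadratic {f : E → F} {f' : E →L[ℝ] F} {x : E} {K : ℝ}
    (h : ∀ y, ‖f y - f x - f' (y - x)‖ ≤ K * ‖y - x‖ ^ 2) : HasFDerivAt f f' x := by
  refine .of_isLittleO ?_
  refine (Asymptotics.IsBigO.of_bound K (.of_forall fun y => ?_)).trans_isLittleO
    (Asymptotics.isLittleO_pow_sub_sub x one_lt_two)
  simpa using h y

/-- First-order Taylor estimate for a family of curves, uniform in time up to the weight. -/
theorem WeightedSmooth.exists_quadratic_bound {μ : ℝ} {g : E → ℝ → F} {g' : ι → E → ℝ → F}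
    (hd : ∀ x t, HasFDerivAt (fun x => g x t) (ofPartials b fun i => g' i x t) x)
    (hg' : ∀ i, WeightedLipschitz μ (g' i)) :
    ∃ C, 0 ≤ C ∧ ∀ x y t, ‖g y t - g x t - ofPartials b (fun i => g' i x t) (y - x)‖ ≤
      C * ‖y - x‖ ^ 2 * Real.exp (μ * |t|) := by
  choose L hL hL2 using fun i => (hg' i).lipschitz
  refine ⟨∑ i, ‖LinearMap.toContinuousLinearMap (b.coord i)‖ * L i,
    Finset.sum_nonneg fun i _ => mul_nonneg (norm_nonneg _) (hL i), fun x y t => ?_⟩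
  have h1 := norm_sub_sub_le_of_lipschitz_deriv (f := fun x => g x t)
    (f' := fun x => ofPartials b fun i => g' i x t)
    (L := (∑ i, ‖LinearMap.toContinuousLinearMap (b.coord i)‖ * L i) * Real.exp (μ * |t|))
    (mul_nonneg (Finset.sum_nonneg fun i _ => mul_nonneg (norm_nonneg _) (hL i))
      (Real.exp_pos _).le) (fun x => hd x t) (fun x y => ?_) x y
  · exact h1.trans (le_of_eq (by ring))
  · have : ofPartials b (fun i => g' i x t) - ofPartials b (fun i => g' i y t) =
        ofPartials b (fun i => g' i x t - g' i y t) := by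
      ext h
      simp [ofPartials_apply, smul_sub]
    rw [this]
    refine (norm_ofPartials_le b _).trans ?_
    rw [Finset.sum_mul, Finset.sum_mul]
    refine Finset.sum_le_sum fun i _ => ?_
    calc _ ≤ ‖LinearMap.toContinuousLinearMap (b.coord i)‖ *
          (L i * ‖x - y‖ * Real.exp (μ * |t|)) := by gcongr; exact hL2 i x y t
      _ = _ := by ring

end WeightedSmooth

/-! ### Smooth dependence of exponentially bounded solutions on parameters -/

section SmoothDependence

open NormedSpace

set_option linter.unusedSectionVars false

variable {E ι : Type*} [NormedAddCommGroup E] [NormedSpace ℝ E] [FiniteDimensional ℝ E]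
  [Fintype ι] {b : Module.Basis ι ℝ E}
  {Z : Type v} [NormedAddCommGroup Z] [NormedSpace ℝ Z] [CompleteSpace Z]
  {J Pc Ps Pu : Z →L[ℝ] Z} {η β C : ℝ}

theorem WeightedSmooth.of_le {F : Type*} [NormedAddCommGroup F] [NormedSpace ℝ F] {k l : ℕ}
    {μ : ℝ} {g : E → ℝ → F} (hg : WeightedSmooth b k μ g) (hl : l ≤ k) :
    WeightedSmooth b l μ g := by
  induction hl with
  | refl => exact hg
  | step _ ih => exact ih hg.of_succ

theorem WeightedSmooth.zero {F : Type*} [NormedAddCommGroup F] [NormedSpace ℝ F] (k : ℕ)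
    (μ : ℝ) : WeightedSmooth b k μ (fun _ _ => (0 : F)) := by
  have h : WeightedLipschitz μ (fun (_ : E) _ => (0 : F)) :=
    ⟨fun _ => continuous_const, ⟨0, le_rfl, by simp⟩, ⟨0, le_rfl, by simp⟩⟩
  induction k with
  | zero => exact h
  | succ k ih =>
    refine ⟨h, fun _ _ _ => 0, fun x t => ?_, fun _ => ih⟩
    exact (hasFDerivAt_const _ _).congr_fderiv (by ext; simp [ofPartials_apply])

/-- The factor by which the exponential weight grows when `k` derivatives with respect to a
parameter are taken of the solutions of a linear equation. -/
def weightFactor : ℕ → ℝ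
  | 0 => 2
  | k + 1 => weightFactor k * (weightFactor k + 1)

theorem two_le_weightFactor (k : ℕ) : 2 ≤ weightFactor k := by
  induction k with
  | zero => exact le_rfl
  | succ k ih => rw [weightFactor]; nlinarith

theorem weightFactor_le_succ (k : ℕ) : weightFactor k ≤ weightFactor (k + 1) := by
  have := two_le_weightFactor k
  rw [weightFactor]
  nlinarith

/-- The exponentially bounded solutions of a family of linear equations `w' = J w + M w + c` depend
on the parameter as smoothly as the coefficients do. Products such as `M' w` carry the weights of both
factors, so the weight is enlarged with every derivative. -/
theorem IsTrichotomy.weightedSmooth_linear (h : IsTrichotomy J Pc Ps Pu η β C) {ε : ℝ}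
    (hε : perronConst η β C * ε ≤ 1 / 2) (hε0 : 0 ≤ ε) (k : ℕ) {μ : ℝ} (hμ : 2 * η ≤ μ)
    (hμβ : weightFactor k * μ ≤ β / 2) {M : E → ℝ → Z →L[ℝ] Z} {c w : E → ℝ → Z} {ξ : Z}
    (hM : WeightedSmooth b k μ M) (hc : WeightedSmooth b k μ c) (hMε : ∀ x t, ‖M x t‖ ≤ ε)
    (hw : ∀ x t, HasDerivAt (w x) (J (w x t) + (M x t (w x t) + c x t)) t)
    (hw0 : ∀ x, Pc (w x 0) = ξ) (hwK : ∀ x, ∃ K, ∀ t, ‖w x t‖ ≤ K * Real.exp (μ * |t|)) :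
    WeightedSmooth b k (weightFactor k * μ) w := by
  have hη := h.rate_pos
  have hC := h.const_pos
  have hκ := h.perronConst_pos
  have hμ0 : 0 < μ := by linarith
  induction k generalizing μ c w ξ with
  | zero =>
    simp only [weightFactor] at hμβ ⊢
    obtain ⟨cM, -, ⟨LM, hLM, lM⟩⟩ := hM
    obtain ⟨cc, ⟨Cc, hCc, bc⟩, ⟨Lc, hLc, lc⟩⟩ := hc
    choose K hK using hwK
    have hbound : ∀ x t, ‖w x t‖ ≤ 2 * (C * ‖ξ‖ + perronConst η β C * Cc) * Real.exp (μ * |t|) := by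
      intro x t
      have := h.estimate_of_small (G := Cc) hμ (by linarith) hε hε0 (hw x) (fun t => by
        refine (norm_add_le _ _).trans (add_le_add ?_ (bc x t))
        exact (M x t).le_of_opNorm_le (hMε x t) _) (hK x) t
      rwa [hw0] at this
    set D := 2 * (C * ‖ξ‖ + perronConst η β C * Cc) with hD
    have hD0 : 0 ≤ D := by positivity
    refine ⟨fun x => continuous_iff_continuousAt.2 fun t => (hw x t).continuousAt,
      ⟨D, hD0, fun x t => (hbound x t).trans ?_⟩,
      ⟨2 * (perronConst η β C * (LM * D + Lc)), by positivity, fun x y t => ?_⟩⟩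
    · gcongr
      linarith
    · have := h.estimate_of_small (u := fun t => w x t - w y t)
        (g := fun t => M x t (w x t) + c x t - (M y t (w y t) + c y t))
        (G := (LM * D + Lc) * ‖x - y‖) (K := D + D) (μ := 2 * μ) (by linarith) (by linarith) hε hε0
        (fun t => ((hw x t).sub (hw y t)).congr_deriv (by rw [map_sub]; abel)) (fun t => by
          have e : M x t (w x t) + c x t - (M y t (w y t) + c y t) =
              M x t (w x t - w y t) + ((M x t - M y t) (w y t) + (c x t - c y t)) := by
            simp only [map_sub, sub_apply]
            abel
          rw [e]
          refine (norm_add_le _ _).trans (add_le_add ((M x t).le_of_opNorm_le (hMε x t) _) ?_)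
          calc ‖(M x t - M y t) (w y t) + (c x t - c y t)‖
              ≤ ‖M x t - M y t‖ * ‖w y t‖ + ‖c x t - c y t‖ :=
                (norm_add_le _ _).trans (add_le_add ((M x t - M y t).le_opNorm _) le_rfl)
            _ ≤ LM * ‖x - y‖ * Real.exp (μ * |t|) * (D * Real.exp (μ * |t|)) +
                Lc * ‖x - y‖ * Real.exp (2 * μ * |t|) := by
                gcongr
                · exact lM x y t
                · exact hbound y t
                · refine (lc x y t).trans ?_
                  gcongr
                  linarith
            _ = LM * ‖x - y‖ * D * (Real.exp (μ * |t|) * Real.exp (μ * |t|)) +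
                Lc * ‖x - y‖ * Real.exp (2 * μ * |t|) := by ring
            _ = _ := by
                rw [← Real.exp_add, show μ * |t| + μ * |t| = 2 * μ * |t| by ring]
                ring)
        (fun t => by
          rw [add_mul]
          refine (norm_sub_le _ _).trans (add_le_add ((hbound x t).trans ?_)
            ((hbound y t).trans ?_)) <;>
          · gcongr
            linarith) t
      simp only [map_sub, hw0, sub_self, norm_zero, mul_zero, zero_add] at this
      refine this.trans (le_of_eq (by ring))
  | succ k ih =>
    have hσ := two_le_weightFactor k
    have hσs := weightFactor_le_succ k
    set σ := weightFactor k with hσdef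
    have hσμ : σ * μ ≤ β / 2 := (mul_le_mul_of_nonneg_right hσs hμ0.le).trans hμβ
    have hμ' : μ ≤ σ * μ := le_mul_of_one_le_left hμ0.le (by linarith)
    have hwS : WeightedSmooth b k (σ * μ) w := ih hμ hσμ hM.of_succ hc.of_succ hw hw0 hwK hμ0
    obtain ⟨aM, M', dM, sM⟩ := hM
    obtain ⟨ac, c', dc, sc⟩ := hc
    -- the partial derivatives solve the linearized equation, with a larger weight
    set μ₁ := (σ + 1) * μ with hμ₁
    have hμ₁μ : μ ≤ μ₁ := by rw [hμ₁]; nlinarith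
    have hμ₁σ : σ * μ ≤ μ₁ := by rw [hμ₁]; nlinarith
    have hμ₁β : σ * μ₁ ≤ β / 2 := by
      rw [hμ₁, ← mul_assoc]; exact hμβ
    have hμ₁β' : μ₁ ≤ β / 2 := by nlinarith
    have hc₁ : ∀ i, WeightedSmooth b k μ₁ (fun x t => M' i x t (w x t) + c' i x t) := by
      intro i
      refine WeightedSmooth.add ?_ ((sc i).mono hμ₁μ)
      have := (sM i).bilin (ContinuousLinearMap.id ℝ (Z →L[ℝ] Z)) hwS
      exact this.mono (le_of_eq (by rw [hμ₁]; ring))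
    have hex : ∀ i x, ∃ u : ℝ → Z,
        (∀ t, HasDerivAt u (J (u t) + (M x t (u t) + (M' i x t (w x t) + c' i x t))) t) ∧
        Pc (u 0) = 0 ∧ ∃ K, ∀ t, ‖u t‖ ≤ K * Real.exp (μ₁ * |t|) := by
      intro i x
      obtain ⟨c1, ⟨G, hG, b1⟩, -⟩ := (hc₁ i).weightedLipschitz
      refine h.exists_solution_of_small
        (N := fun t z => M x t z + (M' i x t (w x t) + c' i x t)) (by linarith) hμ₁β' hε hε0 ?_
        (fun t z z' => ?_) (G := G) (fun t => by simpa using b1 x t) 0 (map_zero _)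
      · exact (((aM.cont x).comp continuous_fst).clm_apply continuous_snd).add
          ((c1 x).comp continuous_fst)
      · rw [add_sub_add_right_eq_sub, ← map_sub]
        exact (M x t).le_of_opNorm_le (hMε x t) _
    choose w' hw' hw'0 hw'K using hex
    refine ⟨hwS.weightedLipschitz.mono (mul_le_mul_of_nonneg_right hσs hμ0.le), w',
      fun x t => ?_, fun i => ?_⟩
    · obtain ⟨CM, hCM, qM⟩ := WeightedSmooth.exists_quadratic_bound dM
        (fun i => (sM i).weightedLipschitz)
      obtain ⟨Cc, hCc, qc⟩ := WeightedSmooth.exists_quadratic_bound dc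
        (fun i => (sc i).weightedLipschitz)
      obtain ⟨-, ⟨D, hD, bw⟩, ⟨L, hL, lw⟩⟩ := hwS.weightedLipschitz
      choose BM hBM bM using fun i => (sM i).weightedLipschitz.bound
      choose K hK using fun i => hw'K i x
      set S := ∑ i, ‖LinearMap.toContinuousLinearMap (b.coord i)‖ * BM i with hS
      have hS0 : 0 ≤ S := Finset.sum_nonneg fun i _ => mul_nonneg (norm_nonneg _) (hBM i)
      have hbM : ∀ t, ‖ofPartials b (fun i => M' i x t)‖ ≤ S * Real.exp (μ * |t|) := by
        intro t
        refine (norm_ofPartials_le b _).trans ?_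
        rw [hS, Finset.sum_mul]
        refine Finset.sum_le_sum fun i _ => ?_
        rw [mul_assoc]
        gcongr
        exact bM i x t
      have hK' : ∀ (y : E) t, ‖w y t - w x t - ofPartials b (fun i => w' i x t) (y - x)‖ ≤
          (D + D + (∑ i, ‖LinearMap.toContinuousLinearMap (b.coord i)‖ * K i) * ‖y - x‖) *
            Real.exp (μ₁ * |t|) := by
        intro y t
        rw [add_mul, add_mul]
        refine (norm_sub_le _ _).trans (add_le_add ((norm_sub_le _ _).trans
          (add_le_add ((bw y t).trans ?_) ((bw x t).trans ?_))) ?_)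
        · gcongr
        · gcongr
        · refine ((ofPartials b (fun i => w' i x t)).le_opNorm _).trans ?_
          rw [mul_right_comm]
          gcongr
          refine (norm_ofPartials_le b _).trans ?_
          rw [Finset.sum_mul]
          refine Finset.sum_le_sum fun i _ => ?_
          rw [mul_assoc]
          gcongr
          exact hK i t
      refine hasFDerivAt_of_quadratic
        (K := 2 * (perronConst η β C * (CM * D + S * L + Cc)) * Real.exp (μ₁ * |t|)) fun y => ?_
      have := h.estimate_of_small
        (u := fun t => w y t - w x t - ofPartials b (fun i => w' i x t) (y - x))
        (g := fun t => M y t (w y t) + c y t - (M x t (w x t) + c x t) -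
          ofPartials b (fun i => M x t (w' i x t) + (M' i x t (w x t) + c' i x t)) (y - x))
        (G := (CM * D + S * L + Cc) * ‖y - x‖ ^ 2) (by linarith) hμ₁β' hε hε0
        (fun t => by
          have hsum : HasDerivAt (fun t => ofPartials b (fun i => w' i x t) (y - x))
              (∑ i, b.coord i (y - x) • (J (w' i x t) +
                (M x t (w' i x t) + (M' i x t (w x t) + c' i x t)))) t := by
            simp only [ofPartials_apply]
            exact HasDerivAt.fun_sum fun i _ => (hw' i x t).const_smul _
          refine (((hw y t).sub (hw x t)).sub hsum).congr_deriv ?_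
          generalize y - x = δ
          simp only [ofPartials_apply, map_sub, map_sum, map_smul, smul_add,
            Finset.sum_add_distrib]
          abel)
        (fun t => by
          have e : M y t (w y t) + c y t - (M x t (w x t) + c x t) -
              ofPartials b (fun i => M x t (w' i x t) + (M' i x t (w x t) + c' i x t)) (y - x) =
              M x t (w y t - w x t - ofPartials b (fun i => w' i x t) (y - x)) +
              ((M y t - M x t - ofPartials b (fun i => M' i x t) (y - x)) (w y t) +
                ofPartials b (fun i => M' i x t) (y - x) (w y t - w x t) +
                (c y t - c x t - ofPartials b (fun i => c' i x t) (y - x))) := by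
            simp only [ofPartials_apply, map_sub, map_sum, map_smul, smul_add,
              Finset.sum_add_distrib, sub_apply, sum_apply,
              smul_apply]
            abel
          rw [e]
          refine (norm_add_le _ _).trans (add_le_add ((M x t).le_of_opNorm_le (hMε x t) _) ?_)
          have e1 : Real.exp (μ * |t|) * Real.exp (σ * μ * |t|) = Real.exp (μ₁ * |t|) := by
            rw [← Real.exp_add, hμ₁]
            congr 1
            ring
          have e2 : Real.exp (μ * |t|) ≤ Real.exp (μ₁ * |t|) := by gcongr
          have i1 : ‖(M y t - M x t - ofPartials b (fun i => M' i x t) (y - x)) (w y t)‖ ≤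
              CM * D * ‖y - x‖ ^ 2 * Real.exp (μ₁ * |t|) := by
            refine ((M y t - M x t - ofPartials b (fun i => M' i x t) (y - x)).le_opNorm _).trans ?_
            calc _ ≤ (CM * ‖y - x‖ ^ 2 * Real.exp (μ * |t|)) * (D * Real.exp (σ * μ * |t|)) := by
                  gcongr
                  · exact qM x y t
                  · exact bw y t
              _ = CM * D * ‖y - x‖ ^ 2 * (Real.exp (μ * |t|) * Real.exp (σ * μ * |t|)) := by ring
              _ = _ := by rw [e1]
          have i2 : ‖ofPartials b (fun i => M' i x t) (y - x) (w y t - w x t)‖ ≤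
              S * L * ‖y - x‖ ^ 2 * Real.exp (μ₁ * |t|) := by
            refine ((ofPartials b (fun i => M' i x t) (y - x)).le_opNorm _).trans ?_
            calc _ ≤ (S * Real.exp (μ * |t|) * ‖y - x‖) *
                  (L * ‖y - x‖ * Real.exp (σ * μ * |t|)) := by
                  gcongr
                  · exact (ofPartials b (fun i => M' i x t)).le_of_opNorm_le (hbM t) _
                  · exact lw y x t
              _ = S * L * ‖y - x‖ ^ 2 * (Real.exp (μ * |t|) * Real.exp (σ * μ * |t|)) := by ring
              _ = _ := by rw [e1]
          have i3 : ‖c y t - c x t - ofPartials b (fun i => c' i x t) (y - x)‖ ≤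
              Cc * ‖y - x‖ ^ 2 * Real.exp (μ₁ * |t|) := by
            refine (qc x y t).trans ?_
            gcongr
          refine (norm_add₃_le).trans ((add_le_add (add_le_add i1 i2) i3).trans (le_of_eq ?_))
          ring)
        (hK' y) t
      refine this.trans (le_of_eq ?_)
      simp only [map_sub, hw0, ofPartials_apply, map_sum, map_smul, hw'0]
      simp
      ring
    · have := ih (μ := μ₁) (by linarith) hμ₁β (ξ := 0)
        ((show WeightedSmooth b (k + 1) μ M from ⟨aM, M', dM, sM⟩).of_succ.mono hμ₁μ)
        (hc₁ i) (fun x t => hw' i x t) (fun x => hw'0 i x) (fun x => hw'K i x) (by linarith)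
      refine this.mono (le_of_eq ?_)
      rw [weightFactor, hμ₁]
      ring

/-- The factor by which the exponential weight grows when `k + 1` derivatives with respect to the
center part of the initial value are taken of the solutions of a nonlinear equation. -/
def curveWeightFactor : ℕ → ℝ
  | 0 => weightFactor 0
  | k + 1 => weightFactor (k + 1) * ((k + 2) * curveWeightFactor k)

theorem two_le_curveWeightFactor (k : ℕ) : 2 ≤ curveWeightFactor k := by
  induction k with
  | zero => exact two_le_weightFactor 0
  | succ k ih =>
    have := two_le_weightFactor (k + 1)
    have hk : (0 : ℝ) ≤ k := k.cast_nonneg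
    have h2 : 2 ≤ (k + 2) * curveWeightFactor k := by nlinarith
    rw [curveWeightFactor]
    nlinarith

theorem curveWeightFactor_le_succ (k : ℕ) : curveWeightFactor k ≤ curveWeightFactor (k + 1) := by
  have h1 := two_le_weightFactor (k + 1)
  have h2 := two_le_curveWeightFactor k
  have hk : (0 : ℝ) ≤ k := k.cast_nonneg
  have h3 : curveWeightFactor k ≤ (k + 2) * curveWeightFactor k :=
    le_mul_of_one_le_left (by linarith) (by linarith)
  rw [curveWeightFactor]
  exact h3.trans (le_mul_of_one_le_left (by linarith) (by linarith))

/-- A nonlinear equation `u' = J u + N u` with small nonlinearity has, for every prescribed center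
part of the initial value, an exponentially bounded solution, whose initial value is a
`C^(k + 1)` function of that center part. -/
theorem IsTrichotomy.exists_contDiff_family [FiniteDimensional ℝ Z]
    (h : IsTrichotomy J Pc Ps Pu η β C) {ε μ : ℝ}
    (hε : perronConst η β C * ε ≤ 1 / 2) (hμ : 2 * η ≤ μ) (k : ℕ)
    (hμβ : curveWeightFactor k * μ ≤ β / 2)
    {N : Z → Z} (hN : ContDiff ℝ ∞ N) (hNc : HasCompactSupport N)
    (hNε : ∀ z, ‖fderiv ℝ N z‖ ≤ ε) (e : E →L[ℝ] Z) (he : ∀ x, Pc (e x) = e x) :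
    ∃ u : E → ℝ → Z, (∀ x t, HasDerivAt (u x) (J (u x t) + N (u x t)) t) ∧
      (∀ x, Pc (u x 0) = e x) ∧ (∀ x, ∃ K, ∀ t, ‖u x t‖ ≤ K * Real.exp (μ * |t|)) ∧
      ContDiff ℝ (k + 1 : ℕ) (fun x => u x 0) ∧
      (N 0 = 0 → fderiv ℝ N 0 = 0 → HasFDerivAt (fun x => u x 0) e 0) := by
  have hη := h.rate_pos
  have hC := h.const_pos
  have hκ := h.perronConst_pos
  have hμ0 : 0 < μ := by linarith
  have hε0 : 0 ≤ ε := (norm_nonneg _).trans (hNε 0)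
  have h2μ : 2 * μ ≤ β / 2 :=
    (mul_le_mul_of_nonneg_right (two_le_curveWeightFactor k) hμ0.le).trans hμβ
  have hNlip : ∀ y z, ‖N y - N z‖ ≤ ε * ‖y - z‖ := fun y z =>
    convex_univ.norm_image_sub_le_of_norm_fderiv_le (𝕜 := ℝ)
      (fun x _ => (hN.differentiable (by simp)) x) (fun x _ => hNε x) (Set.mem_univ _)
      (Set.mem_univ _)
  have hex : ∀ x, ∃ u : ℝ → Z, (∀ t, HasDerivAt u (J (u t) + N (u t)) t) ∧ Pc (u 0) = e x ∧
      ∃ K, ∀ t, ‖u t‖ ≤ K * Real.exp (μ * |t|) := fun x =>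
    h.exists_solution_of_small (N := fun _ z => N z) (G := ‖N 0‖) hμ (by linarith) hε hε0
      (hN.continuous.comp continuous_snd) (fun _ => hNlip)
      (fun t => le_mul_of_one_le_right (norm_nonneg _) (Real.one_le_exp (by positivity))) (e x) (he x)
  choose u hu hu0 huK using hex
  refine ⟨u, hu, hu0, huK, ?_⟩
  have hcont : ∀ x, Continuous (u x) := fun x =>
    continuous_iff_continuousAt.2 fun t => (hu x t).continuousAt
  -- the difference of two of the solutions solves an equation with Lipschitz nonlinearity
  have hlip : ∀ x y t, ‖u x t - u y t‖ ≤ 2 * (C * ‖e‖) * ‖x - y‖ * Real.exp (μ * |t|) := by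
    intro x y t
    obtain ⟨K₁, hK₁⟩ := huK x
    obtain ⟨K₂, hK₂⟩ := huK y
    have := h.estimate_of_small (u := fun t => u x t - u y t)
      (g := fun t => N (u x t) - N (u y t)) (G := 0) (K := K₁ + K₂) hμ (by linarith) hε hε0
      (fun t => ((hu x t).sub (hu y t)).congr_deriv (by rw [map_sub]; abel))
      (fun t => by simpa using hNlip _ _) (fun t => by
        rw [add_mul]
        exact (norm_sub_le _ _).trans (add_le_add (hK₁ t) (hK₂ t))) t
    refine this.trans ?_
    gcongr ?_ * _
    rw [map_sub, hu0, hu0, ← map_sub, mul_zero, add_zero, mul_assoc, mul_assoc]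
    gcongr
    exact e.le_opNorm _
  -- the partial derivatives `v i` of `u` are defined as the solutions of the variational equation
  let b := Module.finBasis ℝ E
  have hDc : Continuous (fderiv ℝ N) := hN.continuous_fderiv (by simp)
  have hex' : ∀ i x, ∃ v : ℝ → Z, (∀ t, HasDerivAt v (J (v t) + fderiv ℝ N (u x t) (v t)) t) ∧
      Pc (v 0) = e (b i) ∧ ∃ K, ∀ t, ‖v t‖ ≤ K * Real.exp (μ * |t|) := fun i x =>
    h.exists_solution_of_small (N := fun t z => fderiv ℝ N (u x t) z) (G := 0) hμ (by linarith)
      hε hε0 (((hDc.comp (hcont x)).comp continuous_fst).clm_apply continuous_snd)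
      (fun t z z' => by
        rw [← map_sub]
        exact (fderiv ℝ N (u x t)).le_of_opNorm_le (hNε _) _)
      (fun t => by simp) (e (b i)) (he _)
  choose v hv hv0 hvK using hex'
  -- The remainder of the linear approximation solves the variational equation up to an error that is
  -- quadratic in `y - x` and has the weight `2 μ`: so the remainder is quadratic itself.
  have hd : ∀ x t, HasFDerivAt (fun x => u x t) (ofPartials b fun i => v i x t) x := by
    intro x t
    obtain ⟨L, hL, hL2⟩ := exists_lipschitz_of_contDiff_compact
      (hN.fderiv_right (m := ∞) (by simp)) (hNc.fderiv ℝ)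
    choose K hK using fun i => hvK i x
    set A := 2 * (C * ‖e‖) with hA
    have hA0 : 0 ≤ A := by positivity
    refine hasFDerivAt_of_quadratic
      (K := 2 * (perronConst η β C * (L * A ^ 2)) * Real.exp (2 * μ * |t|)) fun y => ?_
    have hexp : ∀ t, Real.exp (μ * |t|) ≤ Real.exp (2 * μ * |t|) := fun t => by
      gcongr
      linarith
    have := h.estimate_of_small
      (u := fun t => u y t - u x t - ofPartials b (fun i => v i x t) (y - x))
      (g := fun t => N (u y t) - N (u x t) -
        ofPartials b (fun i => fderiv ℝ N (u x t) (v i x t)) (y - x))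
      (G := L * A ^ 2 * ‖y - x‖ ^ 2) (μ := 2 * μ)
      (K := A * ‖y - x‖ + (∑ i, ‖LinearMap.toContinuousLinearMap (b.coord i)‖ * K i) * ‖y - x‖)
      (by linarith) h2μ hε hε0
      (fun t => by
        have hsum : HasDerivAt (fun t => ofPartials b (fun i => v i x t) (y - x))
            (∑ i, b.coord i (y - x) • (J (v i x t) + fderiv ℝ N (u x t) (v i x t))) t := by
          simp only [ofPartials_apply]
          exact HasDerivAt.fun_sum fun i _ => (hv i x t).const_smul _
        refine (((hu y t).sub (hu x t)).sub hsum).congr_deriv ?_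
        generalize y - x = δ
        simp only [ofPartials_apply, map_sub, map_sum, map_smul, smul_add,
          Finset.sum_add_distrib]
        abel)
      (fun t => by
        have e1 : N (u y t) - N (u x t) -
            ofPartials b (fun i => fderiv ℝ N (u x t) (v i x t)) (y - x) =
            fderiv ℝ N (u x t) (u y t - u x t - ofPartials b (fun i => v i x t) (y - x)) +
            (N (u y t) - N (u x t) - fderiv ℝ N (u x t) (u y t - u x t)) := by
          rw [← comp_ofPartials, ContinuousLinearMap.comp_apply, map_sub _ (u y t - u x t)]
          abel
        rw [e1]
        refine (norm_add_le _ _).trans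
          (add_le_add ((fderiv ℝ N (u x t)).le_of_opNorm_le (hNε _) _) ?_)
        have h1 := norm_sub_sub_le_of_lipschitz_deriv hL
          (fun z => ((hN.differentiable (by simp)) z).hasFDerivAt) hL2 (u x t) (u y t)
        refine h1.trans ?_
        calc L * ‖u y t - u x t‖ ^ 2 ≤ L * (A * ‖y - x‖ * Real.exp (μ * |t|)) ^ 2 := by
              gcongr
              exact hlip y x t
          _ = L * A ^ 2 * ‖y - x‖ ^ 2 * (Real.exp (μ * |t|) * Real.exp (μ * |t|)) := by ring
          _ = _ := by
              rw [← Real.exp_add, show μ * |t| + μ * |t| = 2 * μ * |t| by ring])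
      (fun t => by
        rw [add_mul]
        refine (norm_sub_le _ _).trans (add_le_add ((hlip y x t).trans ?_) ?_)
        · gcongr
          linarith
        · refine ((ofPartials b (fun i => v i x t)).le_opNorm _).trans ?_
          rw [mul_right_comm]
          gcongr
          refine (norm_ofPartials_le b _).trans ?_
          rw [Finset.sum_mul]
          refine Finset.sum_le_sum fun i _ => ?_
          rw [mul_assoc]
          gcongr
          exact (hK i t).trans (mul_le_mul_of_nonneg_left (hexp t)
            (by simpa using (norm_nonneg _).trans (hK i 0)))) t
    refine this.trans (le_of_eq ?_)
    have e2 : Pc (u y 0 - u x 0 - ofPartials b (fun i => v i x 0) (y - x)) = 0 := by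
      have e3 : y - x = ∑ i, b.coord i (y - x) • b i := (b.sum_repr (y - x)).symm
      rw [map_sub, map_sub, hu0, hu0, ← map_sub, ofPartials_apply]
      simp only [map_sum, map_smul, hv0]
      conv_lhs => enter [1]; rw [e3]
      simp only [map_sum, map_smul, sub_self]
    rw [e2]
    simp
    ring
  -- Bootstrapping: if the `v i` have `j` derivatives, then `u` has `j + 1`, and so have the
  -- coefficients of the variational equation and its solutions `v i`.
  have hs : ∀ j ≤ k, ∀ i, WeightedSmooth b j (curveWeightFactor j * μ) (v i) := by
    intro j
    induction j with
    | zero =>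
      intro _ i
      have hM := WeightedSmooth.comp (b := b) (u' := v) (hN.fderiv_right (m := ∞) (by simp))
        (hNc.fderiv ℝ) hμ0.le hcont ⟨_, by positivity, hlip⟩ 0 (by simp)
      refine h.weightedSmooth_linear hε hε0 0 hμ h2μ (M := fun x t => fderiv ℝ N (u x t))
        (c := fun _ _ => 0) (ξ := e (b i)) (by simpa using hM)
        (WeightedSmooth.zero _ _)
        (fun x t => hNε _) (fun x t => by simpa using hv i x t) (hv0 i) (hvK i)
    | succ j ih =>
      intro hj i
      have ih := ih (by omega)
      have hf := two_le_curveWeightFactor j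
      have hμj : μ ≤ curveWeightFactor j * μ := le_mul_of_one_le_left hμ0.le (by linarith)
      have hj0 : (0 : ℝ) ≤ j := j.cast_nonneg
      have hμj' : μ ≤ ((j + 1 : ℕ) + 1 : ℝ) * (curveWeightFactor j * μ) :=
        hμj.trans (le_mul_of_one_le_left (by linarith) (by push_cast; linarith))
      have hM := WeightedSmooth.comp (b := b) (u' := v) (hN.fderiv_right (m := ∞) (by simp))
        (hNc.fderiv ℝ) (μ := curveWeightFactor j * μ) (by linarith) hcont
        ⟨2 * (C * ‖e‖), by positivity, fun x y t => (hlip x y t).trans (by gcongr)⟩ (j + 1)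
        (fun l hl => ⟨hd, fun i => (ih i).of_le (by omega)⟩)
      have he : curveWeightFactor (j + 1) * μ =
          weightFactor (j + 1) * (((j + 1 : ℕ) + 1 : ℝ) * (curveWeightFactor j * μ)) := by
        rw [curveWeightFactor]
        push_cast
        ring
      rw [he]
      refine h.weightedSmooth_linear hε hε0 (j + 1) (by linarith) ?_ hM
        (c := fun _ _ => 0) (ξ := e (b i)) (WeightedSmooth.zero _ _)
        (fun x t => hNε _) (fun x t => by simpa using hv i x t) (hv0 i) (fun x => ?_)
      · rw [← he]
        exact (mul_le_mul_of_nonneg_right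
          (monotone_nat_of_le_succ curveWeightFactor_le_succ hj) hμ0.le).trans hμβ
      · obtain ⟨K, hK⟩ := hvK i x
        have hK0 : 0 ≤ K := by simpa using (norm_nonneg _).trans (hK 0)
        exact ⟨K, fun t => (hK t).trans (by gcongr)⟩
  refine ⟨?_, fun hN0 hN1 => ?_⟩
  · push_cast
    refine contDiff_succ_iff_hasFDerivAt.2 ⟨_, ?_, fun x => hd x 0⟩
    unfold ofPartials
    refine ContDiff.sum fun i _ => ?_
    exact ((ContinuousLinearMap.smulRightL ℝ E Z
      (LinearMap.toContinuousLinearMap (b.coord i))).contDiff).comp ((hs k le_rfl i).contDiff 0)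
  · have hu00 : u 0 = fun _ => 0 := by
      obtain ⟨K, hK⟩ := huK 0
      exact h.eq_of_small (N := fun _ => N) (K' := 0) hμ (by linarith) hε hε0 (fun _ => hNlip)
        (hu 0) (fun t => by simpa [hN0] using hasDerivAt_const t (0 : Z)) hK (by simp)
        (by simp [hu0])
    have hvi : ∀ i, v i 0 0 = e (b i) := by
      intro i
      obtain ⟨K, hK⟩ := hvK i 0
      have := h.eq_of_small (N := fun _ _ => 0) (v := fun t => exp (t • J) (e (b i)))
        (K' := C * ‖e (b i)‖) hμ (by linarith) hε hε0
        (fun _ _ _ => by simpa using mul_nonneg hε0 (norm_nonneg _))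
        (fun t => by simpa [hu00, hN1] using hv i 0 t)
        (fun t => by simpa using hasDerivAt_exp_smul_apply J (e (b i)) t) hK
        (fun t => by
          have h1 := h.center t (e (b i))
          rw [he] at h1
          refine h1.trans ?_
          rw [mul_right_comm]
          gcongr
          linarith)
        (by simp [hv0, he])
      rw [this]
      simp
    refine (hd 0 0).congr_fderiv ?_
    ext x
    have h1 := congrArg e (b.sum_repr x)
    rw [map_sum] at h1
    rw [← h1]
    simp only [hvi, ofPartials_apply, map_smul, Module.Basis.coord_apply]

end SmoothDependence

/-! ### Existence of local center manifolds -/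

section Existence

open Metric Filter

/-- A nonlinearity that vanishes to second order at the origin can be modified away from the
origin to a globally defined one with compact support and arbitrarily small derivative. -/
theorem exists_cutoff {Z F : Type*} [NormedAddCommGroup Z] [NormedSpace ℝ Z]
    [FiniteDimensional ℝ Z] [NormedAddCommGroup F] [NormedSpace ℝ F] {N : Z → F}
    (hN : ∀ᶠ z in 𝓝 0, ContDiffAt ℝ ∞ N z) (h0 : N 0 = 0) (h1 : fderiv ℝ N 0 = 0) {ε : ℝ}
    (hε : 0 < ε) :
    ∃ N' : Z → F, ContDiff ℝ ∞ N' ∧ HasCompactSupport N' ∧ (∀ z, ‖fderiv ℝ N' z‖ ≤ ε) ∧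
      N' =ᶠ[𝓝 0] N := by
  let χ : ContDiffBump (0 : Z) := ⟨1, 2, one_pos, one_lt_two⟩
  have hχ : ContDiff ℝ ∞ χ := χ.contDiff
  obtain ⟨A, hA⟩ := (χ.hasCompactSupport.fderiv (𝕜 := ℝ)).exists_bound_of_continuous
    (hχ.continuous_fderiv (by simp))
  have hA0 : 0 ≤ A := (norm_nonneg _).trans (hA 0)
  -- The cutoff function at scale `δ` has a derivative of size `A / δ`, and `N` is of size `2 δ ε'` on
  -- its support: in total the derivative of the product is at most `(1 + 2 A) ε'`.
  set ε' := ε / (1 + 2 * A) with hε'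
  have hε'0 : 0 < ε' := by positivity
  have hc : ContinuousAt (fderiv ℝ N) 0 :=
    (hN.self_of_nhds.fderiv_right (m := 0) (by simp)).continuousAt
  have hs : ∀ᶠ z in 𝓝 (0 : Z), ‖fderiv ℝ N z‖ < ε' := by
    have := hc.norm
    rw [ContinuousAt, h1, norm_zero] at this
    exact this.eventually (gt_mem_nhds hε'0)
  obtain ⟨r, hr, hball⟩ := Metric.eventually_nhds_iff_ball.1 (hN.and hs)
  -- the support of the cutoff function has radius `2 δ < r`
  set δ := r / 3 with hδ
  have hδ0 : 0 < δ := by positivity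
  have hsm : ContDiff ℝ ∞ (fun z : Z => χ (δ⁻¹ • z)) := hχ.comp (contDiff_const_smul δ⁻¹)
  have hnorm : ∀ z : Z, ‖δ⁻¹ • z‖ = ‖z‖ / δ := fun z => by
    rw [norm_smul, norm_inv, Real.norm_of_nonneg hδ0.le, inv_mul_eq_div]
  have hzero : ∀ z ∉ closedBall (0 : Z) (2 * δ),
      (fun z => χ (δ⁻¹ • z) • N z) =ᶠ[𝓝 z] fun _ => 0 := by
    intro z hz
    filter_upwards [isClosed_closedBall.isOpen_compl.mem_nhds hz] with y hy
    have : χ (δ⁻¹ • y) = 0 := by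
      refine χ.zero_of_le_dist ?_
      rw [dist_zero_right, hnorm]
      simp only [Set.mem_compl_iff, mem_closedBall, dist_zero_right, not_le] at hy
      exact (le_div_iff₀ hδ0).2 hy.le
    rw [this, zero_smul]
  have hsub : closedBall (0 : Z) (2 * δ) ⊆ ball 0 r := closedBall_subset_ball (by linarith)
  refine ⟨fun z => χ (δ⁻¹ • z) • N z, contDiff_iff_contDiffAt.2 fun z => ?_, ?_, fun z => ?_, ?_⟩
  · by_cases hz : z ∈ closedBall (0 : Z) (2 * δ)
    · exact hsm.contDiffAt.smul (hball z (hsub hz)).1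
    · exact contDiffAt_const.congr_of_eventuallyEq (hzero z hz)
  · refine HasCompactSupport.intro (isCompact_closedBall 0 (2 * δ)) fun z hz => ?_
    exact (hzero z hz).self_of_nhds
  · by_cases hz : z ∈ closedBall (0 : Z) (2 * δ)
    · have hd : HasFDerivAt (fun z => χ (δ⁻¹ • z) • N z) (χ (δ⁻¹ • z) • fderiv ℝ N z +
          ((fderiv ℝ χ (δ⁻¹ • z)).comp (δ⁻¹ • ContinuousLinearMap.id ℝ Z)).smulRight (N z)) z := by
        refine HasFDerivAt.fun_smul ?_
          (((hball z (hsub hz)).1.differentiableAt (by simp)).hasFDerivAt)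
        exact ((hχ.differentiable (by simp) _).hasFDerivAt).comp z
          ((hasFDerivAt_id z).const_smul δ⁻¹)
      have hNz : ‖N z‖ ≤ ε' * (2 * δ) := by
        have := (convex_ball (0 : Z) r).norm_image_sub_le_of_norm_fderiv_le (𝕜 := ℝ) (f := N)
          (fun x hx => (hball x hx).1.differentiableAt (by simp)) (fun x hx => (hball x hx).2.le)
          (mem_ball_self hr) (hsub hz)
        rw [h0, sub_zero, sub_zero] at this
        refine this.trans ?_
        gcongr
        simpa using hz
      rw [hd.fderiv]
      calc _ ≤ ‖χ (δ⁻¹ • z) • fderiv ℝ N z‖ + _ := norm_add_le _ _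
        _ ≤ 1 * ε' + (A * δ⁻¹) * (ε' * (2 * δ)) := by
          rw [norm_smul, ContinuousLinearMap.norm_smulRight_apply]
          gcongr
          · rw [Real.norm_of_nonneg χ.nonneg]
            exact χ.le_one
          · exact (hball z (hsub hz)).2.le
          · refine (ContinuousLinearMap.opNorm_comp_le _ _).trans ?_
            gcongr
            · exact hA _
            · refine ContinuousLinearMap.opNorm_le_bound _ (by positivity) fun x => ?_
              simp [norm_smul, abs_of_pos hδ0]
        _ = ε := by
          rw [hε']
          field_simp
    · rw [(hzero z hz).fderiv_eq]
      simp [hε.le]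
  · filter_upwards [ball_mem_nhds (0 : Z) hδ0] with z hz
    have : χ (δ⁻¹ • z) = 1 := by
      refine χ.one_of_mem_closedBall ?_
      rw [mem_closedBall, dist_zero_right, hnorm]
      exact (div_le_one hδ0).2 (mem_ball_zero_iff.1 hz).le
    rw [this, one_smul]

/-- A solution on an interval agrees with a global solution that it meets in one point. -/
theorem eqOn_Icc_of_lipschitz {Z : Type*} [NormedAddCommGroup Z] [NormedSpace ℝ Z] {F : Z → Z}
    {K : NNReal} (hF : LipschitzWith K F) {γ v : ℝ → Z} {a b t₀ : ℝ} (ht₀ : t₀ ∈ Set.Icc a b)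
    (hγ : ∀ t ∈ Set.Icc a b, HasDerivWithinAt γ (F (γ t)) (Set.Icc a b) t)
    (hv : ∀ t, HasDerivAt v (F (v t)) t) (h : γ t₀ = v t₀) : Set.EqOn γ v (Set.Icc a b) := by
  have hc : ContinuousOn γ (Set.Icc a b) := fun t ht => (hγ t ht).continuousWithinAt
  have hvc : Continuous v := continuous_iff_continuousAt.2 fun t => (hv t).continuousAt
  rw [← Set.Icc_union_Icc_eq_Icc ht₀.1 ht₀.2]
  refine Set.EqOn.union ?_ ?_
  · refine ODE_solution_unique_of_mem_Icc_left (v := fun _ => F) (s := fun _ => Set.univ)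
      (fun t _ => hF.lipschitzOnWith) (hc.mono (Set.Icc_subset_Icc_right ht₀.2))
      (fun t ht => ?_) (fun _ _ => trivial) hvc.continuousOn
      (fun t _ => (hv t).hasDerivWithinAt) (fun _ _ => trivial) h
    exact (hγ t ⟨ht.1.le, ht.2.trans ht₀.2⟩).mono_of_mem_nhdsWithin
      (mem_of_superset (Ioc_mem_nhdsLE ht.1) fun s hs =>
        ⟨hs.1.le, hs.2.trans (ht.2.trans ht₀.2)⟩)
  · refine ODE_solution_unique_of_mem_Icc_right (v := fun _ => F) (s := fun _ => Set.univ)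
      (fun t _ => hF.lipschitzOnWith) (hc.mono (Set.Icc_subset_Icc_left ht₀.1))
      (fun t ht => ?_) (fun _ _ => trivial) hvc.continuousOn
      (fun t _ => (hv t).hasDerivWithinAt) (fun _ _ => trivial) h
    exact (hγ t ⟨ht₀.1.trans ht.1, ht.2.le⟩).mono_of_mem_nhdsWithin
      (mem_of_superset (Ico_mem_nhdsGE ht.2) fun s hs =>
        ⟨ht₀.1.trans (ht.1.trans hs.1), hs.2.le⟩)

/-- **Center manifold theorem.** A smooth vector field on a finite-dimensional space has, at every
equilibrium and for every finite `k`, a local center manifold of class `C^k`. It consists of the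
initial values of the slowly growing solutions of a globally modified equation. -/
theorem exists_isLocalCenterManifold {Z : Type v} [NormedAddCommGroup Z] [NormedSpace ℝ Z]
    [FiniteDimensional ℝ Z] (k : ℕ) {S : Z → Z} {J : Z →L[ℝ] Z}
    (hS : ∀ᶠ z in 𝓝 0, ContDiffAt ℝ ∞ S z) (hS0 : S 0 = 0) (hJ : HasFDerivAt S J 0) :
    ∃ Ψ, IsLocalCenterManifold k S J Ψ := by
  have : CompleteSpace Z := FiniteDimensional.complete ℝ Z
  obtain ⟨β, hβ, hη⟩ := exists_isTrichotomy J
  have hw := two_le_curveWeightFactor k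
  -- all the weights needed for `k + 1` derivatives lie below half of the spectral gap
  set μ := β / (2 * curveWeightFactor k) with hμ
  have hμ0 : 0 < μ := by positivity
  have hμβ : curveWeightFactor k * μ ≤ β / 2 := by
    rw [hμ]
    exact le_of_eq (by field_simp)
  obtain ⟨C, h⟩ := hη (μ / 2) (by positivity)
  have hκ := h.perronConst_pos
  -- a Lipschitz constant for which the Perron operator is a contraction
  set ε := 1 / (2 * perronConst (μ / 2) β C) with hε
  have hε0 : 0 < ε := by positivity
  have hεκ : perronConst (μ / 2) β C * ε ≤ 1 / 2 := by
    rw [hε]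
    exact le_of_eq (by field_simp)
  have hJN : HasFDerivAt (fun z => S z - J z) 0 0 :=
    (hJ.sub J.hasFDerivAt).congr_fderiv (sub_self J)
  obtain ⟨N, hN, hNc, hNε, hNS⟩ := exists_cutoff (N := fun z => S z - J z)
    (hS.mono fun z hz => hz.sub J.contDiff.contDiffAt) (by simp [hS0]) hJN.fderiv hε0
  have hμ2 : 2 * (μ / 2) ≤ μ := by linarith
  have hμβ' : μ ≤ β / 2 := (le_mul_of_one_le_left hμ0.le (by linarith)).trans hμβ
  have hPc : ∀ z : Z, spectralProj J {0} z ∈ centerSubspace (J : Module.End ℝ Z) := fun z => by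
    rw [← spectralSubspace_singleton]
    exact spectralProj_mem J _ z
  obtain ⟨u, hu, hu0, huK, hud, hu1⟩ := h.exists_contDiff_family hεκ hμ2 k hμβ hN hNc hNε
    (centerSubspace (J : Module.End ℝ Z)).subtypeL
    (fun x => spectralProj_of_mem J (by rw [spectralSubspace_singleton]; exact x.2))
  have hNlip : ∀ y z, ‖N y - N z‖ ≤ ε * ‖y - z‖ := fun y z =>
    convex_univ.norm_image_sub_le_of_norm_fderiv_le (𝕜 := ℝ)
      (fun x _ => (hN.differentiable (by simp)) x) (fun x _ => hNε x) (Set.mem_univ _)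
      (Set.mem_univ _)
  have hN0 : N 0 = 0 := by simpa [hS0] using hNS.self_of_nhds
  have hN1 : fderiv ℝ N 0 = 0 := by rw [hNS.fderiv_eq, hJN.fderiv]
  -- the projection onto the hyperbolic subspace
  let Q : Z →L[ℝ] hyperbolicSubspace (J : Module.End ℝ Z) :=
    LinearMap.toContinuousLinearMap (Submodule.projectionOnto _ _
      (isCompl_center_hyperbolic (J : Module.End ℝ Z)).symm)
  have hQc : ∀ z ∈ centerSubspace (J : Module.End ℝ Z), Q z = 0 := fun z hz =>
    Submodule.projectionOnto_apply_of_mem_right _ hz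
  have hQ : ∀ z : Z, (Q z : Z) = z - spectralProj J {0} z := by
    intro z
    have hm : z - spectralProj J {0} z ∈ hyperbolicSubspace (J : Module.End ℝ Z) := by
      have h1 : z - spectralProj J {0} z =
          spectralProj J (Set.Iio 0) z + spectralProj J (Set.Ioi 0) z := by
        rw [sub_eq_iff_eq_add]
        nth_rewrite 1 [← h.sum z]
        abel
      rw [h1, ← spectralSubspace_compl_singleton]
      exact Submodule.add_mem _
        (spectralSubspace_mono _ (by simp [Set.subset_def]; exact fun x hx => hx.ne)
          (spectralProj_mem J _ z))
        (spectralSubspace_mono _ (by simp [Set.subset_def]; exact fun x hx => hx.ne')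
          (spectralProj_mem J _ z))
    have h2 : Q (z - spectralProj J {0} z) = ⟨_, hm⟩ :=
      Submodule.projectionOnto_apply_of_mem_left _ hm
    rw [map_sub, hQc _ (hPc z), sub_zero] at h2
    rw [h2]
  have hgraph : ∀ c, (u c 0) = (c : Z) + (Q (u c 0) : Z) := by
    intro c
    rw [hQ, hu0]
    simp
  -- Slowly growing solutions stay on the graph: the equation is autonomous, so a time shift of such
  -- a solution is the one that belongs to its own initial value.
  have hmem : ∀ (v : ℝ → Z) (K : ℝ), (∀ t, HasDerivAt v (J (v t) + N (v t)) t) →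
      (∀ t, ‖v t‖ ≤ K * Real.exp (μ * |t|)) → ∀ t, v t ∈ centerGraph J (fun c => Q (u c 0)) := by
    intro v K hv hK t
    obtain ⟨K', hK'⟩ := huK ⟨_, hPc (v t)⟩
    have hK0 : 0 ≤ K := by simpa using (norm_nonneg _).trans (hK 0)
    have := h.eq_of_small (u := fun s => v (s + t)) (v := u ⟨_, hPc (v t)⟩) (N := fun _ => N)
      (K := K * Real.exp (μ * |t|)) hμ2 hμβ' hεκ hε0.le (fun _ => hNlip)
      (fun s => by simpa using (hv (s + t)).comp_add_const s t) (hu _) (fun s => ?_) hK'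
      (by simp [hu0])
    · have h1 := congrFun this 0
      simp only [zero_add] at h1
      exact ⟨_, h1.trans (hgraph _)⟩
    · refine (hK _).trans ?_
      rw [mul_assoc, ← Real.exp_add]
      gcongr
      rw [← mul_add]
      gcongr
      rw [add_comm]
      exact abs_add_le t s
  obtain ⟨r, hr, hO⟩ := Metric.eventually_nhds_iff_ball.1 hNS
  have hO' : ∀ z ∈ ball (0 : Z) r, S z = J z + N z := fun z hz => by rw [hO z hz, add_sub_cancel]
  have hQu : ContDiff ℝ (k + 1 : ℕ) (fun c => Q (u c 0)) := Q.contDiff.comp hud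
  refine ⟨fun c => Q (u c 0), hS0, hJ, ?_, ?_, ?_, ⟨ball 0 r, ball_mem_nhds _ hr, ?_⟩,
    ⟨ball 0 r, ball_mem_nhds _ hr, ?_⟩⟩
  · exact (hQu.of_le (by exact_mod_cast Nat.le_succ k)).contDiffAt
  · obtain ⟨K, hK⟩ := huK 0
    have : u 0 = fun _ => 0 := h.eq_of_small (N := fun _ => N) (K' := 0) hμ2 hμβ' hεκ hε0.le
      (fun _ => hNlip) (hu 0) (fun t => by simpa [hN0] using hasDerivAt_const t (0 : Z)) hK
      (by simp) (by simp [hu0])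
    simp [this]
  · refine (Q.hasFDerivAt.comp 0 (hu1 hN0 hN1)).congr_fderiv ?_
    ext c
    simp [hQc _ c.2]
  · rintro γ a b hγ hγO ⟨t₀, ht₀, c, hc⟩ t ht
    have hlip : LipschitzWith (‖J‖₊ + ε.toNNReal) (fun z => J z + N z) :=
      J.lipschitz.add (LipschitzWith.of_dist_le_mul fun y z => by
        rw [dist_eq_norm, dist_eq_norm, Real.coe_toNNReal _ hε0.le]
        exact hNlip y z)
    have hv : ∀ t, HasDerivAt (fun t => u c (t - t₀))
        (J (u c (t - t₀)) + N (u c (t - t₀))) t := fun t => (hu c (t - t₀)).comp_sub_const t t₀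
    have := eqOn_Icc_of_lipschitz hlip ht₀ (fun t ht => by
      have : HasDerivWithinAt γ (S (γ t)) (Set.Icc a b) t := hγ t ht
      rwa [hO' _ (hγO t ht)] at this) hv (by rw [hc, sub_self, hgraph])
    obtain ⟨K, hK⟩ := huK c
    rw [this ht]
    exact hmem (u c) K (hu c) hK _
  · intro γ hγ hγO
    exact hmem γ r (fun t => by rw [← hO' _ (hγO t)]; exact hγ t) fun t =>
      (mem_ball_zero_iff.1 (hγO t)).le.trans
        (le_mul_of_one_le_right hr.le (Real.one_le_exp (by positivity)))

end Existence

/-! ### Taylor expansion of maps of finite smoothness -/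

section TaylorExpansion

open Filter Asymptotics

variable {E F : Type v} [NormedAddCommGroup E] [NormedSpace ℝ E] [NormedAddCommGroup F]
  [NormedSpace ℝ F]

/-- Iterated derivatives of a `C^n` map are symmetric: this follows from the symmetry of second
derivatives, which gives the invariance under transpositions of neighbouring variables. -/
theorem ContDiffAt.iteratedFDeriv_comp_perm_of_real {n : ℕ} {f : E → F} {x : E}
    (hf : ContDiffAt ℝ n f x) (σ : Equiv.Perm (Fin n)) (v : Fin n → E) :
    iteratedFDeriv ℝ n f x (v ∘ σ) = iteratedFDeriv ℝ n f x v := by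
  induction n generalizing x with
  | zero => exact congrArg _ (Subsingleton.elim _ _)
  | succ n ih =>
    have hσ : σ ∈ Submonoid.closure (Set.range fun i : Fin n => Equiv.swap i.castSucc i.succ) := by
      rw [Equiv.Perm.mclosure_swap_castSucc_succ]
      trivial
    induction hσ using Submonoid.closure_induction generalizing v with
    | one => rfl
    | mul σ τ _ _ hσ hτ =>
      rw [Equiv.Perm.coe_mul, ← Function.comp_assoc, hτ, hσ]
    | mem σ hσ =>
      obtain ⟨i, rfl⟩ := hσ
      cases n with
      | zero => exact i.elim0
      | succ n =>
        refine Fin.cases ?_ (fun j => ?_) i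
        · have h2 : ContDiffAt ℝ 2 (iteratedFDeriv ℝ n f) x :=
            hf.iteratedFDeriv_right (by norm_cast; omega)
          have h3 : IsSymmSndFDerivAt ℝ (iteratedFDeriv ℝ n f) x :=
            h2.isSymmSndFDerivAt (by simp)
          have h1 : ∀ w : Fin (n + 2) → E, iteratedFDeriv ℝ (n + 2) f x w =
              fderiv ℝ (fderiv ℝ (iteratedFDeriv ℝ n f)) x (w 0) (w 1)
                (Fin.tail (Fin.tail w)) := by
            intro w
            have hD : HasFDerivAt (fderiv ℝ (iteratedFDeriv ℝ n f)) _ x :=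
              ((h2.fderiv_right (m := 1) (by norm_num)).differentiableAt (by simp)).hasFDerivAt
            have := ((continuousMultilinearCurryLeftEquiv ℝ (fun _ : Fin (n + 1) => E)
              F).symm.toContinuousLinearEquiv.toContinuousLinearMap.hasFDerivAt.comp x hD).fderiv
            exact DFunLike.congr_fun (DFunLike.congr_fun this (w 0)) (Fin.tail w)
          simp only [h1, Fin.castSucc_zero, Fin.succ_zero_eq_one, Function.comp_apply,
            Equiv.swap_apply_left, Equiv.swap_apply_right]
          rw [h3]
          congr 1
        · set τ := Equiv.swap j.castSucc j.succ with hτ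
          have hc : ∀ᶠ y in 𝓝 x, ContDiffAt ℝ (n + 1 : ℕ) f y :=
            (hf.of_le (by norm_cast; omega)).eventually (by simp)
          have hd : DifferentiableAt ℝ (iteratedFDeriv ℝ (n + 1) f) x :=
            (hf.iteratedFDeriv_right (m := 1) (by norm_cast; omega)).differentiableAt (by simp)
          have h4 : ∀ a u, fderiv ℝ (iteratedFDeriv ℝ (n + 1) f) x a (u ∘ τ) =
              fderiv ℝ (iteratedFDeriv ℝ (n + 1) f) x a u := by
            intro a u
            have e1 := hd.hasFDerivAt.continuousMultilinear_apply_const (u ∘ τ)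
            have e2 := hd.hasFDerivAt.continuousMultilinear_apply_const u
            have e3 : (fun y => iteratedFDeriv ℝ (n + 1) f y (u ∘ τ)) =ᶠ[𝓝 x]
                fun y => iteratedFDeriv ℝ (n + 1) f y u := hc.mono fun y hy => ih hy τ u
            exact DFunLike.congr_fun (e1.unique (e2.congr_of_eventuallyEq e3)) a
          have h5 : (v ∘ Equiv.swap j.succ.castSucc j.succ.succ) 0 = v 0 := by
            rw [Function.comp_apply, Equiv.swap_apply_of_ne_of_ne]
            · rw [← Fin.succ_castSucc]
              exact (Fin.succ_ne_zero _).symm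
            · exact (Fin.succ_ne_zero _).symm
          have h6 : Fin.tail (v ∘ Equiv.swap j.succ.castSucc j.succ.succ) = Fin.tail v ∘ τ := by
            ext k
            simp only [Fin.tail, Function.comp_apply]
            rw [hτ, ← Fin.succ_castSucc, (Fin.succ_injective _).swap_apply]
          rw [iteratedFDeriv_succ_apply_left, iteratedFDeriv_succ_apply_left]
          simp only [h5, h6, h4]

/-- Polarization: the iterated derivative, being symmetric, is determined by its values on the
diagonal. -/
theorem ContDiffAt.iteratedFDeriv_eq_zero_of_diag {n : ℕ} {f : E → F} {x : E}
    (hf : ContDiffAt ℝ n f x) (h : ∀ z, iteratedFDeriv ℝ n f x (fun _ => z) = 0) :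
    iteratedFDeriv ℝ n f x = 0 := by
  ext v
  have h1 := ContinuousMultilinearMap.iteratedFDeriv_comp_diagonal (iteratedFDeriv ℝ n f x) 0 v
  have h2 : (fun z => iteratedFDeriv ℝ n f x (fun _ => z)) = fun _ => 0 := funext h
  have h3 : ∀ σ : Equiv.Perm (Fin n), iteratedFDeriv ℝ n f x (fun i => v (σ i)) =
      iteratedFDeriv ℝ n f x v := fun σ => hf.iteratedFDeriv_comp_perm_of_real σ v
  rw [h2, Finset.sum_congr rfl fun σ _ => h3 σ, Finset.sum_const, Finset.card_univ,
    Fintype.card_perm, Fintype.card_fin] at h1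
  have h4 : iteratedFDeriv ℝ n (fun _ : E => (0 : F)) 0 v = 0 := by
    rw [iteratedFDeriv_fun_zero]
    rfl
  rw [h4, ← Nat.cast_smul_eq_nsmul ℝ, eq_comm, smul_eq_zero] at h1
  exact h1.resolve_left (by positivity)

/-- The derivative of a homogeneous Taylor term of `f` is the Taylor term of the derivative of `f`. -/
theorem ContDiffAt.hasFDerivAt_iteratedFDeriv_diag {n : ℕ} {f : E → F} {x : E}
    (hf : ContDiffAt ℝ (n + 1 : ℕ) f x) (z : E) :
    HasFDerivAt (fun z => ((n + 1).factorial : ℝ)⁻¹ • iteratedFDeriv ℝ (n + 1) f x (fun _ => z))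
      ((n.factorial : ℝ)⁻¹ • iteratedFDeriv ℝ n (fderiv ℝ f) x (fun _ => z)) z := by
  let g : E →L[ℝ] (Fin (n + 1) → E) := ContinuousLinearMap.pi fun _ => ContinuousLinearMap.id ℝ E
  have h1 : HasFDerivAt (fun z => iteratedFDeriv ℝ (n + 1) f x (g z))
      (((iteratedFDeriv ℝ (n + 1) f x).linearDeriv (g z)).comp g) z :=
    ((iteratedFDeriv ℝ (n + 1) f x).hasFDerivAt (g z)).comp z g.hasFDerivAt
  refine (h1.const_smul ((n + 1).factorial : ℝ)⁻¹).congr_fderiv ?_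
  ext w
  have h2 : ∀ i : Fin (n + 1), iteratedFDeriv ℝ (n + 1) f x (Function.update (fun _ => z) i w) =
      iteratedFDeriv ℝ n (fderiv ℝ f) x (fun _ => z) w := by
    intro i
    have : Function.update (fun _ : Fin (n + 1) => z) i w =
        Function.update (fun _ => z) (Fin.last n) w ∘ Equiv.swap i (Fin.last n) := by
      ext k
      simp only [Function.comp_apply, Function.update_apply]
      congr 1
      rw [Equiv.swap_apply_eq_iff, Equiv.swap_apply_right]
    rw [this, hf.iteratedFDeriv_comp_perm_of_real, iteratedFDeriv_succ_apply_right]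
    have h3 : Fin.init (Function.update (fun _ : Fin (n + 1) => z) (Fin.last n) w) =
        fun _ => z := by
      ext k
      simp [Fin.init, Fin.ext_iff, k.is_lt.ne]
    rw [h3, Function.update_self]
  have h4 : ((iteratedFDeriv ℝ (n + 1) f x).linearDeriv (g z)) (g w) =
      ∑ i : Fin (n + 1), iteratedFDeriv ℝ n (fderiv ℝ f) x (fun _ => z) w := by
    rw [ContinuousMultilinearMap.linearDeriv_apply]
    exact Finset.sum_congr rfl fun i _ => h2 i
  simp only [smul_apply, ContinuousLinearMap.comp_apply, h4, Finset.sum_const,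
    Finset.card_univ, Fintype.card_fin]
  rw [← Nat.cast_smul_eq_nsmul ℝ, smul_smul, Nat.factorial_succ]
  congr 1
  push_cast
  field_simp

/-- **Taylor's theorem** with the remainder in the form of Peano. -/
theorem ContDiffAt.taylor_isLittleO {n : ℕ} {f : E → F} (hf : ContDiffAt ℝ n f 0) :
    (fun z => f z - ∑ m ∈ Finset.range (n + 1),
      ((m.factorial : ℝ)⁻¹) • iteratedFDeriv ℝ m f 0 (fun _ => z)) =o[𝓝 0]
      fun z => ‖z‖ ^ n := by
  induction n generalizing F with
  | zero =>
    simp only [pow_zero, isLittleO_one_iff]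
    have h1 : Tendsto (fun z => f z - f 0) (𝓝 0) (𝓝 (f 0 - f 0)) :=
      hf.continuousAt.tendsto.sub_const (f 0)
    simpa using h1
  | succ n ih =>
    have hf' : ContDiffAt ℝ n (fderiv ℝ f) 0 := hf.fderiv_right (by norm_cast)
    have hd : ∀ᶠ z in 𝓝 (0 : E), DifferentiableAt ℝ f z :=
      (hf.eventually (by simp)).mono fun z hz => hz.differentiableAt (by simp)
    obtain ⟨r, hr, hball⟩ := Metric.eventually_nhds_iff_ball.1 hd
    have hmem : (0 : E) ∈ Metric.ball (0 : E) r := Metric.mem_ball_self hr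
    have := (convex_ball (0 : E) r).isLittleO_pow_succ (n := n) hmem
      (f := fun z => f z - ∑ m ∈ Finset.range (n + 1),
        (((m + 1).factorial : ℝ)⁻¹) • iteratedFDeriv ℝ (m + 1) f 0 (fun _ => z))
      (f' := fun z => fderiv ℝ f z - ∑ m ∈ Finset.range (n + 1),
        ((m.factorial : ℝ)⁻¹) • iteratedFDeriv ℝ m (fderiv ℝ f) 0 (fun _ => z))
      (fun z hz => ((hball z hz).hasFDerivAt.sub (HasFDerivAt.fun_sum fun m hm =>
        (hf.of_le (by
          have := Finset.mem_range.1 hm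
          norm_cast)).hasFDerivAt_iteratedFDeriv_diag z)).hasFDerivWithinAt)
      (by
        rw [nhdsWithin_eq_nhds.2 (Metric.isOpen_ball.mem_nhds hmem)]
        simpa using ih hf')
    rw [nhdsWithin_eq_nhds.2 (Metric.isOpen_ball.mem_nhds hmem)] at this
    simp only [sub_zero] at this
    refine this.congr_left fun z => ?_
    rw [Finset.sum_range_succ' _ (n + 1)]
    have : ∀ m ∈ Finset.range (n + 1), (((m + 1).factorial : ℝ)⁻¹) •
        iteratedFDeriv ℝ (m + 1) f 0 (fun _ => (0 : E)) = 0 := fun m _ => by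
      rw [(iteratedFDeriv ℝ (m + 1) f 0).map_coord_zero 0 rfl, smul_zero]
    rw [Finset.sum_eq_zero this]
    simp
    abel

theorem ContDiffAt.isLittleO_of_iteratedFDeriv_eq_zero {n : ℕ} {f : E → F}
    (hf : ContDiffAt ℝ n f 0) (h : ∀ m ≤ n, iteratedFDeriv ℝ m f 0 = 0) :
    f =o[𝓝 0] fun z => ‖z‖ ^ n := by
  refine hf.taylor_isLittleO.congr_left fun z => ?_
  rw [Finset.sum_eq_zero fun m hm => by
    rw [h m (Nat.lt_succ_iff.1 (Finset.mem_range.1 hm)), zero_apply, smul_zero],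
    sub_zero]

/-- A polynomial in one variable that is of smaller order than its degree vanishes. -/
theorem eq_zero_of_sum_pow_isLittleO {n : ℕ} {a : ℕ → F}
    (h : (fun s : ℝ => ∑ m ∈ Finset.range (n + 1), s ^ m • a m) =o[𝓝[>] 0] fun s => s ^ n) :
    ∀ m ≤ n, a m = 0 := by
  have h0 : ∀ (n : ℕ) (a : ℕ → F),
      ((fun s : ℝ => ∑ m ∈ Finset.range (n + 1), s ^ m • a m) =o[𝓝[>] 0] fun s => s ^ n) →
      a 0 = 0 := by
    intro n a h
    have h1 : Tendsto (fun s : ℝ => ∑ m ∈ Finset.range (n + 1), s ^ m • a m) (𝓝[>] 0) (𝓝 0) := by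
      refine (isLittleO_one_iff ℝ).1 (h.trans_isBigO ?_)
      have : Tendsto (fun s : ℝ => s ^ n) (𝓝[>] 0) (𝓝 (0 ^ n)) :=
        ((continuous_pow n).tendsto 0).mono_left nhdsWithin_le_nhds
      exact this.isBigO_one ℝ
    have h2 : Tendsto (fun s : ℝ => ∑ m ∈ Finset.range (n + 1), s ^ m • a m) (𝓝[>] 0)
        (𝓝 (∑ m ∈ Finset.range (n + 1), (0 : ℝ) ^ m • a m)) := by
      refine Tendsto.mono_left ?_ nhdsWithin_le_nhds
      exact Continuous.tendsto (by fun_prop) 0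
    have h3 := tendsto_nhds_unique h2 h1
    rw [Finset.sum_range_succ'] at h3
    simpa using h3
  induction n generalizing a with
  | zero =>
    intro m hm
    rw [Nat.le_zero.1 hm]
    exact h0 0 a h
  | succ n ih =>
    have ha := h0 _ a h
    have h1 := ih (a := fun m => a (m + 1)) (by
      rw [isLittleO_iff] at h ⊢
      intro c hc
      filter_upwards [h hc, self_mem_nhdsWithin] with s hs hs0
      rw [Finset.sum_range_succ', ha, smul_zero, add_zero] at hs
      have e : ∑ m ∈ Finset.range (n + 1), s ^ (m + 1) • a (m + 1) =
          s • ∑ m ∈ Finset.range (n + 1), s ^ m • a (m + 1) := by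
        rw [Finset.smul_sum]
        exact Finset.sum_congr rfl fun m _ => by rw [smul_smul, pow_succ']
      rw [e, norm_smul, pow_succ', norm_mul, mul_left_comm] at hs
      exact le_of_mul_le_mul_left hs (norm_pos_iff.2 (ne_of_gt hs0)))
    intro m hm
    cases m with
    | zero => exact ha
    | succ m => exact h1 m (by omega)

end TaylorExpansion

/-! ### The Taylor expansion of a center manifold -/

section JetUniqueness

open Filter Asymptotics NormedSpace

set_option linter.unusedSectionVars false

variable {Z : Type v} [NormedAddCommGroup Z] [NormedSpace ℝ Z] [FiniteDimensional ℝ Z]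

/-- The projection onto the center subspace along the hyperbolic subspace, as a continuous linear
map. -/
noncomputable def centerProjL (J : Z →L[ℝ] Z) : Z →L[ℝ] centerSubspace (J : Module.End ℝ Z) :=
  LinearMap.toContinuousLinearMap (centerProj (J : Module.End ℝ Z))

theorem centerProjL_coe (J : Z →L[ℝ] Z) (c : centerSubspace (J : Module.End ℝ Z)) :
    centerProjL J c = c :=
  Submodule.projectionOnto_apply_left _ c

theorem centerProjL_of_mem_hyperbolic (J : Z →L[ℝ] Z) {z : Z}
    (hz : z ∈ hyperbolicSubspace (J : Module.End ℝ Z)) : centerProjL J z = 0 :=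
  Submodule.projectionOnto_apply_of_mem_right _ hz

theorem sub_centerProjL_mem (J : Z →L[ℝ] Z) (z : Z) :
    z - centerProjL J z ∈ hyperbolicSubspace (J : Module.End ℝ Z) := by
  refine (Submodule.projectionOnto_apply_eq_zero_iff
    (isCompl_center_hyperbolic (J : Module.End ℝ Z))).1 ?_
  change centerProjL J _ = 0
  rw [map_sub, centerProjL_coe, sub_self]

theorem map_mem_centerSubspace (J : Z →L[ℝ] Z) {z : Z}
    (hz : z ∈ centerSubspace (J : Module.End ℝ Z)) : J z ∈ centerSubspace (J : Module.End ℝ Z) := by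
  rw [← spectralSubspace_singleton] at hz ⊢
  exact map_mem_spectralSubspace (J : Module.End ℝ Z) (fun _ => rfl) _ hz

theorem map_mem_hyperbolicSubspace (J : Z →L[ℝ] Z) {z : Z}
    (hz : z ∈ hyperbolicSubspace (J : Module.End ℝ Z)) :
    J z ∈ hyperbolicSubspace (J : Module.End ℝ Z) := by
  rw [← spectralSubspace_compl_singleton] at hz ⊢
  exact map_mem_spectralSubspace (J : Module.End ℝ Z) (fun _ => rfl) _ hz

theorem centerProjL_map (J : Z →L[ℝ] Z) (z : Z) :
    (centerProjL J (J z) : Z) = J (centerProjL J z) := by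
  have h1 := centerProjL_of_mem_hyperbolic J
    (map_mem_hyperbolicSubspace J (sub_centerProjL_mem J z))
  rw [map_sub, map_sub, sub_eq_zero] at h1
  rw [h1]
  exact congrArg Subtype.val (centerProjL_coe J ⟨_, map_mem_centerSubspace J (centerProjL J z).2⟩)

theorem coe_centerProjL (J : Z →L[ℝ] Z) (z : Z) :
    (centerProjL J z : Z) = spectralProj J {0} z := by
  have h1 : spectralProj J {0} (centerProjL J z : Z) = centerProjL J z :=
    spectralProj_of_mem J (by rw [spectralSubspace_singleton]; exact (centerProjL J z).2)
  have h2 : spectralProj J {0} (z - centerProjL J z) = 0 :=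
    spectralProj_of_mem_disjoint J disjoint_compl_right (sub_centerProjL_mem J z)
  rw [map_sub, h1, sub_eq_zero] at h2
  exact h2.symm

theorem coe_centerProjL_exp (J : Z →L[ℝ] Z) (c : centerSubspace (J : Module.End ℝ Z)) (t : ℝ) :
    (centerProjL J (exp (t • J) (c : Z)) : Z) = exp (t • J) (c : Z) := by
  have : CompleteSpace Z := FiniteDimensional.complete ℝ Z
  have h := exp_comm_apply (J := J)
    (P := (centerSubspace (J : Module.End ℝ Z)).subtypeL.comp (centerProjL J))
    (centerProjL_map J) t c
  simpa [centerProjL_coe] using h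

/-- The graph of a center manifold is tangent to the vector field. -/
theorem IsLocalCenterManifold.eventually_tangent {k : ℕ} {S : Z → Z} {J : Z →L[ℝ] Z}
    {Ψ : centerSubspace (J : Module.End ℝ Z) → hyperbolicSubspace (J : Module.End ℝ Z)}
    (h : IsLocalCenterManifold k S J Ψ) (hk : 1 ≤ k) (hS : ContDiffAt ℝ 1 S 0) :
    ∀ᶠ c in 𝓝 (0 : centerSubspace (J : Module.End ℝ Z)),
      fderiv ℝ (fun c => (Ψ c : Z)) c (centerProjL J (S (c + Ψ c))) =
        S (c + Ψ c) - centerProjL J (S (c + Ψ c)) := by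
  have : CompleteSpace Z := FiniteDimensional.complete ℝ Z
  obtain ⟨O, hO, hinv⟩ := h.locally_invariant
  -- the solution through a point of the graph stays on the graph: differentiate at time zero
  obtain ⟨r, hr, ε, hε, hα⟩ :=
    hS.exists_forall_mem_closedBall_exists_eq_forall_mem_Ioo_hasDerivAt 0
  have hΨ1 : ContDiffAt ℝ 1 Ψ 0 := h.smooth.of_le (by exact_mod_cast hk)
  have hΨd : ∀ᶠ c in 𝓝 (0 : centerSubspace (J : Module.End ℝ Z)), DifferentiableAt ℝ Ψ c :=
    (hΨ1.eventually (by simp)).mono fun c hc => hc.differentiableAt (by simp)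
  have hcont : Tendsto (fun c : centerSubspace (J : Module.End ℝ Z) => (c : Z) + (Ψ c : Z))
      (𝓝 0) (𝓝 0) := by
    have h1 : ContinuousAt (fun c : centerSubspace (J : Module.End ℝ Z) => (c : Z) + (Ψ c : Z)) 0 :=
      continuous_subtype_val.continuousAt.add
        (continuous_subtype_val.continuousAt.comp hΨ1.continuousAt)
    simpa [ContinuousAt, h.through_zero] using h1
  filter_upwards [hΨd, hcont (interior_mem_nhds.2 hO),
    hcont (Metric.closedBall_mem_nhds 0 hr)] with c hc hcO hcr
  obtain ⟨α, hα0, hαd⟩ := hα _ hcr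
  have h00 : (0 : ℝ) ∈ Set.Ioo (0 - ε) (0 + ε) := by simp [hε]
  have hd0 := hαd 0 h00
  have hev : ∀ᶠ t in 𝓝 (0 : ℝ), α t ∈ interior O ∧ t ∈ Set.Ioo (0 - ε) (0 + ε) := by
    refine (hd0.continuousAt.tendsto.eventually_mem ?_).and (Ioo_mem_nhds h00.1 h00.2)
    rw [hα0]
    exact isOpen_interior.mem_nhds hcO
  obtain ⟨a, ha, hball⟩ := Metric.eventually_nhds_iff.1 hev
  have hIcc : ∀ t ∈ Set.Icc (-(a / 2)) (a / 2), α t ∈ interior O ∧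
      t ∈ Set.Ioo (0 - ε) (0 + ε) := fun t ht => hball (by
    rw [Real.dist_eq, sub_zero]
    exact (abs_le.2 ht).trans_lt (by linarith))
  have hgr := hinv α (-(a / 2)) (a / 2) (fun t ht => (hαd t (hIcc t ht).2).hasDerivWithinAt)
    (fun t ht => interior_subset (hIcc t ht).1)
    ⟨0, ⟨by linarith, by linarith⟩, c, hα0⟩
  have heq : α =ᶠ[𝓝 0] fun t => (centerProjL J (α t) : Z) + (Ψ (centerProjL J (α t)) : Z) := by
    filter_upwards [Icc_mem_nhds (show -(a / 2) < (0 : ℝ) by linarith)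
      (show (0 : ℝ) < a / 2 by linarith)] with t ht
    obtain ⟨y, hy⟩ := hgr t ht
    have : centerProjL J (α t) = y := by
      rw [hy, map_add, centerProjL_coe, centerProjL_of_mem_hyperbolic J (Ψ y).2, add_zero]
    rw [this, hy]
  have hπ0 : centerProjL J (α 0) = c := by
    rw [hα0, map_add, centerProjL_coe, centerProjL_of_mem_hyperbolic J (Ψ c).2, add_zero]
  have hd1 : HasDerivAt (fun t => centerProjL J (α t)) (centerProjL J (S (α 0))) 0 :=
    (centerProjL J).hasFDerivAt.comp_hasDerivAt 0 hd0
  have hΨZ : HasFDerivAt (fun c => (Ψ c : Z)) (fderiv ℝ (fun c => (Ψ c : Z)) c)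
      (centerProjL J (α 0)) := by
    rw [hπ0]
    exact ((hyperbolicSubspace (J : Module.End ℝ Z)).subtypeL.differentiableAt.comp c
      hc).hasFDerivAt
  have hd2 := ((centerSubspace (J : Module.End ℝ Z)).subtypeL.hasFDerivAt.comp_hasDerivAt 0
    hd1).add (hΨZ.comp_hasDerivAt 0 hd1)
  have := hd0.unique (hd2.congr_of_eventuallyEq heq)
  rw [hα0] at this
  rw [eq_sub_iff_add_eq']
  exact this.symm

/-- A map with vanishing derivative at the origin is Lipschitz there, with a constant proportional
to the distance from the origin. -/
theorem ContDiffAt.isBigO_comp_sub_comp {X Y F : Type*} [NormedAddCommGroup Y] [NormedSpace ℝ Y]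
    [NormedAddCommGroup F] [NormedSpace ℝ F] {N : Y → F} (hN : ContDiffAt ℝ 2 N 0)
    (hN0 : fderiv ℝ N 0 = 0) {l : Filter X} {f g : X → Y} {w : X → ℝ} (hf : f =O[l] w)
    (hg : g =O[l] w) (hw : Tendsto w l (𝓝 0)) :
    (fun x => N (f x) - N (g x)) =O[l] fun x => ‖w x‖ * ‖f x - g x‖ := by
  have h1 : ContDiffAt ℝ 1 (fderiv ℝ N) 0 := hN.fderiv_right (by norm_num)
  have h2 : (fderiv ℝ N) =O[𝓝 0] fun z => z := by
    simpa [hN0] using (h1.differentiableAt (by simp)).isBigO_sub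
  obtain ⟨L, hL0, hL⟩ := h2.exists_pos
  have hd : ∀ᶠ z in 𝓝 (0 : Y), DifferentiableAt ℝ N z :=
    (hN.eventually (by simp)).mono fun c hc => hc.differentiableAt (by simp)
  obtain ⟨r, hr, hball⟩ := Metric.eventually_nhds_iff_ball.1 (hd.and hL.bound)
  obtain ⟨A, hA0, hA⟩ := hf.exists_pos
  obtain ⟨B, hB0, hB⟩ := hg.exists_pos
  refine IsBigO.of_bound (L * (A + B)) ?_
  have hs : ∀ᶠ x in l, (A + B) * ‖w x‖ < r := by
    have : Tendsto (fun x => (A + B) * ‖w x‖) l (𝓝 ((A + B) * ‖(0 : ℝ)‖)) :=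
      (hw.norm).const_mul _
    exact this.eventually (gt_mem_nhds (by simpa using hr))
  filter_upwards [hA.bound, hB.bound, hs] with x hx hx' hxr
  have hw0 := norm_nonneg (w x)
  have hsub : Metric.closedBall (0 : Y) ((A + B) * ‖w x‖) ⊆ Metric.ball 0 r :=
    Metric.closedBall_subset_ball hxr
  have := (convex_closedBall (0 : Y) ((A + B) * ‖w x‖)).norm_image_sub_le_of_norm_fderiv_le
    (𝕜 := ℝ) (f := N) (C := L * ((A + B) * ‖w x‖)) (fun y hy => (hball y (hsub hy)).1)
    (fun y hy => (hball y (hsub hy)).2.trans (by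
      gcongr
      simpa using hy)) (x := g x) (y := f x)
    (by rw [mem_closedBall_zero_iff]; nlinarith) (by rw [mem_closedBall_zero_iff]; nlinarith)
  refine this.trans (le_of_eq ?_)
  rw [norm_mul, norm_norm, norm_norm]
  ring

/-- Restriction of an asymptotic estimate to the ray spanned by `a`. -/
theorem Asymptotics.IsLittleO.ray {Y F : Type*} [NormedAddCommGroup Y] [NormedSpace ℝ Y]
    [NormedAddCommGroup F] {f : Y → F} {n : ℕ}
    (h : f =o[𝓝 0] fun y => ‖y‖ ^ n) (a : Y) :
    (fun s : ℝ => f (s • a)) =o[𝓝[>] 0] fun s => s ^ n := by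
  have h1 : Tendsto (fun s : ℝ => s • a) (𝓝[>] 0) (𝓝 0) := by
    have : Tendsto (fun s : ℝ => s • a) (𝓝 0) (𝓝 ((0 : ℝ) • a)) :=
      Continuous.tendsto (by fun_prop) 0
    rw [zero_smul] at this
    exact this.mono_left nhdsWithin_le_nhds
  refine (h.comp_tendsto h1).trans_isBigO (IsBigO.of_bound (‖a‖ ^ n) (.of_forall fun s => ?_))
  simp [norm_smul, mul_pow, mul_comm]

theorem eq_zero_of_pow_smul_isLittleO {F : Type*} [NormedAddCommGroup F] [NormedSpace ℝ F]
    {n : ℕ} {x : F} (h : (fun s : ℝ => s ^ n • x) =o[𝓝[>] 0] fun s => s ^ n) : x = 0 := by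
  by_contra hx
  obtain ⟨s, hs, hs0⟩ := ((isLittleO_iff.1 h (half_pos (norm_pos_iff.2 hx))).and
    self_mem_nhdsWithin).exists
  have hs1 : 0 < ‖s ^ n‖ := norm_pos_iff.2 (pow_pos hs0 n).ne'
  rw [norm_smul] at hs
  have := norm_pos_iff.2 hx
  nlinarith

theorem Asymptotics.IsBigO.clm_apply_isLittleO {X E F : Type*} [NormedAddCommGroup E]
    [NormedSpace ℝ E] [NormedAddCommGroup F] [NormedSpace ℝ F] {l : Filter X} {A : X → E →L[ℝ] F}
    {b : X → E} {u v : X → ℝ} (hA : A =O[l] u) (hb : b =o[l] v) :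
    (fun x => A x (b x)) =o[l] fun x => u x * v x := by
  obtain ⟨C, hC, hA⟩ := hA.exists_pos
  have h1 : (fun x => A x (b x)) =O[l] fun x => u x * ‖b x‖ := by
    refine IsBigO.of_bound C (hA.bound.mono fun x hx => ?_)
    rw [norm_mul, _root_.norm_norm, ← mul_assoc]
    exact (A x).le_of_opNorm_le hx _
  exact h1.trans_isLittleO ((isBigO_refl u l).mul_isLittleO hb.norm_left)

theorem Asymptotics.IsLittleO.clm_apply_isBigO {X E F : Type*} [NormedAddCommGroup E]
    [NormedSpace ℝ E] [NormedAddCommGroup F] [NormedSpace ℝ F] {l : Filter X} {A : X → E →L[ℝ] F}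
    {b : X → E} {u v : X → ℝ} (hA : A =o[l] u) (hb : b =O[l] v) :
    (fun x => A x (b x)) =o[l] fun x => u x * v x := by
  obtain ⟨C, hC, hb⟩ := hb.exists_pos
  refine isLittleO_iff.2 fun c hc => ?_
  filter_upwards [hb.bound, isLittleO_iff.1 hA (div_pos hc hC)] with x hx hx'
  refine ((A x).le_of_opNorm_le hx' _).trans ?_
  rw [norm_mul]
  calc c / C * ‖u x‖ * ‖b x‖ ≤ c / C * ‖u x‖ * (C * ‖v x‖) := by gcongr
    _ = _ := by field_simp

theorem IsLocalCenterManifold.smooth_coe {k : ℕ} {S : Z → Z} {J : Z →L[ℝ] Z}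
    {Ψ : centerSubspace (J : Module.End ℝ Z) → hyperbolicSubspace (J : Module.End ℝ Z)}
    (h : IsLocalCenterManifold k S J Ψ) : ContDiffAt ℝ k (fun c => (Ψ c : Z)) 0 :=
  (hyperbolicSubspace (J : Module.End ℝ Z)).subtypeL.contDiff.contDiffAt.comp 0 h.smooth

theorem IsLocalCenterManifold.hasFDerivAt_coe {k : ℕ} {S : Z → Z} {J : Z →L[ℝ] Z}
    {Ψ : centerSubspace (J : Module.End ℝ Z) → hyperbolicSubspace (J : Module.End ℝ Z)}
    (h : IsLocalCenterManifold k S J Ψ) :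
    HasFDerivAt (fun c : centerSubspace (J : Module.End ℝ Z) => (Ψ c : Z))
      (0 : centerSubspace (J : Module.End ℝ Z) →L[ℝ] Z) 0 :=
  (((hyperbolicSubspace (J : Module.End ℝ Z)).subtypeL.hasFDerivAt (x := Ψ 0)).comp
    (0 : centerSubspace (J : Module.End ℝ Z)) h.tangent).congr_fderiv
    (ContinuousLinearMap.comp_zero _)

theorem IsLocalCenterManifold.isBigO_graph {k : ℕ} {S : Z → Z} {J : Z →L[ℝ] Z}
    {Ψ : centerSubspace (J : Module.End ℝ Z) → hyperbolicSubspace (J : Module.End ℝ Z)}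
    (h : IsLocalCenterManifold k S J Ψ) :
    (fun c : centerSubspace (J : Module.End ℝ Z) => (c : Z) + (Ψ c : Z)) =O[𝓝 0]
      fun c => ‖c‖ := by
  have h1 := h.hasFDerivAt_coe.isBigO_sub
  simp only [h.through_zero, Submodule.coe_zero, sub_zero] at h1
  refine IsBigO.add (IsBigO.of_bound 1 (.of_forall fun c => ?_)) h1.norm_right
  simp

/-- The difference `ψ` of two center manifolds solves the linearized invariance equation
`Dψ(c) J c = J ψ(c)` up to terms of higher order, if the vector fields agree to sufficiently high order
and `ψ` is already known to be of smaller order than `‖c‖ ^ (j + 1)`. -/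
theorem IsLocalCenterManifold.linearized_invariance {k k' l j : ℕ} {S S' : Z → Z} {J : Z →L[ℝ] Z}
    {Ψ Ψ' : centerSubspace (J : Module.End ℝ Z) → hyperbolicSubspace (J : Module.End ℝ Z)}
    (h : IsLocalCenterManifold k S J Ψ) (h' : IsLocalCenterManifold k' S' J Ψ') (hk : 1 ≤ k)
    (hk' : 1 ≤ k') (hS : ContDiffAt ℝ 2 S 0) (hS' : ContDiffAt ℝ 2 S' 0)
    (hd : (fun z => S' z - S z) =O[𝓝 0] fun z => ‖z‖ ^ (l + 1)) (hj : j + 2 ≤ l)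
    (h0 : (fun c => (Ψ' c : Z) - (Ψ c : Z)) =o[𝓝 0] fun c => ‖c‖ ^ (j + 1))
    (h1 : (fderiv ℝ fun c => (Ψ' c : Z) - (Ψ c : Z)) =o[𝓝 0] fun c => ‖c‖ ^ j) :
    (fun c : centerSubspace (J : Module.End ℝ Z) =>
      fderiv ℝ (fun c => (Ψ' c : Z) - (Ψ c : Z)) c (centerProjL J (J c)) -
        J ((Ψ' c : Z) - (Ψ c : Z))) =o[𝓝 0] fun c => ‖c‖ ^ (j + 2) := by
  set ψ : centerSubspace (J : Module.End ℝ Z) → Z := fun c => (Ψ' c : Z) - (Ψ c : Z) with hψ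
  set π := centerProjL J with hπ
  set z : centerSubspace (J : Module.End ℝ Z) → Z := fun c => (c : Z) + (Ψ c : Z) with hz
  set z' : centerSubspace (J : Module.End ℝ Z) → Z := fun c => (c : Z) + (Ψ' c : Z) with hz'
  -- `δ` is the difference of the nonlinear parts on the two graphs, `η` is the nonlinear part of `S`
  set δ : centerSubspace (J : Module.End ℝ Z) → Z := fun c => S' (z' c) - S (z c) - J (ψ c)
    with hδ
  set η : centerSubspace (J : Module.End ℝ Z) → Z := fun c => S (z c) - J (z c) with hη
  have hzO : z =O[𝓝 0] fun c => ‖c‖ := h.isBigO_graph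
  have hzO' : z' =O[𝓝 0] fun c => ‖c‖ := h'.isBigO_graph
  have hw : Tendsto (fun c : centerSubspace (J : Module.End ℝ Z) => ‖c‖) (𝓝 0) (𝓝 0) :=
    tendsto_norm_zero
  have hz0' : Tendsto z' (𝓝 0) (𝓝 0) := hzO'.trans_tendsto hw
  have hN : ContDiffAt ℝ 2 (fun z => S z - J z) 0 := hS.sub J.contDiff.contDiffAt
  have hN0 : fderiv ℝ (fun z => S z - J z) 0 = 0 := by
    rw [(h.linearization.fun_sub J.hasFDerivAt).fderiv, sub_self]
  have hηO : η =O[𝓝 0] fun c => ‖c‖ ^ 2 := by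
    have := hN.isBigO_comp_sub_comp hN0 hzO (isBigO_zero _ _) hw
    simp only [h.equilibrium, map_zero, sub_zero, norm_norm] at this
    refine this.trans ?_
    simp only [pow_two]
    exact (isBigO_refl _ _).mul hzO.norm_left
  have hδo : δ =o[𝓝 0] fun c => ‖c‖ ^ (j + 2) := by
    have e : δ = fun c => ((S (z' c) - J (z' c)) - (S (z c) - J (z c))) +
        (S' (z' c) - S (z' c)) := by
      funext c
      have : J (ψ c) = J (z' c) - J (z c) := by
        rw [← map_sub]
        congr 1
        simp only [hψ, hz, hz']
        abel
      simp only [hδ, this]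
      abel
    rw [e]
    refine IsLittleO.add ((hN.isBigO_comp_sub_comp hN0 hzO' hzO hw).trans_isLittleO ?_) ?_
    · have e2 : (fun c => z' c - z c) = ψ := by
        funext c
        simp only [hψ, hz, hz']
        abel
      have e3 : ∀ c, z' c - z c = ψ c := fun c => congrFun e2 c
      simp only [e3, norm_norm]
      simp only [pow_succ' _ (j + 1)]
      exact (isBigO_refl _ _).mul_isLittleO h0.norm_left
    · refine ((hd.comp_tendsto hz0').trans (hzO'.norm_left.pow (l + 1))).trans_isLittleO ?_
      exact (isLittleO_pow_pow (by omega : j + 2 < l + 1)).comp_tendsto hw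
  have hΨ1 : ContDiffAt ℝ 1 (fun c => (Ψ c : Z)) 0 := h.smooth_coe.of_le (by exact_mod_cast hk)
  have hΨ1' : ContDiffAt ℝ 1 (fun c => (Ψ' c : Z)) 0 :=
    h'.smooth_coe.of_le (by exact_mod_cast hk')
  have hb : (fderiv ℝ fun c => (Ψ' c : Z)) =O[𝓝 0] fun _ => (1 : ℝ) :=
    ((hΨ1'.fderiv_right (m := 0) (by simp)).continuousAt).isBigO_one ℝ
  have key : ∀ᶠ c in 𝓝 0, fderiv ℝ ψ c (π (J c)) - J (ψ c) =
      (δ c - π (δ c)) - fderiv ℝ (fun c => (Ψ' c : Z)) c (π (δ c)) - fderiv ℝ ψ c (π (η c)) := by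
    filter_upwards [h.eventually_tangent hk (hS.of_le (by norm_num)),
      h'.eventually_tangent hk' (hS'.of_le (by norm_num)), hΨ1.eventually (by simp),
      hΨ1'.eventually (by simp)] with c t t' d d'
    have hf : fderiv ℝ ψ c = fderiv ℝ (fun c => (Ψ' c : Z)) c - fderiv ℝ (fun c => (Ψ c : Z)) c :=
      fderiv_sub (d'.differentiableAt (by simp)) (d.differentiableAt (by simp))
    have hJψ : π (J (ψ c)) = 0 := centerProjL_of_mem_hyperbolic J
      (map_mem_hyperbolicSubspace J (Submodule.sub_mem _ (Ψ' c).2 (Ψ c).2))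
    have hJΨ : π (J (Ψ c)) = 0 := centerProjL_of_mem_hyperbolic J
      (map_mem_hyperbolicSubspace J (Ψ c).2)
    have e1 : π (S (z c)) = π (J c) + π (η c) := by
      simp only [hη, hz, map_sub, map_add, hJΨ]
      abel
    have e2 : π (S' (z' c)) = π (J c) + π (η c) + π (δ c) := by
      rw [← e1, hδ]
      simp only [map_sub, hJψ]
      abel
    have e3 : S' (z' c) = S (z c) + J (ψ c) + δ c := by
      simp only [hδ]
      abel
    have t1 : fderiv ℝ (fun c => (Ψ c : Z)) c (π (S (z c))) = S (z c) - π (S (z c)) := t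
    have t2 : fderiv ℝ (fun c => (Ψ' c : Z)) c (π (S' (z' c))) = S' (z' c) - π (S' (z' c)) := t'
    rw [e1, map_add] at t1
    rw [e2, e3, map_add, map_add] at t2
    rw [hf]
    simp only [sub_apply]
    have t3 := congrArg₂ (· - ·) t2 t1
    simp only [Submodule.coe_add] at t3
    rw [← sub_eq_zero] at t3 ⊢
    rw [← t3]
    abel
  refine IsLittleO.congr' ?_ (key.mono fun c hc => hc.symm) EventuallyEq.rfl
  refine IsLittleO.sub (IsLittleO.sub ?_ ?_) ?_
  · exact ((ContinuousLinearMap.id ℝ Z - (Submodule.subtypeL _).comp π).isBigO_comp δ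
      (𝓝 0)).trans_isLittleO hδo
  · simpa only [one_mul] using
      hb.clm_apply_isLittleO ((π.isBigO_comp δ (𝓝 0)).trans_isLittleO hδo)
  · simp only [pow_add]
    exact h1.clm_apply_isBigO ((π.isBigO_comp η (𝓝 0)).trans hηO)

/-- A homogeneous term of a center manifold difference that solves the linearized invariance
equation to leading order is equivariant under the linear flow. -/
theorem equivariant_of_linearized_invariance {J : Z →L[ℝ] Z} {i : ℕ}
    {ψ : centerSubspace (J : Module.End ℝ Z) → Z} (hψ : ContDiffAt ℝ i ψ 0) (hi : 1 ≤ i)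
    (h0 : ∀ m < i, iteratedFDeriv ℝ m ψ 0 = 0)
    (hg : (fun c : centerSubspace (J : Module.End ℝ Z) =>
      fderiv ℝ ψ c (centerProjL J (J c)) - J (ψ c)) =o[𝓝 0] fun c => ‖c‖ ^ i)
    (c₀ : centerSubspace (J : Module.End ℝ Z)) (T : ℝ) :
    exp ((-T) • J) (iteratedFDeriv ℝ i ψ 0 fun _ => centerProjL J (exp (T • J) (c₀ : Z))) =
      iteratedFDeriv ℝ i ψ 0 fun _ => c₀ := by
  have : CompleteSpace Z := FiniteDimensional.complete ℝ Z
  set c : ℝ → centerSubspace (J : Module.End ℝ Z) := fun t => centerProjL J (exp (t • J) (c₀ : Z))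
    with hc
  have hcd : ∀ t, HasDerivAt c (centerProjL J (J (c t))) t := fun t => by
    have := (centerProjL J).hasFDerivAt.comp_hasDerivAt t (hasDerivAt_exp_smul_apply J (c₀ : Z) t)
    rwa [← coe_centerProjL_exp] at this
  have hc0 : c 0 = c₀ := by simp [hc, centerProjL_coe]
  have hcc : Continuous c := continuous_iff_continuousAt.2 fun t => (hcd t).continuousAt
  have hexpd : ∀ t, HasDerivAt (fun t : ℝ => exp ((-t) • J)) (-(exp ((-t) • J) * J)) t := fun t => by
    have := (hasDerivAt_exp_smul_const (𝕂 := ℝ) J (-t)).scomp t (hasDerivAt_neg t)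
    simpa [Function.comp_def] using this
  have hexp : Continuous fun t : ℝ => exp ((-t) • J) :=
    continuous_iff_continuousAt.2 fun t => (hexpd t).continuousAt
  obtain ⟨M₁, hM₁⟩ := (isCompact_uIcc (a := (0 : ℝ)) (b := T)).exists_bound_of_continuousOn
    hcc.continuousOn
  obtain ⟨M₂, hM₂⟩ := (isCompact_uIcc (a := (0 : ℝ)) (b := T)).exists_bound_of_continuousOn
    hexp.continuousOn
  have hM₁0 : 0 ≤ M₁ := (norm_nonneg _).trans (hM₁ 0 Set.left_mem_uIcc)
  have hM₂0 : 0 ≤ M₂ := (norm_nonneg _).trans (hM₂ 0 Set.left_mem_uIcc)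
  have hdiff : ∀ᶠ c in 𝓝 (0 : centerSubspace (J : Module.End ℝ Z)), DifferentiableAt ℝ ψ c :=
    ((hψ.of_le (by exact_mod_cast hi : ((1 : ℕ) : WithTop ℕ∞) ≤ i)).eventually
      (by simp)).mono fun c hc => hc.differentiableAt (by simp)
  -- along the linear flow the difference is transported up to higher order
  have hflow : (fun s : ℝ => exp ((-T) • J) (ψ (s • c T)) - ψ (s • c₀)) =o[𝓝[>] 0]
      fun s => s ^ i := by
    refine isLittleO_iff.2 fun ε hε => ?_
    set ε' := ε / (M₂ * M₁ ^ i * |T| + 1) with hε'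
    have hε'0 : 0 < ε' := by positivity
    obtain ⟨r, hr, hball⟩ := Metric.eventually_nhds_iff_ball.1
      (hdiff.and (isLittleO_iff.1 hg hε'0))
    have hs : ∀ᶠ s in 𝓝[>] (0 : ℝ), s * M₁ < r := by
      have : Tendsto (fun s : ℝ => s * M₁) (𝓝[>] 0) (𝓝 (0 * M₁)) :=
        (Continuous.tendsto (by fun_prop) 0).mono_left nhdsWithin_le_nhds
      exact this.eventually (gt_mem_nhds (by simpa using hr))
    filter_upwards [hs, self_mem_nhdsWithin] with s hs hs0
    have hs0 : 0 < s := hs0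
    have hn : ∀ t ∈ Set.uIcc 0 T, ‖s • c t‖ ≤ s * M₁ := fun t ht => by
      rw [norm_smul, Real.norm_of_nonneg hs0.le]
      exact mul_le_mul_of_nonneg_left (hM₁ t ht) hs0.le
    have hmem : ∀ t ∈ Set.uIcc 0 T, s • c t ∈
        Metric.ball (0 : centerSubspace (J : Module.End ℝ Z)) r := fun t ht => by
      rw [mem_ball_zero_iff]
      exact (hn t ht).trans_lt hs
    have hder : ∀ t ∈ Set.uIcc 0 T, HasDerivAt (fun t => exp ((-t) • J) (ψ (s • c t)))
        (exp ((-t) • J) (fderiv ℝ ψ (s • c t) (centerProjL J (J (s • c t : centerSubspace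
          (J : Module.End ℝ Z)))) - J (ψ (s • c t)))) t := by
      intro t ht
      have h1 : HasDerivAt (fun t => ψ (s • c t))
          (fderiv ℝ ψ (s • c t) (s • centerProjL J (J (c t)))) t :=
        ((hball _ (hmem t ht)).1.hasFDerivAt).comp_hasDerivAt t ((hcd t).const_smul s)
      refine ((hexpd t).clm_apply h1).congr_deriv ?_
      simp only [neg_apply, mul_apply_eq_comp, Submodule.coe_smul, map_smul, map_sub]
      abel
    have hle := (convex_uIcc (0 : ℝ) T).norm_image_sub_le_of_norm_hasDerivWithin_le
      (f := fun t => exp ((-t) • J) (ψ (s • c t))) (C := M₂ * (ε' * (s * M₁) ^ i))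
      (fun t ht => (hder t ht).hasDerivWithinAt)
      (fun t ht => by
        refine (ContinuousLinearMap.le_opNorm _ _).trans ?_
        have h3 := (hball _ (hmem t ht)).2
        rw [norm_pow, norm_norm] at h3
        have h4 := hn t ht
        gcongr
        · exact hM₂ t ht
        · exact h3.trans (by gcongr))
      Set.left_mem_uIcc Set.right_mem_uIcc
    rw [sub_zero] at hle
    have e0 : exp ((-(0 : ℝ)) • J) (ψ (s • c 0)) = ψ (s • c₀) := by simp [hc0]
    simp only [e0] at hle
    refine hle.trans ?_
    rw [Real.norm_eq_abs, Real.norm_of_nonneg (by positivity), mul_pow]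
    calc M₂ * (ε' * (s ^ i * M₁ ^ i)) * |T| = ε' * (M₂ * M₁ ^ i * |T|) * s ^ i := by ring
      _ ≤ ε' * (M₂ * M₁ ^ i * |T| + 1) * s ^ i := by gcongr; linarith
      _ = ε * s ^ i := by rw [hε']; field_simp
  have htay : (fun y => ψ y - ((i.factorial : ℝ)⁻¹) • iteratedFDeriv ℝ i ψ 0 (fun _ => y))
      =o[𝓝 0] fun y => ‖y‖ ^ i := by
    refine hψ.taylor_isLittleO.congr_left fun y => ?_
    rw [Finset.sum_range_succ, Finset.sum_eq_zero, zero_add]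
    intro m hm
    rw [h0 m (Finset.mem_range.1 hm), zero_apply, smul_zero]
  have hhom : ∀ (s : ℝ) y, iteratedFDeriv ℝ i ψ 0 (fun _ => s • y) =
      s ^ i • iteratedFDeriv ℝ i ψ 0 (fun _ => y) := fun s y => by
    have := (iteratedFDeriv ℝ i ψ 0).map_smul_univ (fun _ => s) (fun _ => y)
    simpa using this
  have h1 := (exp ((-T) • J)).isBigO_comp _ _ |>.trans_isLittleO (htay.ray (c T))
  have h2 := ((hflow.sub h1).add (htay.ray c₀))
  have h3 : exp ((-T) • J) (((i.factorial : ℝ)⁻¹) • iteratedFDeriv ℝ i ψ 0 fun _ => c T) -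
      ((i.factorial : ℝ)⁻¹) • iteratedFDeriv ℝ i ψ 0 (fun _ => c₀) = 0 := by
    refine eq_zero_of_pow_smul_isLittleO (n := i) (h2.congr_left fun s => ?_)
    simp only [hhom, map_sub, map_smul, smul_sub]
    rw [smul_comm (s ^ i), smul_comm (s ^ i)]
    abel
  rw [map_smul, ← smul_sub, smul_eq_zero, sub_eq_zero] at h3
  exact h3.resolve_left (by positivity)

/-- **Uniqueness of the Taylor expansion of center manifolds.** If two vector fields with the same
linearization differ by terms of order `l + 1`, then the Taylor expansions of their center manifolds
agree through degree `l`. The leading term of the difference is equivariant under the linear flow,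
grows subexponentially along it, and takes hyperbolic values: so it vanishes. -/
theorem IsLocalCenterManifold.sub_isLittleO {k k' l : ℕ} {S S' : Z → Z} {J : Z →L[ℝ] Z}
    {Ψ Ψ' : centerSubspace (J : Module.End ℝ Z) → hyperbolicSubspace (J : Module.End ℝ Z)}
    (h : IsLocalCenterManifold k S J Ψ) (h' : IsLocalCenterManifold k' S' J Ψ') (hk : 1 ≤ k)
    (hk' : 1 ≤ k') (hlk : l ≤ k) (hlk' : l ≤ k') (hS : ContDiffAt ℝ 2 S 0)
    (hS' : ContDiffAt ℝ 2 S' 0)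
    (hd : (fun z => S' z - S z) =O[𝓝 0] fun z => ‖z‖ ^ (l + 1)) :
    (fun c => (Ψ' c : Z) - (Ψ c : Z)) =o[𝓝 0] fun c => ‖c‖ ^ l := by
  have : CompleteSpace Z := FiniteDimensional.complete ℝ Z
  set ψ : centerSubspace (J : Module.End ℝ Z) → Z := fun c => (Ψ' c : Z) - (Ψ c : Z) with hψ
  have hψl : ContDiffAt ℝ l ψ 0 :=
    (h'.smooth_coe.of_le (by exact_mod_cast hlk')).sub (h.smooth_coe.of_le (by exact_mod_cast hlk))
  refine hψl.isLittleO_of_iteratedFDeriv_eq_zero fun i => ?_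
  induction i using Nat.strong_induction_on with
  | _ i ih =>
  intro hil
  match i, ih, hil with
  | 0, _, _ =>
    ext v
    simp [hψ, h.through_zero, h'.through_zero]
  | 1, _, _ =>
    ext v
    rw [iteratedFDeriv_one_apply, (h'.hasFDerivAt_coe.fun_sub h.hasFDerivAt_coe).fderiv]
    simp
  | j + 2, ih, hil =>
    have hψi : ContDiffAt ℝ (j + 2 : ℕ) ψ 0 := hψl.of_le (by exact_mod_cast hil)
    refine hψi.iteratedFDeriv_eq_zero_of_diag fun c₀ => ?_
    have h0 : ψ =o[𝓝 0] fun c => ‖c‖ ^ (j + 1) :=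
      (hψi.of_le (by norm_cast; omega)).isLittleO_of_iteratedFDeriv_eq_zero
        fun m hm => ih m (by omega) (by omega)
    have h1 : fderiv ℝ ψ =o[𝓝 0] fun c => ‖c‖ ^ j := by
      refine (hψi.fderiv_right (m := j) (by norm_cast; omega)).isLittleO_of_iteratedFDeriv_eq_zero
        fun m hm => ?_
      ext v w
      have := iteratedFDeriv_succ_apply_right (𝕜 := ℝ) (f := ψ) (x := 0)
        (Fin.snoc v w : Fin (m + 1) → centerSubspace (J : Module.End ℝ Z))
      rw [ih (m + 1) (by omega) (by omega), Fin.init_snoc, Fin.snoc_last] at this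
      rw [← this]
      simp
    have hg := h.linearized_invariance h' hk hk' hS hS' hd hil h0 h1
    set p := iteratedFDeriv ℝ (j + 2) ψ 0 with hp
    have hequiv := equivariant_of_linearized_invariance hψi (by omega)
      (fun m hm => ih m hm (by omega)) hg c₀
    -- the leading term `p` takes values in the hyperbolic subspace
    have hpc : ∀ c : centerSubspace (J : Module.End ℝ Z), centerProjL J (p fun _ => c) = 0 := by
      intro c
      have h2 : (fun c => centerProjL J (ψ c)) = fun _ => 0 := funext fun c =>
        centerProjL_of_mem_hyperbolic J (Submodule.sub_mem _ (Ψ' c).2 (Ψ c).2)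
      have h3 := (centerProjL J).iteratedFDeriv_comp_left hψi (le_refl ((j + 2 : ℕ) : ℕ∞ω))
      have h4 : (centerProjL J ∘ ψ) = fun _ => 0 := h2
      rw [h4, iteratedFDeriv_fun_zero] at h3
      exact (DFunLike.congr_fun h3 fun _ => c).symm
    obtain ⟨β, hβ, hη⟩ := exists_isTrichotomy J
    -- with this growth rate of the center flow, `p` grows along it at most like `exp (β |T| / 2)`
    obtain ⟨C, htri⟩ := hη (β / (2 * (j + 2))) (by positivity)
    have hsol : ∀ T : ℝ, exp (T • J) (p fun _ => c₀) =
        p fun _ => centerProjL J (exp (T • J) (c₀ : Z)) := by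
      intro T
      rw [hp, ← hequiv T, exp_smul_add_apply]
      simp
    have hbound : ∀ T : ℝ, ‖exp (T • J) (p fun _ => c₀)‖ ≤
        ‖p‖ * (‖centerProjL J‖ * (C * ‖(c₀ : Z)‖)) ^ (j + 2) * Real.exp (β / 2 * |T|) := by
      intro T
      rw [hsol]
      refine (p.le_opNorm _).trans ?_
      rw [Finset.prod_const, Finset.card_univ, Fintype.card_fin, mul_assoc]
      gcongr
      have hc : spectralProj J {0} (c₀ : Z) = c₀ := spectralProj_of_mem J (by
        rw [spectralSubspace_singleton]
        exact c₀.2)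
      have h2 := htri.center T c₀
      rw [hc] at h2
      have e1 : Real.exp (β / 2 * |T|) = Real.exp (β / (2 * (j + 2)) * |T|) ^ (j + 2) := by
        rw [← Real.exp_nat_mul]
        congr 1
        push_cast
        field_simp
      rw [e1, ← mul_pow]
      gcongr
      refine ((centerProjL J).le_opNorm _).trans ?_
      rw [mul_assoc]
      gcongr
      refine h2.trans (le_of_eq (by ring))
    -- a linear solution with this growth and without center part vanishes
    have hzero := htri.eq_of_small (u := fun T : ℝ => exp (T • J) (p fun _ => c₀))
      (v := fun _ => 0) (N := fun _ _ => 0) (μ := β / 2) (ε := 0) (K' := 0) ?_ le_rfl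
      (by simp) le_rfl (by simp)
      (fun t => by simpa using hasDerivAt_exp_smul_apply J (p fun _ => c₀) t)
      (fun t => by simpa using hasDerivAt_const t (0 : Z)) hbound (by simp) ?_
    · simpa using congrFun hzero 0
    · rw [mul_div_assoc', div_le_div_iff₀ (by positivity) (by positivity)]
      nlinarith [(Nat.cast_nonneg j : (0 : ℝ) ≤ j)]
    · simp only [zero_smul, exp_zero, one_apply_eq_self, map_zero]
      rw [← coe_centerProjL, hpc]
      rfl

end JetUniqueness

/-! ### Hyperbolic operators -/

section HyperbolicOperators

/-- Without eigenvectors for imaginary eigenvalues the center subspace is trivial. -/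
theorem centerSubspace_eq_bot_of_forall {Z : Type*} [AddCommGroup Z] [Module ℝ Z]
    {T : Module.End ℝ Z} (h : ∀ (b : ℝ) (x : Z), T (T x) = -(b ^ 2) • x → x = 0) :
    centerSubspace T = ⊥ := by
  refine (iSup_eq_bot).2 fun b => (Submodule.eq_bot_iff _).2 fun x hx => ?_
  obtain ⟨k, hk⟩ := (Module.End.mem_maxGenEigenspace _ _ _).1 hx
  induction k generalizing x with
  | zero => simpa using hk
  | succ k ih =>
    rw [pow_succ, Module.End.mul_apply] at hk
    have h1 := ih _ ((Module.End.mem_maxGenEigenspace _ _ _).2 ⟨k, hk⟩) hk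
    refine h b x ?_
    simpa [pow_two, add_eq_zero_iff_eq_neg] using h1

/-- An operator with a definite quadratic form has no spectrum on the imaginary axis. -/
theorem centerSubspace_eq_bot_of_inner_neg {Y : Type*} [NormedAddCommGroup Y]
    [InnerProductSpace ℝ Y] {T : Module.End ℝ Y} (h : ∀ y, y ≠ 0 → inner ℝ y (T y) < 0) :
    centerSubspace T = ⊥ := by
  refine centerSubspace_eq_bot_of_forall fun b x hx => ?_
  by_contra hx0
  have h1 : T x = 0 := by
    by_contra hT
    have h2 := h _ hT
    rw [hx, inner_smul_right, real_inner_comm] at h2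
    nlinarith [h x hx0, sq_nonneg b]
  have h3 := h x hx0
  rw [h1, inner_zero_right] at h3
  exact lt_irrefl _ h3

open Polynomial in
/-- Adding a multiple of the identity makes an operator hyperbolic, up to finitely many
exceptions. -/
theorem finite_setOf_centerSubspace_ne_bot {Y : Type*} [AddCommGroup Y] [Module ℝ Y]
    [FiniteDimensional ℝ Y] (B : Module.End ℝ Y) :
    {s : ℝ | centerSubspace (B + s • 1) ≠ ⊥}.Finite := by
  have hB : minpoly ℝ B ≠ 0 := minpoly.ne_zero (Algebra.IsIntegral.isIntegral B)
  refine (((minpoly ℝ B).rootSet_finite ℂ).image fun z => -z.re).subset fun s hs => ?_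
  obtain ⟨x, hx, hx0⟩ := (Submodule.ne_bot_iff _).1 hs
  rw [centerSubspace_eq] at hx
  obtain ⟨q, hq, hqx⟩ := exists_poly_of_mem_iSup _ _ hx
  set r := (minpoly ℝ B).comp (X - C s) with hr
  have hrT : aeval (B + s • 1) r = 0 := by
    rw [hr, aeval_comp, map_sub, aeval_X, aeval_C, Algebra.algebraMap_eq_smul_one,
      add_sub_cancel_right, minpoly.aeval]
  have hcop : ¬IsCoprime q r := by
    rintro ⟨a, c, hac⟩
    have h1 := congrArg (fun p => aeval (B + s • 1) p x) hac
    simp only [map_add, map_mul, hrT, mul_zero, add_zero, map_one, Module.End.mul_apply, hqx,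
      map_zero, Module.End.one_apply] at h1
    exact hx0 h1.symm
  obtain ⟨z, hz, hz'⟩ : ∃ z : ℂ, aeval z q = 0 ∧ aeval z r = 0 := by
    by_contra! hno
    refine hcop (isCoprime_of_irreducible_dvd ?_ ?_)
    · rintro ⟨rfl, -⟩
      exact hx0 (by
        have := hq 1 (by simp)
        simp at this)
    · rintro p hp ⟨s, rfl⟩ ⟨t, ht⟩
      obtain ⟨z, hz⟩ : ∃ z : ℂ, Polynomial.aeval z p = 0 :=
        IsAlgClosed.exists_aeval_eq_zero _ p (Polynomial.degree_pos_of_irreducible hp).ne'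
      exact hno z (by rw [map_mul, hz, zero_mul]) (by rw [ht, map_mul, hz, zero_mul])
  refine ⟨z - s, ?_, ?_⟩
  · rw [mem_rootSet]
    refine ⟨hB, ?_⟩
    rw [hr, aeval_comp] at hz'
    simpa using hz'
  · have := hq z hz
    simp only [Set.mem_singleton_iff] at this
    simp [this]

end HyperbolicOperators

/-! ### The coupling matrix -/

section Coupling

variable {Y : Type*} [NormedAddCommGroup Y] [InnerProductSpace ℝ Y] [FiniteDimensional ℝ Y]

/-- Moving the entries below the diagonal to the transposed places does not change a quadratic form:
what remains after subtracting the strictly upper triangular part is the diagonal. -/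
theorem sum_sum_sub_sum_lt {m : ℕ} (a : Fin m → Fin m → ℝ) (c : Fin m → ℝ) :
    ∑ i, ∑ j, c i * c j * a i j - ∑ i, ∑ j, (if i < j then a i j + a j i else 0) * c j * c i =
      ∑ i, a i i * c i ^ 2 := by
  have h1 : ∑ i, ∑ j, (if i < j then a i j + a j i else 0) * c j * c i =
      ∑ i, ∑ j, ((if i < j then 1 else 0) + (if j < i then 1 else 0)) * (c i * c j * a i j) := by
    have h2 : ∀ i j, (if i < j then a i j + a j i else 0) * c j * c i =
        (if i < j then 1 else 0) * (c i * c j * a i j) +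
        (if i < j then 1 else 0) * (c j * c i * a j i) := by
      intro i j
      split_ifs <;> ring
    simp only [h2, add_mul, Finset.sum_add_distrib]
    congr 1
    rw [Finset.sum_comm]
  rw [h1, ← Finset.sum_sub_distrib]
  refine Finset.sum_congr rfl fun i _ => ?_
  rw [← Finset.sum_sub_distrib, Finset.sum_eq_single i]
  · simp
    ring
  · intro j _ hj
    rcases lt_or_gt_of_ne hj with h | h
    · simp [h, h.not_gt]
    · simp [h, h.not_gt]
  · simp

/-- If the quadratic form of `A` is positive on `m` orthogonal vectors, then `A` differs by a
positive-definite operator from one whose center subspace has dimension `m` and carries a nilpotent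
operator. On the span of the orthogonal vectors the difference is made strictly upper triangular;
on the orthogonal complement it is made negative-definite, with off-diagonal blocks that cancel in
the quadratic form of `D`. -/
theorem exists_posDef_nilpotent_sub {m : ℕ} (A : Y →L[ℝ] Y) (x : Fin m → Y)
    (hx_orth : ∀ i j, i ≠ j → inner ℝ (x i) (x j) = 0)
    (hx_pos : ∀ i, 0 < inner ℝ (x i) (A (x i))) :
    ∃ D : Y →L[ℝ] Y, (∀ y, y ≠ 0 → 0 < inner ℝ y (D y)) ∧
      Module.finrank ℝ (centerSubspace ((A - D : Y →L[ℝ] Y) : Module.End ℝ Y)) = m ∧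
      ∀ w ∈ centerSubspace ((A - D : Y →L[ℝ] Y) : Module.End ℝ Y), ((A - D) ^ m) w = 0 := by
  have : CompleteSpace Y := FiniteDimensional.complete ℝ Y
  have hx0 : ∀ i, x i ≠ 0 := fun i h => by simpa [h] using hx_pos i
  set e : Fin m → Y := fun i => ‖x i‖⁻¹ • x i with he
  have heo : Orthonormal ℝ e := by
    refine ⟨fun i => ?_, fun i j hij => ?_⟩
    · rw [he, norm_smul, norm_inv, norm_norm, inv_mul_cancel₀ (norm_ne_zero_iff.2 (hx0 i))]
    · simp only [he, inner_smul_left, inner_smul_right, hx_orth i j hij, mul_zero]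
  set a : Fin m → Fin m → ℝ := fun i j => inner ℝ (e i) (A (e j)) with ha
  have haa : ∀ i, 0 < a i i := fun i => by
    simp only [ha, he, map_smul, inner_smul_left, inner_smul_right]
    have := hx_pos i
    have := norm_pos_iff.2 (hx0 i)
    simp
    positivity
  -- `P` is the orthogonal projection onto the span of the vectors. The operator `N`, strictly upper
  -- triangular in the basis `e`, has the quadratic form of `P A P` up to the diagonal entries.
  let P : Y →L[ℝ] Y := ∑ j, (innerSL ℝ (e j)).smulRight (e j)
  have hP : ∀ z, P z = ∑ j, inner ℝ (e j) z • e j := fun z => by simp [P, sum_apply]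
  let N : Y →L[ℝ] Y := ∑ i, ∑ j, (if i < j then a i j + a j i else 0) •
    (innerSL ℝ (e j)).smulRight (e i)
  have hN : ∀ z, N z = ∑ i, (∑ j, (if i < j then a i j + a j i else 0) * inner ℝ (e j) z) • e i :=
    fun z => by
      simp only [N, sum_apply, smul_apply, ContinuousLinearMap.smulRight_apply,
        innerSL_apply_apply, Finset.sum_smul, smul_smul]
  have hcP : ∀ i z, inner ℝ (e i) (P z) = inner ℝ (e i) z := fun i z => by
    rw [hP, heo.inner_right_fintype]
  have hcN : ∀ i z, inner ℝ (e i) (N z) =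
      ∑ j, (if i < j then a i j + a j i else 0) * inner ℝ (e j) z := fun i z => by
    rw [hN, heo.inner_right_fintype]
  have hPP : ∀ z, P (P z) = P z := fun z => by rw [hP (P z), hP z]; simp only [← hP, hcP]
  have hPN : ∀ z, P (N z) = N z := fun z => by rw [hP (N z), hN]; simp only [← hN, hcN]
  have hNP : ∀ z, N (P z) = N z := fun z => by rw [hN, hN]; simp only [hcP]
  have hPs : ∀ y z, inner ℝ y (P z) = inner ℝ (P y) z := fun y z => by
    rw [hP, hP, inner_sum, sum_inner]
    refine Finset.sum_congr rfl fun j _ => ?_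
    rw [real_inner_smul_right, real_inner_smul_left (e j) z, real_inner_comm y (e j), mul_comm]
  -- for this `κ` the compression of `A - κ` to the orthogonal complement is negative-definite
  set κ := ‖A‖ + 1 with hκ
  have hκ0 : 0 < κ := by positivity
  let Q : Y →L[ℝ] Y := ContinuousLinearMap.id ℝ Y - P
  have hQ : ∀ z, Q z = z - P z := fun z => rfl
  have hPQ : ∀ z, P (Q z) = 0 := fun z => by rw [hQ, map_sub, hPP, sub_self]
  have hQP : ∀ z, Q (P z) = 0 := fun z => by rw [hQ, hPP, sub_self]
  -- The last term makes the coupling between the two subspaces skew-symmetric. It vanishes on the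
  -- span, which is therefore invariant: there `A - D` is `N`.
  let D : Y →L[ℝ] Y := A.comp P - N + κ • Q - (P.comp A.adjoint).comp Q
  have hD : ∀ z, D z = A (P z) - N z + κ • Q z - P (A.adjoint (Q z)) := fun z => rfl
  set T := A - D with hT
  have hTz : ∀ z, T z = A (Q z) + N z - κ • Q z + P (A.adjoint (Q z)) := fun z => by
    have : A (Q z) = A z - A (P z) := by rw [hQ, map_sub]
    rw [hT, sub_apply, hD, this]
    abel
  have hTP : ∀ z, P z = z → T z = N z := fun z hz => by
    have : Q z = 0 := by rw [hQ, hz, sub_self]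
    simp [hTz, this]
  have hTk : ∀ z, P z = z → ∀ k, (T ^ k) z = (N ^ k) z ∧ P ((N ^ k) z) = (N ^ k) z := by
    intro z hz k
    induction k with
    | zero => exact ⟨rfl, hz⟩
    | succ k ih =>
      rw [pow_succ', pow_succ', mul_apply_eq_comp, mul_apply_eq_comp, ih.1]
      exact ⟨hTP _ ih.2, hPN _⟩
  have hnil : ∀ z, P z = z → (T ^ m) z = 0 := by
    intro z hz
    have h1 : ∀ k, ∀ i : Fin m, m ≤ i + k → inner ℝ (e i) ((N ^ k) z) = 0 := by
      intro k
      induction k with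
      | zero =>
        intro i hi
        exact absurd i.2 (by omega)
      | succ k ih =>
        intro i hi
        rw [pow_succ', mul_apply_eq_comp, hcN]
        refine Finset.sum_eq_zero fun j _ => ?_
        split_ifs with hij
        · rw [ih j (by have := Fin.lt_def.1 hij; omega), mul_zero]
        · rw [zero_mul]
    rw [(hTk z hz m).1, ← (hTk z hz m).2, hP]
    exact Finset.sum_eq_zero fun i _ => by rw [h1 m i (by omega), zero_smul]
  have hcenter : ∀ z, z ∈ centerSubspace (T : Module.End ℝ Y) ↔ P z = z := by
    intro z
    constructor
    · intro hz
      -- the compression to the orthogonal complement is negative-definite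
      let T' : Y →L[ℝ] Y := (Q.comp T).comp Q - P
      have hneg : ∀ y, y ≠ 0 → inner ℝ y (T' y) < 0 := by
        intro y hy
        have h1 : inner ℝ y (T' y) = inner ℝ (Q y) (A (Q y)) - κ * ‖Q y‖ ^ 2 - ‖P y‖ ^ 2 := by
          have h2 : T' y = Q (A (Q y)) - κ • Q y - P y := by
            change Q (T (Q y)) - P y = _
            have e1 : Q (Q y) = Q y := by rw [hQ (Q y), hPQ, sub_zero]
            have e2 : N (Q y) = 0 := by rw [← hNP, hPQ, map_zero]
            rw [hTz, e1, e2, map_add, map_sub, map_add, hQP, map_smul, e1]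
            simp
          have h3 : ∀ u, inner ℝ y (Q u) = inner ℝ (Q y) u := fun u => by
            rw [hQ, hQ, inner_sub_left, inner_sub_right, hPs]
          have h4 : inner ℝ y (Q y) = ‖Q y‖ ^ 2 := by
            have e1 : Q (Q y) = Q y := by rw [hQ (Q y), hPQ, sub_zero]
            rw [← e1, h3, e1, real_inner_self_eq_norm_sq]
          have h5 : inner ℝ y (P y) = ‖P y‖ ^ 2 := by
            rw [← hPP, hPs, hPP, real_inner_self_eq_norm_sq]
          rw [h2, inner_sub_right, inner_sub_right, h3, inner_smul_right, h4, h5]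
        have h2 : inner ℝ (Q y) (A (Q y)) ≤ ‖A‖ * ‖Q y‖ ^ 2 :=
          (real_inner_le_norm _ _).trans (by
            have := A.le_opNorm (Q y)
            have := norm_nonneg (Q y)
            nlinarith)
        rw [h1, hκ]
        by_contra! hcon
        have h3 : ‖Q y‖ ^ 2 = 0 := by nlinarith [sq_nonneg ‖Q y‖, sq_nonneg ‖P y‖]
        have h4 : ‖P y‖ ^ 2 = 0 := by nlinarith [sq_nonneg ‖Q y‖, sq_nonneg ‖P y‖]
        rw [sq_eq_zero_iff, norm_eq_zero] at h3 h4
        rw [hQ, h4, sub_zero] at h3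
        exact hy h3
      have hint : ∀ y, Q (T y) = T' (Q y) := by
        intro y
        have e1 : Q (Q y) = Q y := by rw [hQ (Q y), hPQ, sub_zero]
        change _ = Q (T (Q (Q y))) - P (Q y)
        rw [e1, hPQ, sub_zero, hTz, hTz, e1]
        have e2 : Q (N y) = 0 := by rw [← hPN, hQP]
        have e3 : N (Q y) = 0 := by rw [← hNP, hPQ, map_zero]
        simp only [map_add, map_sub, e2, e3, map_zero]
      have h1 : Q z ∈ centerSubspace (T' : Module.End ℝ Y) := by
        rw [← spectralSubspace_singleton] at hz ⊢
        exact map_mem_spectralSubspace (Q : Y →ₗ[ℝ] Y) hint _ hz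
      rw [centerSubspace_eq_bot_of_inner_neg (T := (T' : Module.End ℝ Y)) hneg,
        Submodule.mem_bot, hQ, sub_eq_zero] at h1
      exact h1.symm
    · intro hz
      refine le_iSup (fun b => realGenEigenspace (T : Module.End ℝ Y) 0 b) 0 ?_
      refine (mem_realGenEigenspace_iff _ _ _ _).2 ⟨m, ?_⟩
      have h1 : ∀ k, (((T : Module.End ℝ Y)) ^ k) z = (T ^ k) z := fun k => by
        induction k with
        | zero => rfl
        | succ k ih =>
          rw [pow_succ', pow_succ', Module.End.mul_apply, ih]
          rfl
      have h2 : (Polynomial.aeval (T : Module.End ℝ Y)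
          (((Polynomial.X - Polynomial.C 0) ^ 2 + Polynomial.C (0 ^ 2) : Polynomial ℝ) ^ m)) =
          (T : Module.End ℝ Y) ^ m * (T : Module.End ℝ Y) ^ m := by
        simp [← pow_add, ← pow_mul, two_mul]
      rw [h2, Module.End.mul_apply, h1, hnil z hz, map_zero]
  refine ⟨D, fun z hz => ?_, ?_, fun w hw => hnil w ((hcenter w).1 hw)⟩
  · have h1 : inner ℝ z (D z) = ∑ i, a i i * inner ℝ (e i) z ^ 2 + κ * ‖Q z‖ ^ 2 := by
      have hzz : z = P z + Q z := by rw [hQ, add_sub_cancel]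
      have h2 : inner ℝ z (A (P z)) = ∑ i, ∑ j, inner ℝ (e i) z * inner ℝ (e j) z * a i j +
          inner ℝ (Q z) (A (P z)) := by
        nth_rewrite 1 [hzz]
        rw [inner_add_left]
        congr 1
        rw [hP, map_sum, sum_inner]
        refine Finset.sum_congr rfl fun i _ => ?_
        rw [inner_sum]
        refine Finset.sum_congr rfl fun j _ => ?_
        rw [map_smul, inner_smul_left, inner_smul_right, mul_assoc]
        rfl
      have h3 : inner ℝ z (N z) =
          ∑ i, ∑ j, (if i < j then a i j + a j i else 0) * inner ℝ (e j) z * inner ℝ (e i) z := by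
        rw [hN, inner_sum]
        refine Finset.sum_congr rfl fun i _ => ?_
        rw [inner_smul_right, Finset.sum_mul, real_inner_comm]
      have h4 : inner ℝ z (Q z) = ‖Q z‖ ^ 2 := by
        nth_rewrite 1 [hzz]
        rw [inner_add_left, ← hPs, hPQ, inner_zero_right, zero_add, real_inner_self_eq_norm_sq]
      have h5 : inner ℝ z (P (A.adjoint (Q z))) = inner ℝ (Q z) (A (P z)) := by
        rw [hPs, ContinuousLinearMap.adjoint_inner_right, real_inner_comm]
      rw [hD, inner_sub_right, inner_add_right, inner_sub_right, inner_smul_right, h2, h3, h4, h5,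
        ← sum_sum_sub_sum_lt]
      ring
    rw [h1]
    have hs : ∀ i ∈ Finset.univ, 0 ≤ a i i * inner ℝ (e i) z ^ 2 := fun i _ =>
      mul_nonneg (haa i).le (sq_nonneg _)
    have hs0 := Finset.sum_nonneg hs
    by_contra! hcon
    have h2 : ‖Q z‖ ^ 2 = 0 := by nlinarith [sq_nonneg ‖Q z‖]
    have h3 : ∑ i, a i i * inner ℝ (e i) z ^ 2 = 0 := by nlinarith [sq_nonneg ‖Q z‖]
    rw [sq_eq_zero_iff, norm_eq_zero, hQ, sub_eq_zero] at h2
    have h4 : P z = 0 := by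
      rw [hP]
      refine Finset.sum_eq_zero fun i hi => ?_
      have h5 := (Finset.sum_eq_zero_iff_of_nonneg hs).1 h3 i hi
      have h6 := (mul_eq_zero.1 h5).resolve_left (haa i).ne'
      rw [sq_eq_zero_iff.1 h6, zero_smul]
    exact hz (h2.trans h4)
  · have h1 : centerSubspace (T : Module.End ℝ Y) = Submodule.span ℝ (Set.range e) := by
      ext z
      rw [hcenter]
      constructor
      · intro hz
        rw [← hz, hP]
        exact Submodule.sum_mem _ fun i _ => Submodule.smul_mem _ _
          (Submodule.subset_span (Set.mem_range_self i))
      · intro hz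
        obtain ⟨c, rfl⟩ := (Submodule.mem_span_range_iff_exists_fun ℝ).1 hz
        rw [hP]
        simp only [heo.inner_right_fintype]
    rw [h1, finrank_span_eq_card heo.linearIndependent, Fintype.card_fin]

end Coupling

/-! ### The center subspace of the network -/

section NetworkSpectrum

variable {V : Type*} [Fintype V] [DecidableEq V]

/-- The weighted sum `∑ p, u p • X p` of the states of the nodes. -/
noncomputable def nodeSum {n : ℕ} (u : V → ℝ) :
    (V → EuclideanSpace ℝ (Fin n)) →L[ℝ] EuclideanSpace ℝ (Fin n) :=
  ∑ p, u p • ContinuousLinearMap.proj p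

/-- The network state `u ⊗ y`, in which the node `p` has the state `u p • y`. -/
noncomputable def nodeLift {n : ℕ} (u : V → ℝ) :
    EuclideanSpace ℝ (Fin n) →L[ℝ] (V → EuclideanSpace ℝ (Fin n)) :=
  ContinuousLinearMap.pi fun p => u p • ContinuousLinearMap.id ℝ _

omit [DecidableEq V] in
theorem nodeSum_apply {n : ℕ} (u : V → ℝ) (X : V → EuclideanSpace ℝ (Fin n)) :
    nodeSum u X = ∑ p, u p • X p := by
  simp [nodeSum, sum_apply]

omit [Fintype V] [DecidableEq V] in
theorem nodeLift_apply {n : ℕ} (u : V → ℝ) (y : EuclideanSpace ℝ (Fin n)) (p : V) :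
    nodeLift u y p = u p • y := rfl

omit [DecidableEq V] in
theorem nodeSum_nodeLift {n : ℕ} (u v : V → ℝ) (y : EuclideanSpace ℝ (Fin n)) :
    nodeSum u (nodeLift v y) = (∑ p, u p * v p) • y := by
  rw [nodeSum_apply, Finset.sum_smul]
  exact Finset.sum_congr rfl fun p _ => smul_smul _ _ _

omit [Fintype V] [DecidableEq V] in
theorem nodeLift_injective {n : ℕ} {v : V → ℝ} (hv : v ≠ 0) :
    Function.Injective (nodeLift (n := n) v) := by
  obtain ⟨p, hp⟩ := Function.ne_iff.1 hv
  intro y y' h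
  have := congrFun h p
  exact smul_right_injective _ hp this

variable (G : SimpleGraph V) [DecidableRel G.Adj] {n : ℕ}
  (A : EuclideanSpace ℝ (Fin n) →L[ℝ] EuclideanSpace ℝ (Fin n)) (α : ℝ)
  (D : EuclideanSpace ℝ (Fin n) →L[ℝ] EuclideanSpace ℝ (Fin n))

theorem networkJacobian_apply (X : V → EuclideanSpace ℝ (Fin n)) (p : V) :
    networkJacobian G A α D X p = A (X p) - α • ∑ j, G.lapMatrix ℝ p j • D (X j) := by
  simp [networkJacobian, sum_apply]

variable {G}

theorem networkJacobian_nodeLift {u : V → ℝ} {μ : ℝ}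
    (hu : Matrix.mulVec (G.lapMatrix ℝ) u = μ • u) (y : EuclideanSpace ℝ (Fin n)) :
    networkJacobian G A α D (nodeLift u y) = nodeLift u ((A - (α * μ) • D) y) := by
  funext p
  rw [networkJacobian_apply]
  simp only [nodeLift_apply, map_smul, smul_smul, ← Finset.sum_smul]
  have h1 : ∑ j, G.lapMatrix ℝ p j * u j = μ * u p := congrFun hu p
  rw [h1, sub_apply, smul_apply, smul_sub, smul_smul]
  congr 2
  ring

theorem nodeSum_networkJacobian {u : V → ℝ} {μ : ℝ}
    (hu : Matrix.mulVec (G.lapMatrix ℝ) u = μ • u) (X : V → EuclideanSpace ℝ (Fin n)) :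
    nodeSum u (networkJacobian G A α D X) = (A - (α * μ) • D) (nodeSum u X) := by
  simp only [nodeSum_apply, networkJacobian_apply, smul_sub, Finset.sum_sub_distrib, sub_apply,
    map_sum, map_smul, smul_apply]
  congr 1
  simp only [Finset.smul_sum, smul_smul]
  rw [Finset.sum_comm]
  refine Finset.sum_congr rfl fun j _ => ?_
  rw [← Finset.sum_smul]
  congr 1
  have h1 : ∑ p, G.lapMatrix ℝ j p * u p = μ * u j := congrFun hu j
  have h2 : ∀ p, u p * (α * G.lapMatrix ℝ p j) = α * (G.lapMatrix ℝ j p * u p) := fun p => by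
    rw [(G.isSymm_lapMatrix (R := ℝ)).apply p j]
    ring
  simp only [h2]
  rw [← Finset.mul_sum, h1]
  ring

/-- Expansion of a network state in an orthonormal basis of eigenvectors of the Laplacian. -/
theorem sum_nodeLift_nodeSum (b : OrthonormalBasis V ℝ (EuclideanSpace ℝ V))
    (X : V → EuclideanSpace ℝ (Fin n)) :
    ∑ k, nodeLift (b k) (nodeSum (b k) X) = X := by
  funext p
  have h1 : ∀ q, ∑ k, b k p * b k q = if p = q then 1 else 0 := fun q => by
    have := congrFun (congrArg WithLp.ofLp (b.sum_repr' (EuclideanSpace.single q (1 : ℝ)))) p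
    simpa [EuclideanSpace.inner_single_right, mul_comm, Pi.single_apply] using this
  simp only [Finset.sum_apply, nodeLift_apply, nodeSum_apply, Finset.smul_sum, smul_smul]
  rw [Finset.sum_comm]
  simp only [← Finset.sum_smul, h1]
  simp

variable {A α D}

/-- If all blocks but the one for the eigenvalue `lam` are hyperbolic, then the center subspace of
the network consists of the states `v ⊗ w`, where `w` is in the center subspace of that block. -/
theorem mem_centerSubspace_networkJacobian {v : V → ℝ} {lam : ℝ}
    (hv : Matrix.mulVec (G.lapMatrix ℝ) v = lam • v)
    (hs : ∀ u : V → ℝ, Matrix.mulVec (G.lapMatrix ℝ) u = lam • u → ∃ t : ℝ, u = t • v)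
    (hyp : ∀ k, (G.isHermitian_lapMatrix ℝ).eigenvalues k ≠ lam →
      centerSubspace ((A - (α * (G.isHermitian_lapMatrix ℝ).eigenvalues k) • D :
        EuclideanSpace ℝ (Fin n) →L[ℝ] EuclideanSpace ℝ (Fin n)) :
        Module.End ℝ (EuclideanSpace ℝ (Fin n))) = ⊥) (X : V → EuclideanSpace ℝ (Fin n)) :
    X ∈ centerSubspace (networkJacobian G A α D : Module.End ℝ (V → EuclideanSpace ℝ (Fin n))) ↔
      ∃ w ∈ centerSubspace ((A - (α * lam) • D :
        EuclideanSpace ℝ (Fin n) →L[ℝ] EuclideanSpace ℝ (Fin n)) :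
        Module.End ℝ (EuclideanSpace ℝ (Fin n))), X = nodeLift v w := by
  set hL := G.isHermitian_lapMatrix ℝ
  constructor
  · intro hX
    have hb : ∀ k, Matrix.mulVec (G.lapMatrix ℝ) (hL.eigenvectorBasis k) =
        hL.eigenvalues k • (hL.eigenvectorBasis k : V → ℝ) := hL.mulVec_eigenvectorBasis
    have h1 : ∀ k, nodeSum (hL.eigenvectorBasis k) X ∈ centerSubspace
        ((A - (α * hL.eigenvalues k) • D :
        EuclideanSpace ℝ (Fin n) →L[ℝ] EuclideanSpace ℝ (Fin n)) :
        Module.End ℝ (EuclideanSpace ℝ (Fin n))) := fun k => by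
      rw [← spectralSubspace_singleton] at hX ⊢
      exact map_mem_spectralSubspace
        (nodeSum (hL.eigenvectorBasis k)).toLinearMap
        (nodeSum_networkJacobian A α D (hb k)) _ hX
    have h2 : ∀ k, ∃ w ∈ centerSubspace ((A - (α * lam) • D :
        EuclideanSpace ℝ (Fin n) →L[ℝ] EuclideanSpace ℝ (Fin n)) :
        Module.End ℝ (EuclideanSpace ℝ (Fin n))),
        nodeLift (hL.eigenvectorBasis k) (nodeSum (hL.eigenvectorBasis k) X) = nodeLift v w := by
      intro k
      have h3 := h1 k
      by_cases hk : hL.eigenvalues k = lam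
      · have h4 := hb k
        rw [hk] at h4 h3
        obtain ⟨t, ht⟩ := hs _ h4
        refine ⟨t • nodeSum (hL.eigenvectorBasis k) X, Submodule.smul_mem _ _ h3, ?_⟩
        funext p
        rw [nodeLift_apply, nodeLift_apply, ht, smul_smul, Pi.smul_apply, smul_eq_mul, mul_comm]
      · rw [hyp k hk, Submodule.mem_bot] at h3
        exact ⟨0, Submodule.zero_mem _, by rw [h3, map_zero, map_zero]⟩
    choose w hw hw' using h2
    refine ⟨∑ k, w k, Submodule.sum_mem _ fun k _ => hw k, ?_⟩
    rw [map_sum, ← Finset.sum_congr rfl fun k _ => hw' k]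
    exact (sum_nodeLift_nodeSum _ X).symm
  · rintro ⟨w, hw, rfl⟩
    rw [← spectralSubspace_singleton] at hw ⊢
    exact map_mem_spectralSubspace
      (nodeLift v).toLinearMap
      (fun z => (networkJacobian_nodeLift A α D hv z).symm) _ hw

variable (A α D) in
theorem finrank_centerSubspace_le_networkJacobian {v : V → ℝ} (hv0 : v ≠ 0) {lam : ℝ}
    (hv : Matrix.mulVec (G.lapMatrix ℝ) v = lam • v) :
    Module.finrank ℝ (centerSubspace ((A - (α * lam) • D :
        EuclideanSpace ℝ (Fin n) →L[ℝ] EuclideanSpace ℝ (Fin n)) :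
        Module.End ℝ (EuclideanSpace ℝ (Fin n)))) ≤
      Module.finrank ℝ (centerSubspace
        (networkJacobian G A α D : Module.End ℝ (V → EuclideanSpace ℝ (Fin n)))) := by
  have h1 := (Submodule.equivMapOfInjective (nodeLift (n := n) v).toLinearMap
    (nodeLift_injective hv0) (centerSubspace ((A - (α * lam) • D :
        EuclideanSpace ℝ (Fin n) →L[ℝ] EuclideanSpace ℝ (Fin n)) :
        Module.End ℝ (EuclideanSpace ℝ (Fin n))))).finrank_eq
  rw [h1]
  refine Submodule.finrank_mono ?_
  rintro _ ⟨w, hw, rfl⟩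
  rw [← spectralSubspace_singleton]
  rw [SetLike.mem_coe, ← spectralSubspace_singleton] at hw
  exact map_mem_spectralSubspace (nodeLift v).toLinearMap
    (fun z => (networkJacobian_nodeLift A α D hv z).symm) _ hw

theorem exists_pos_eigenvalue_lapMatrix [Nontrivial V] (hG : G.Connected) :
    ∃ (lam : ℝ) (v : V → ℝ), 0 < lam ∧ v ≠ 0 ∧ Matrix.mulVec (G.lapMatrix ℝ) v = lam • v := by
  set hL := G.isHermitian_lapMatrix ℝ
  have h1 : hL.eigenvalues ≠ 0 := by
    intro h
    have h0 := hL.eigenvalues_eq_zero_iff.1 h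
    obtain ⟨p, q, hpq⟩ := exists_pair_ne V
    have h2 := (G.lapMatrix_mulVec_eq_zero_iff_forall_reachable (x := Pi.single p 1)).1
      (by rw [h0, Matrix.zero_mulVec]) p q (hG.preconnected p q)
    simp [hpq.symm] at h2
  obtain ⟨k, hk⟩ := Function.ne_iff.1 h1
  refine ⟨hL.eigenvalues k, hL.eigenvectorBasis k,
    lt_of_le_of_ne ((G.posSemidef_lapMatrix ℝ).eigenvalues_nonneg k) (Ne.symm hk), fun h => ?_,
    hL.mulVec_eigenvectorBasis k⟩
  have := hL.eigenvectorBasis.orthonormal.ne_zero k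
  exact this (by ext p; exact congrFun h p)

theorem IsVersatile.exists_smul_eq {ρ : ℕ} {lam : ℝ} {v : V → ℝ} (h : IsVersatile G ρ lam v)
    {u : V → ℝ} (hu : Matrix.mulVec (G.lapMatrix ℝ) u = lam • u) : ∃ t : ℝ, u = t • v := by
  have hmem : ∀ u : V → ℝ, Matrix.mulVec (G.lapMatrix ℝ) u = lam • u →
      u ∈ Module.End.maxGenEigenspace (Matrix.toLin' (G.lapMatrix ℝ)) lam := fun u hu =>
    (Module.End.mem_maxGenEigenspace _ _ _).2 ⟨1, by simp [hu]⟩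
  obtain ⟨t, ht⟩ := (finrank_eq_one_iff_of_nonzero' (⟨v, hmem v h.eigenvector⟩ :
    Module.End.maxGenEigenspace (Matrix.toLin' (G.lapMatrix ℝ)) lam)
    (fun h0 => h.ne_zero (congrArg Subtype.val h0))).1 h.simple ⟨u, hmem u hu⟩
  exact ⟨t, (congrArg Subtype.val ht).symm⟩

variable (A) in
/-- The choice of the perturbed Jacobian and of the coupling matrix for a versatile graph: a small
multiple of the identity is added to both, which leaves the block for `lam` as it is and makes the
other blocks hyperbolic. -/
theorem exists_network_parameters {ρ : ℕ} {lam : ℝ} {v : V → ℝ} (h : IsVersatile G ρ lam v)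
    {m : ℕ} (x : Fin m → EuclideanSpace ℝ (Fin n))
    (hx_orth : ∀ i j, i ≠ j → inner ℝ (x i) (x j) = 0)
    (hx_pos : ∀ i, 0 < inner ℝ (x i) (A (x i))) {δ : ℝ} (hδ : 0 < δ) :
    ∃ A' D : EuclideanSpace ℝ (Fin n) →L[ℝ] EuclideanSpace ℝ (Fin n), ‖A' - A‖ < δ ∧
      IsPosDefOp D ∧
      Module.finrank ℝ (centerSubspace ((A' - (1 / lam * lam) • D :
        EuclideanSpace ℝ (Fin n) →L[ℝ] EuclideanSpace ℝ (Fin n)) :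
        Module.End ℝ (EuclideanSpace ℝ (Fin n)))) = m ∧
      (∀ w ∈ centerSubspace ((A' - (1 / lam * lam) • D :
        EuclideanSpace ℝ (Fin n) →L[ℝ] EuclideanSpace ℝ (Fin n)) :
        Module.End ℝ (EuclideanSpace ℝ (Fin n))), ((A' - (1 / lam * lam) • D) ^ m) w = 0) ∧
      ∀ X, X ∈ centerSubspace
          (networkJacobian G A' (1 / lam) D : Module.End ℝ (V → EuclideanSpace ℝ (Fin n))) ↔
        ∃ w ∈ centerSubspace ((A' - (1 / lam * lam) • D :
          EuclideanSpace ℝ (Fin n) →L[ℝ] EuclideanSpace ℝ (Fin n)) :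
          Module.End ℝ (EuclideanSpace ℝ (Fin n))), X = nodeLift v w := by
  obtain ⟨D, hD, hdim, hnil⟩ := exists_posDef_nilpotent_sub A x hx_orth hx_pos
  set hL := G.isHermitian_lapMatrix ℝ
  have hlam := h.pos_eigenvalue
  -- adding `ζ` to `A` and `D` shifts the block for the `k`-th eigenvalue by `ζ * (1 - θ k)`
  set θ : V → ℝ := fun k => 1 / lam * hL.eigenvalues k with hθ
  have hθ1 : ∀ k, hL.eigenvalues k ≠ lam → 1 - θ k ≠ 0 := fun k hk h0 => hk (by
    simp only [hθ] at h0
    field_simp at h0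
    linarith)
  -- the perturbations for which some block fails to be hyperbolic
  have hfin : (⋃ k, {s : ℝ | hL.eigenvalues k ≠ lam ∧
      centerSubspace (((A - θ k • D : EuclideanSpace ℝ (Fin n) →L[ℝ] EuclideanSpace ℝ (Fin n)) :
        Module.End ℝ (EuclideanSpace ℝ (Fin n))) + (s * (1 - θ k)) • 1) ≠ ⊥}).Finite := by
    refine Set.finite_iUnion fun k => ?_
    by_cases hk : hL.eigenvalues k = lam
    · simp [hk]
    · refine ((finite_setOf_centerSubspace_ne_bot
        ((A - θ k • D : EuclideanSpace ℝ (Fin n) →L[ℝ] EuclideanSpace ℝ (Fin n)) :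
          Module.End ℝ (EuclideanSpace ℝ (Fin n)))).preimage
        (f := fun s : ℝ => s * (1 - θ k)) (mul_left_injective₀ (hθ1 k hk)).injOn).subset ?_
      exact fun s hs => hs.2
  obtain ⟨ζ, ⟨hζ0, hζδ⟩, hζ⟩ := ((Set.Ioo_infinite hδ).sdiff hfin).nonempty
  simp only [Set.mem_iUnion, Set.mem_ofPred_eq, not_exists, not_and, not_not] at hζ
  set I := ContinuousLinearMap.id ℝ (EuclideanSpace ℝ (Fin n)) with hI
  have hT : A + ζ • I - (1 / lam * lam) • (D + ζ • I) = A - D := by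
    rw [one_div_mul_cancel hlam.ne', one_smul]
    abel
  refine ⟨A + ζ • I, D + ζ • I, ?_, fun y hy => ?_, ?_⟩
  · rw [add_sub_cancel_left, norm_smul, Real.norm_of_nonneg hζ0.le]
    refine lt_of_le_of_lt ?_ hζδ
    exact mul_le_of_le_one_right hζ0.le ContinuousLinearMap.norm_id_le
  · have h1 : inner ℝ y ((D + ζ • I) y) = inner ℝ y (D y) + ζ * ‖y‖ ^ 2 := by
      simp [hI, inner_add_right, inner_smul_right]
    rw [h1]
    have := hD y hy
    positivity
  · rw [hT]
    refine ⟨hdim, hnil, ?_⟩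
    have := mem_centerSubspace_networkJacobian (G := G) (A := A + ζ • I) (α := 1 / lam)
      (D := D + ζ • I) h.eigenvector (fun u hu => h.exists_smul_eq hu) (fun k hk => by
        rw [← hζ k hk]
        congr 1
        ext y : 1
        have h1 : 1 / lam * hL.eigenvalues k = θ k := rfl
        rw [h1]
        simp only [hI, ContinuousLinearMap.coe_coe, sub_apply, add_apply, smul_apply,
          LinearMap.add_apply, LinearMap.smul_apply, Module.End.one_apply, ContinuousLinearMap.id_apply]
        module)
    rwa [hT] at this

end NetworkSpectrum

/-! ### Homogeneous polynomials -/

section Homogeneous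

open Filter Asymptotics

variable {W W' : Type*} [NormedAddCommGroup W] [NormedSpace ℝ W]
  [NormedAddCommGroup W'] [NormedSpace ℝ W'] {l : ℕ}

theorem ContinuousMultilinearMap.contDiff_diag
    (M : ContinuousMultilinearMap ℝ (fun _ : Fin l => W) W') {n : WithTop ℕ∞} :
    ContDiff ℝ n fun w => M fun _ => w :=
  M.contDiff.comp (contDiff_pi.2 fun _ => contDiff_id)

theorem ContinuousMultilinearMap.diag_smul
    (M : ContinuousMultilinearMap ℝ (fun _ : Fin l => W) W') (s : ℝ) (w : W) :
    (M fun _ => s • w) = s ^ l • M fun _ => w := by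
  rw [M.map_smul_univ (fun _ => s) fun _ => w]
  simp

theorem ContinuousMultilinearMap.diag_isBigO
    (M : ContinuousMultilinearMap ℝ (fun _ : Fin l => W) W') :
    (fun w => M fun _ => w) =O[𝓝 0] fun w => ‖w‖ ^ l := by
  refine IsBigO.of_bound ‖M‖ (.of_forall fun w => ?_)
  rw [norm_pow, norm_norm]
  exact M.le_opNorm_mul_pow_of_le (pi_norm_const_le w)

theorem ContinuousMultilinearMap.diag_sub_diag_isLittleO {X : Type*}
    (M : ContinuousMultilinearMap ℝ (fun _ : Fin (l + 1) => W) W') {F : Filter X} {f g : X → W}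
    {w : X → ℝ} (hf : f =O[F] w) (hg : g =O[F] w) (hfg : (fun x => f x - g x) =o[F] w) :
    (fun x => (M fun _ => f x) - M fun _ => g x) =o[F] fun x => w x ^ (l + 1) := by
  have h1 : (fun x => (M fun _ => f x) - M fun _ => g x) =O[F]
      fun x => (‖f x‖ + ‖g x‖) ^ l * ‖f x - g x‖ := by
    refine IsBigO.of_bound (‖M‖ * (l + 1)) (.of_forall fun x => ?_)
    have h2 := M.norm_image_sub_le (fun _ => f x) (fun _ => g x)
    have h3 : ‖(fun _ : Fin (l + 1) => f x) - fun _ => g x‖ = ‖f x - g x‖ :=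
      pi_norm_const (ι := Fin (l + 1)) (f x - g x)
    rw [h3, pi_norm_const, pi_norm_const, Fintype.card_fin, Nat.add_sub_cancel] at h2
    refine h2.trans ?_
    rw [Real.norm_of_nonneg (by positivity), ← mul_assoc]
    push_cast
    gcongr
    exact max_le_add_of_nonneg (norm_nonneg _) (norm_nonneg _)
  refine h1.trans_isLittleO ?_
  simp only [pow_succ]
  exact ((hf.norm_left.add hg.norm_left).pow l).mul_isLittleO hfg.norm_left

theorem IsPolyMap.contDiff {p : W → W'} (hp : IsPolyMap l p) {n : WithTop ℕ∞} :
    ContDiff ℝ n p := by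
  obtain ⟨c, hc⟩ := hp
  rw [funext hc]
  exact ContDiff.sum fun j _ => (c j).contDiff_diag

theorem IsPolyMap.hasFDerivAt_zero {p : W → W'} (hp : IsPolyMap l p) :
    HasFDerivAt p (0 : W →L[ℝ] W') 0 := by
  obtain ⟨c, hc⟩ := hp
  rw [funext hc]
  refine (HasFDerivAt.fun_sum (u := Finset.Icc 2 l) (A := fun j w => c j fun _ => w)
    (A' := fun _ => 0) fun j hj => ?_).congr_fderiv (Finset.sum_const_zero)
  have h2 := (Finset.mem_Icc.1 hj).1
  refine .of_isLittleO ?_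
  have h0 : (c j fun _ => (0 : W)) = 0 := (c j).map_coord_zero (⟨0, by omega⟩ : Fin j) rfl
  simp only [h0, sub_zero, zero_apply]
  refine (c j).diag_isBigO.trans_isLittleO ?_
  have := isLittleO_norm_pow_id (E' := W) (n := j) (by omega)
  exact this

end Homogeneous

/-! ### Comparison of Taylor expansions -/

section TaylorComparison

open Filter Asymptotics

variable {E F : Type v} [NormedAddCommGroup E] [NormedSpace ℝ E] [NormedAddCommGroup F]
  [NormedSpace ℝ F]

/-- If the difference of two functions is, up to higher order, a homogeneous polynomial of degree
`l + 1`, then this polynomial is the difference of their terms of degree `l + 1`, and their terms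
of lower degree are equal. -/
theorem taylorTerms_succ_of_sub_isLittleO {l : ℕ} (hl : 1 ≤ l) {R R' : E → F}
    (hR : ContDiffAt ℝ (l + 1 : ℕ) R 0) (hR' : ContDiffAt ℝ (l + 1 : ℕ) R' 0)
    (M : ContinuousMultilinearMap ℝ (fun _ : Fin (l + 1) => E) F)
    (h : (fun w => R' w - R w - M fun _ => w) =o[𝓝 0] fun w => ‖w‖ ^ (l + 1)) (w : E) :
    taylorTerms (l + 1) R' w = taylorTerms l R w +
      ((((l + 1).factorial : ℝ)⁻¹ • iteratedFDeriv ℝ (l + 1) R 0 fun _ => w) + M fun _ => w) := by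
  set a : ℕ → F := fun m => ((m.factorial : ℝ)⁻¹ • iteratedFDeriv ℝ m R' 0 fun _ => w) -
    ((m.factorial : ℝ)⁻¹ • iteratedFDeriv ℝ m R 0 fun _ => w) -
    if m = l + 1 then (M fun _ => w) else 0 with ha
  have h1 : (fun s : ℝ => ∑ m ∈ Finset.range (l + 1 + 1), s ^ m • a m) =o[𝓝[>] 0]
      fun s => s ^ (l + 1) := by
    have h2 := ((hR.taylor_isLittleO.sub hR'.taylor_isLittleO).add h).ray w
    refine h2.congr_left fun s => ?_
    simp only [ContinuousMultilinearMap.diag_smul, ha, smul_sub, Finset.sum_sub_distrib,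
      smul_ite, smul_zero, Finset.sum_ite_eq', Finset.mem_range, lt_add_iff_pos_right,
      zero_lt_one, if_true]
    simp only [smul_comm (s ^ _) ((_ : ℝ)⁻¹)]
    abel
  have h2 := eq_zero_of_sum_pow_isLittleO h1
  have h3 := h2 (l + 1) le_rfl
  have h4 : taylorTerms l R' w = taylorTerms l R w := by
    refine Finset.sum_congr rfl fun m hm => ?_
    have h5 := (Finset.mem_Icc.1 hm).2
    have h6 := h2 m (by omega)
    rw [ha] at h6
    simp only [show m ≠ l + 1 by omega, if_false, sub_zero] at h6
    exact sub_eq_zero.1 h6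
  simp only [ha, if_true, sub_sub] at h3
  rw [← h4, ← sub_eq_zero.1 h3]
  exact Finset.sum_Icc_succ_top (by omega) _

/-- Taylor terms vanish in the directions of lines on which the function vanishes. -/
theorem iteratedFDeriv_eq_zero_of_eventually {l : ℕ} {R : E → F} (hR : ContDiffAt ℝ l R 0) {w : E}
    (h : ∀ᶠ s in 𝓝 (0 : ℝ), R (s • w) = 0) : (iteratedFDeriv ℝ l R 0 fun _ => w) = 0 := by
  have h1 := (hR.taylor_isLittleO.ray w).neg_left
  have h2 := eq_zero_of_sum_pow_isLittleO
    (a := fun m => (m.factorial : ℝ)⁻¹ • iteratedFDeriv ℝ m R 0 fun _ => w) (h1.congr' (by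
      filter_upwards [h.filter_mono nhdsWithin_le_nhds] with s hs
      simp only [hs, ContinuousMultilinearMap.diag_smul, zero_sub, neg_neg]
      simp only [smul_comm (s ^ _) ((_ : ℝ)⁻¹)]) .rfl) l le_rfl
  exact (smul_eq_zero.1 h2).resolve_left (by positivity)

/-- If a polynomial map vanishes on the line spanned by `w`, then so do its homogeneous terms. -/
theorem ContinuousMultilinearMap.diag_eq_zero_of_sum {ρ : ℕ}
    (c : (j : ℕ) → ContinuousMultilinearMap ℝ (fun _ : Fin j => E) F) {w : E}
    (h : ∀ s : ℝ, ∑ j ∈ Finset.Icc 2 ρ, c j (fun _ => s • w) = 0) {j : ℕ}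
    (hj : j ∈ Finset.Icc 2 ρ) : (c j fun _ => w) = 0 := by
  have h1 := eq_zero_of_sum_pow_isLittleO (n := ρ)
    (a := fun j => if 2 ≤ j then (c j fun _ => w) else 0) (by
      refine (isLittleO_zero _ _).congr_left fun s => ?_
      refine (h s).symm.trans ?_
      rw [← Finset.sum_subset (s₁ := Finset.Icc 2 ρ)
        (fun i hi => Finset.mem_range.2 (Nat.lt_succ_of_le (Finset.mem_Icc.1 hi).2))]
      · refine Finset.sum_congr rfl fun i hi => ?_
        rw [if_pos (Finset.mem_Icc.1 hi).1, ContinuousMultilinearMap.diag_smul]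
      · intro i hi hi'
        rw [Finset.mem_range] at hi
        rw [Finset.mem_Icc, not_and', not_le] at hi'
        rw [if_neg (not_le.2 (hi' (by omega))), smul_zero]) j (Finset.mem_Icc.1 hj).2
  simpa [(Finset.mem_Icc.1 hj).1] using h1

end TaylorComparison

/-! ### Parameterized center manifolds -/

section Parameterized

open Filter Asymptotics

variable {Z : Type v} [NormedAddCommGroup Z] [NormedSpace ℝ Z] {P : Type}
  [NormedAddCommGroup P] [NormedSpace ℝ P]

/-- A family of vector fields, defined and smooth near the origin, with an equilibrium at the
origin for all small parameters and the Jacobian `J` there for the parameter zero. -/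
structure IsEquilibriumFamily (H : Z × P → Z) (J : Z →L[ℝ] Z) : Prop where
  smooth : ∀ᶠ z in 𝓝 0, ContDiffAt ℝ ∞ H z
  equilibrium : ∀ᶠ e in 𝓝 0, H (0, e) = 0
  jacobian : HasFDerivAt (fun x => H (x, 0)) J 0

namespace IsEquilibriumFamily

variable {H : Z × P → Z} {J : Z →L[ℝ] Z}

theorem smoothAt (h : IsEquilibriumFamily H J) : ContDiffAt ℝ ∞ H 0 := h.smooth.self_of_nhds

/-- Since the origin is an equilibrium for all small parameters, the derivative with respect to
the parameter vanishes. -/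
theorem hasFDerivAt (h : IsEquilibriumFamily H J) :
    HasFDerivAt H (J.comp (ContinuousLinearMap.fst ℝ Z P)) 0 := by
  have h1 : HasFDerivAt H (fderiv ℝ H 0) ((0 : Z), (0 : P)) :=
    (h.smoothAt.differentiableAt (by simp)).hasFDerivAt
  have h2 : (fderiv ℝ H 0).comp (ContinuousLinearMap.inl ℝ Z P) = J :=
    (HasFDerivAt.comp (0 : Z) h1 (ContinuousLinearMap.inl ℝ Z P).hasFDerivAt).unique h.jacobian
  have h3 : (fderiv ℝ H 0).comp (ContinuousLinearMap.inr ℝ Z P) = 0 := by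
    refine (HasFDerivAt.comp (0 : P) h1 (ContinuousLinearMap.inr ℝ Z P).hasFDerivAt).unique ?_
    exact (hasFDerivAt_const (0 : Z) (0 : P)).congr_of_eventuallyEq h.equilibrium
  refine h1.congr_fderiv (ContinuousLinearMap.ext fun z => ?_)
  have h4 := congrArg (fun L => L z.1) h2
  have h5 := congrArg (fun L => L z.2) h3
  simp only [ContinuousLinearMap.comp_apply, ContinuousLinearMap.inl_apply,
    ContinuousLinearMap.inr_apply, zero_apply] at h4 h5
  have h6 : z = (z.1, 0) + (0, z.2) := by simp
  rw [ContinuousLinearMap.comp_apply, ContinuousLinearMap.coe_fst', ← h4]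
  nth_rewrite 1 [h6]
  rw [map_add, h5, add_zero]

theorem augmented_hasFDerivAt (h : IsEquilibriumFamily H J) :
    HasFDerivAt (augmented H) (augmentedLin P J) 0 :=
  (h.hasFDerivAt.prodMk (hasFDerivAt_const (0 : P) (0 : Z × P))).congr_fderiv
    (ContinuousLinearMap.ext fun _ => rfl)

theorem augmented_smooth (h : IsEquilibriumFamily H J) :
    ∀ᶠ z in 𝓝 0, ContDiffAt ℝ ∞ (augmented H) z :=
  h.smooth.mono fun _ hz => hz.prodMk contDiffAt_const

theorem exists_isParamCenterManifold [FiniteDimensional ℝ Z] [FiniteDimensional ℝ P]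
    (h : IsEquilibriumFamily H J) (k : ℕ) : ∃ Ψ, IsParamCenterManifold k H J Ψ :=
  exists_isLocalCenterManifold k h.augmented_smooth
    (Prod.ext h.equilibrium.self_of_nhds rfl) h.augmented_hasFDerivAt

end IsEquilibriumFamily

theorem fst_mem_hyperbolicSubspace {J : Z →L[ℝ] Z} {z : Z × P}
    (hz : z ∈ hyperbolicSubspace (augmentedLin P J : Module.End ℝ (Z × P))) :
    z.1 ∈ hyperbolicSubspace (J : Module.End ℝ Z) := by
  rw [← spectralSubspace_compl_singleton] at hz ⊢
  exact map_mem_spectralSubspace (LinearMap.fst ℝ Z P) (fun _ => rfl) _ hz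

/-- The map `centerPoint`, as a continuous linear map. -/
def centerPointL (J : Z →L[ℝ] Z) : centerSubspace (J : Module.End ℝ Z) × P →L[ℝ]
    centerSubspace (augmentedLin P J : Module.End ℝ (Z × P)) :=
  ContinuousLinearMap.codRestrict
    ((centerSubspace (J : Module.End ℝ Z)).subtypeL.prodMap (ContinuousLinearMap.id ℝ P)) _
    fun z => (centerPoint J z.1 z.2).2

theorem coe_centerPointL (J : Z →L[ℝ] Z) (z : centerSubspace (J : Module.End ℝ Z) × P) :
    (centerPointL J z : Z × P) = ((z.1 : Z), z.2) := rfl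

theorem centerPointL_isBigO (J : Z →L[ℝ] Z) :
    (fun z : centerSubspace (J : Module.End ℝ Z) × P => centerPointL J z) =O[𝓝 0]
      fun z => ‖z‖ :=
  (ContinuousLinearMap.isBigO_id _ _).norm_right

theorem centerPointL_tendsto (J : Z →L[ℝ] Z) :
    Tendsto (centerPointL J : centerSubspace (J : Module.End ℝ Z) × P → _) (𝓝 0) (𝓝 0) := by
  have := (centerPointL (P := P) J).continuous.tendsto 0
  rwa [map_zero] at this

variable [FiniteDimensional ℝ Z] [FiniteDimensional ℝ P] {H : Z × P → Z} {J : Z →L[ℝ] Z} {k : ℕ}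
  {Ψ : centerSubspace (augmentedLin P J : Module.End ℝ (Z × P)) →
    hyperbolicSubspace (augmentedLin P J : Module.End ℝ (Z × P))}

omit [FiniteDimensional ℝ P] in
theorem reducedField_apply (z : centerSubspace (J : Module.End ℝ Z) × P) :
    reducedField H J Ψ z =
      centerProjL J (H ((centerPointL J z : Z × P) + (Ψ (centerPointL J z) : Z × P))) := rfl

theorem IsParamCenterManifold.contDiffAt_reducedField (h : IsParamCenterManifold k H J Ψ)
    (hH : IsEquilibriumFamily H J) : ContDiffAt ℝ k (reducedField H J Ψ) 0 := by
  have h1 : ContDiffAt ℝ k (fun c : centerSubspace (augmentedLin P J : Module.End ℝ (Z × P)) =>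
      (c : Z × P) + Ψ c) 0 :=
    (Submodule.subtypeL _).contDiff.contDiffAt.add h.smooth_coe
  have h2 : ContDiffAt ℝ k H (((0 : centerSubspace (augmentedLin P J : Module.End ℝ (Z × P))) :
      Z × P) + Ψ 0) := by
    rw [h.through_zero]
    simpa using hH.smoothAt.of_le (by exact_mod_cast le_top)
  have h3 := h2.comp (0 : centerSubspace (augmentedLin P J : Module.End ℝ (Z × P))) h1
  rw [← map_zero (centerPointL (P := P) J)] at h3
  exact (centerProjL J).contDiff.contDiffAt.comp 0
    (h3.comp (0 : centerSubspace (J : Module.End ℝ Z) × P)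
      (centerPointL (P := P) J).contDiff.contDiffAt)

theorem IsParamCenterManifold.hasFDerivAt_reducedField (h : IsParamCenterManifold k H J Ψ)
    (hH : IsEquilibriumFamily H J) :
    HasFDerivAt (fun c => reducedField H J Ψ (c, 0))
      ((centerProjL J).comp (J.comp (centerSubspace (J : Module.End ℝ Z)).subtypeL)) 0 := by
  have h1 : HasFDerivAt (fun c : centerSubspace (augmentedLin P J : Module.End ℝ (Z × P)) =>
      (c : Z × P) + Ψ c)
      ((centerSubspace (augmentedLin P J : Module.End ℝ (Z × P))).subtypeL + 0) 0 :=
    (Submodule.subtypeL _).hasFDerivAt.add h.hasFDerivAt_coe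
  have h2 : HasFDerivAt H (J.comp (ContinuousLinearMap.fst ℝ Z P))
      (((0 : centerSubspace (augmentedLin P J : Module.End ℝ (Z × P))) : Z × P) + Ψ 0) := by
    rw [h.through_zero]
    simpa using hH.hasFDerivAt
  have h3 := h2.comp (0 : centerSubspace (augmentedLin P J : Module.End ℝ (Z × P))) h1
  have h4 : (0 : centerSubspace (augmentedLin P J : Module.End ℝ (Z × P))) =
    (centerPointL (P := P) J).comp (ContinuousLinearMap.inl ℝ _ P) 0 := (map_zero _).symm
  rw [h4] at h3
  exact ((centerProjL J).hasFDerivAt.comp (0 : centerSubspace (J : Module.End ℝ Z))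
    (h3.comp (0 : centerSubspace (J : Module.End ℝ Z))
      ((centerPointL (P := P) J).comp
        (ContinuousLinearMap.inl ℝ _ P)).hasFDerivAt)).congr_fderiv
    (ContinuousLinearMap.ext fun c => by simp [coe_centerPointL])

/-- The equilibria `(0, ε)` are solutions that stay near the origin, so they lie on the center
manifold. -/
theorem IsParamCenterManifold.eventually_reducedField_eq_zero (h : IsParamCenterManifold k H J Ψ)
    (hH : IsEquilibriumFamily H J) :
    ∀ᶠ e in 𝓝 (0 : P), reducedField H J Ψ (0, e) = 0 := by
  obtain ⟨O, hO, hc⟩ := h.contains_bounded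
  have h1 : Tendsto (fun e : P => ((0 : Z), e)) (𝓝 0) (𝓝 0) :=
    (Continuous.prodMk_right (0 : Z)).tendsto' _ _ rfl
  filter_upwards [hH.equilibrium, h1.eventually_mem hO] with e he heO
  have h2 : IsIntegralCurve (fun _ : ℝ => ((0 : Z), e)) (fun _ => augmented H) := fun t => by
    have : augmented H ((0 : Z), e) = 0 := Prod.ext he rfl
    change HasDerivAt _ (augmented H ((0 : Z), e)) t
    rw [this]
    exact hasDerivAt_const t _
  obtain ⟨c, hc'⟩ := hc _ h2 (fun _ => heO) 0
  have h3 : (Ψ c : Z × P) ∈ centerSubspace (augmentedLin P J : Module.End ℝ (Z × P)) := by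
    rw [← add_sub_cancel_left (c : Z × P) (Ψ c), ← hc']
    exact Submodule.sub_mem _ (centerPointL J (0, e)).2 c.2
  have h4 : (Ψ c : Z × P) = 0 := Submodule.disjoint_def.1
    (isCompl_center_hyperbolic (augmentedLin P J : Module.End ℝ (Z × P))).disjoint _ h3 (Ψ c).2
  rw [h4, add_zero] at hc'
  have h5 : centerPointL J ((0 : centerSubspace (J : Module.End ℝ Z)), e) = c :=
    Subtype.ext hc'
  rw [reducedField_apply, h5, h4, add_zero, ← hc', he, map_zero]

/-- The first-order effect of a perturbation: if homogeneous terms `M` of degree `l + 1` are added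
to the vector field, then the reduced vector field changes by the center component of `M`, up to
terms of higher order. -/
theorem IsParamCenterManifold.reducedField_sub_isLittleO {k' l : ℕ} {H' : Z × P → Z}
    {Ψ' : centerSubspace (augmentedLin P J : Module.End ℝ (Z × P)) →
      hyperbolicSubspace (augmentedLin P J : Module.End ℝ (Z × P))}
    (h : IsParamCenterManifold k H J Ψ) (h' : IsParamCenterManifold k' H' J Ψ')
    (hH : IsEquilibriumFamily H J) (hH' : IsEquilibriumFamily H' J) (hl : 1 ≤ l) (hlk : l ≤ k)
    (hlk' : l ≤ k') (M : ContinuousMultilinearMap ℝ (fun _ : Fin (l + 1) => Z × P) Z)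
    (hM : ∀ z, H' z = H z + M fun _ => z) :
    (fun z => reducedField H' J Ψ' z - reducedField H J Ψ z -
      centerProjL J (M fun _ => ((z.1 : Z), z.2))) =o[𝓝 0] fun z => ‖z‖ ^ (l + 1) := by
  have h2 : (2 : WithTop ℕ∞) ≤ ∞ := ENat.LEInfty.out
  -- By uniqueness of the Taylor expansion the center manifolds differ by `o(‖c‖ ^ l)`. Linear terms do
  -- not see the difference, as it is hyperbolic, and in the nonlinear terms it gains one order.
  have hΨ : (fun c => (Ψ' c : Z × P) - (Ψ c : Z × P)) =o[𝓝 0] fun c => ‖c‖ ^ l := by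
    refine IsLocalCenterManifold.sub_isLittleO h h' (by omega) (by omega) hlk hlk'
      (hH.augmented_smooth.self_of_nhds.of_le h2) (hH'.augmented_smooth.self_of_nhds.of_le h2) ?_
    have h3 : ∀ z, augmented H' z - augmented H z = (M fun _ => z, (0 : P)) := fun z => by
      simp [augmented, hM]
    simp only [h3]
    exact M.diag_isBigO.prod_left (isBigO_zero _ _)
  -- the nonlinear part of the perturbed vector field
  set N : Z × P → Z := fun z => H' z - J z.1 with hN
  have hN2 : ContDiffAt ℝ 2 N 0 := (hH'.smoothAt.of_le h2).sub
    (J.comp (ContinuousLinearMap.fst ℝ Z P)).contDiff.contDiffAt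
  have hN0 : fderiv ℝ N 0 = 0 := by
    have := hH'.hasFDerivAt.sub (J.comp (ContinuousLinearMap.fst ℝ Z P)).hasFDerivAt
    rw [sub_self] at this
    exact this.fderiv
  have h3 : (fun c : centerSubspace (augmentedLin P J : Module.End ℝ (Z × P)) =>
      ‖‖c‖‖ * ‖(c : Z × P) + Ψ' c - (c + Ψ c)‖) =o[𝓝 0] fun c => ‖c‖ ^ (l + 1) := by
    simp only [norm_norm, add_sub_add_left_eq_sub, pow_succ']
    exact (isBigO_refl _ _).mul_isLittleO hΨ.norm_left
  have h4 := (hN2.isBigO_comp_sub_comp hN0 h'.isBigO_graph h.isBigO_graph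
    (tendsto_norm_zero)).trans_isLittleO h3
  have h5 := M.diag_sub_diag_isLittleO h.isBigO_graph
    (g := fun c : centerSubspace (augmentedLin P J : Module.End ℝ (Z × P)) => (c : Z × P))
    (w := fun c => ‖c‖) (IsBigO.of_bound 1 (.of_forall fun c => by simp)) (by
      simp only [add_sub_cancel_left]
      have := h.hasFDerivAt_coe.isLittleO
      simpa [h.through_zero] using this.norm_right)
  have h6 := (((centerProjL J).isBigO_comp _ _).trans_isLittleO (h4.add h5)).comp_tendsto
    (centerPointL_tendsto J)
  refine (h6.trans_isBigO ((centerPointL_isBigO J).norm_left.pow (l + 1))).congr_left fun z => ?_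
  simp only [Function.comp_apply, reducedField_apply, hN, ← coe_centerPointL]
  set c := centerPointL J z
  have h7 : centerProjL J (J (Ψ' c : Z × P).1) = 0 := centerProjL_of_mem_hyperbolic J
    (map_mem_hyperbolicSubspace J (fst_mem_hyperbolicSubspace (Ψ' c).2))
  have h8 : centerProjL J (J (Ψ c : Z × P).1) = 0 := centerProjL_of_mem_hyperbolic J
    (map_mem_hyperbolicSubspace J (fst_mem_hyperbolicSubspace (Ψ c).2))
  simp only [map_add, map_sub, Prod.fst_add, h7, h8, hM ((c : Z × P) + Ψ c)]
  abel

end Parameterized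

/-! ### Node families and the network vector field -/

section NodeFamilies

open Filter

variable {V : Type*} [Fintype V] [DecidableEq V] (G : SimpleGraph V) [DecidableRel G.Adj] {n d : ℕ}
  {U : Set (EuclideanSpace ℝ (Fin n))} {Ω : Set (EuclideanSpace ℝ (Fin d))}
  {f q : EuclideanSpace ℝ (Fin n) × EuclideanSpace ℝ (Fin d) → EuclideanSpace ℝ (Fin n)}
  {A : EuclideanSpace ℝ (Fin n) →L[ℝ] EuclideanSpace ℝ (Fin n)}

theorem IsNodeFamily.isEquilibriumFamily (hf : IsNodeFamily U Ω f A) (α : ℝ)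
    (D : EuclideanSpace ℝ (Fin n) →L[ℝ] EuclideanSpace ℝ (Fin n)) :
    IsEquilibriumFamily (networkField G f α D) (networkJacobian G A α D) where
  smooth := by
    have hcoord : ∀ p : V, Continuous
        fun z : (V → EuclideanSpace ℝ (Fin n)) × EuclideanSpace ℝ (Fin d) => (z.1 p, z.2) :=
      fun p => by fun_prop
    have h1 : ∀ᶠ z : (V → EuclideanSpace ℝ (Fin n)) × EuclideanSpace ℝ (Fin d) in 𝓝 0,
        ∀ p, (z.1 p, z.2) ∈ U ×ˢ Ω := by
      refine eventually_all.2 fun p => (hcoord p).continuousAt.eventually_mem ?_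
      exact (hf.isOpen_state.prod hf.isOpen_param).mem_nhds ⟨hf.zero_mem_state, hf.zero_mem_param⟩
    filter_upwards [h1] with z hz
    refine contDiffAt_pi.2 fun p => ContDiffAt.sub ?_ (by fun_prop)
    have h2 : ContDiffAt ℝ ∞ f (z.1 p, z.2) :=
      hf.smooth.contDiffAt ((hf.isOpen_state.prod hf.isOpen_param).mem_nhds (hz p))
    exact h2.comp z (by fun_prop)
  equilibrium := by
    filter_upwards [hf.isOpen_param.mem_nhds hf.zero_mem_param] with e he
    funext p
    simp [networkField, hf.equilibrium e he]
  jacobian := by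
    refine hasFDerivAt_pi.2 fun p => ?_
    refine (HasFDerivAt.comp (0 : V → EuclideanSpace ℝ (Fin n)) (hf.jacobian)
      (ContinuousLinearMap.proj (R := ℝ) (φ := fun _ : V => EuclideanSpace ℝ (Fin n))
        p).hasFDerivAt).sub ?_
    have h1 := (α • ∑ j, G.lapMatrix ℝ p j • D.comp (ContinuousLinearMap.proj (R := ℝ)
      (φ := fun _ : V => EuclideanSpace ℝ (Fin n)) j)).hasFDerivAt (x := 0)
    refine h1.congr_of_eventuallyEq (.of_forall fun X => ?_)
    simp [sum_apply]

theorem IsNodeFamily.add_isPolyMap (hf : IsNodeFamily U Ω f A) {ρ : ℕ} (hq : IsPolyMap ρ q)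
    (hq0 : ∀ e, q (0, e) = 0) : IsNodeFamily U Ω (f + q) A where
  isOpen_state := hf.isOpen_state
  zero_mem_state := hf.zero_mem_state
  isOpen_param := hf.isOpen_param
  zero_mem_param := hf.zero_mem_param
  smooth := hf.smooth.add hq.contDiff.contDiffOn
  equilibrium e he := by rw [Pi.add_apply, hf.equilibrium e he, hq0, add_zero]
  jacobian := by
    have h1 : HasFDerivAt q
        (0 : EuclideanSpace ℝ (Fin n) × EuclideanSpace ℝ (Fin d) →L[ℝ] EuclideanSpace ℝ (Fin n))
        (ContinuousLinearMap.inl ℝ (EuclideanSpace ℝ (Fin n)) (EuclideanSpace ℝ (Fin d)) 0) := by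
      rw [map_zero]
      exact hq.hasFDerivAt_zero
    have h2 := hf.jacobian.add (HasFDerivAt.comp (0 : EuclideanSpace ℝ (Fin n)) h1 (ContinuousLinearMap.inl ℝ
      (EuclideanSpace ℝ (Fin n)) (EuclideanSpace ℝ (Fin d))).hasFDerivAt)
    rw [ContinuousLinearMap.zero_comp, add_zero] at h2
    exact h2

theorem networkField_add (α : ℝ) (D : EuclideanSpace ℝ (Fin n) →L[ℝ] EuclideanSpace ℝ (Fin n))
    (z : (V → EuclideanSpace ℝ (Fin n)) × EuclideanSpace ℝ (Fin d)) :
    networkField G (f + q) α D z = networkField G f α D z + fun p => q (z.1 p, z.2) := by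
  funext p
  simp only [networkField, Pi.add_apply]
  abel

theorem IsPolyMap.add_homogeneous {W W' : Type*} [NormedAddCommGroup W] [NormedSpace ℝ W]
    [NormedAddCommGroup W'] [NormedSpace ℝ W'] {l : ℕ} (hl : 1 ≤ l) {p : W → W'}
    (hp : IsPolyMap l p) (M : ContinuousMultilinearMap ℝ (fun _ : Fin (l + 1) => W) W') :
    IsPolyMap (l + 1) (p + fun w => M fun _ => w) := by
  obtain ⟨c, hc⟩ := hp
  refine ⟨Function.update c (l + 1) M, fun w => ?_⟩
  rw [Finset.sum_Icc_succ_top (by omega), Function.update_self, Pi.add_apply, hc]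
  congr 1
  refine Finset.sum_congr rfl fun j hj => ?_
  rw [Function.update_of_ne (by have := (Finset.mem_Icc.1 hj).2; omega)]

end NodeFamilies

/-! ### Prescribing the reduced vector field -/

section Prescription

open Filter Asymptotics

variable {V : Type*} [Fintype V] [DecidableEq V] {G : SimpleGraph V} [DecidableRel G.Adj] {n d : ℕ}
  {U : Set (EuclideanSpace ℝ (Fin n))} {Ω : Set (EuclideanSpace ℝ (Fin d))}
  {f : EuclideanSpace ℝ (Fin n) × EuclideanSpace ℝ (Fin d) → EuclideanSpace ℝ (Fin n)}
  {A D : EuclideanSpace ℝ (Fin n) →L[ℝ] EuclideanSpace ℝ (Fin n)} {α lam : ℝ} {v : V → ℝ} {ρ : ℕ}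

/-- The center component of a network state is determined by its sum weighted with `v`. -/
theorem centerProjL_networkJacobian_eq (hv0 : v ≠ 0)
    (hv : Matrix.mulVec (G.lapMatrix ℝ) v = lam • v)
    (hc : ∀ X, X ∈ centerSubspace
          (networkJacobian G A α D : Module.End ℝ (V → EuclideanSpace ℝ (Fin n))) ↔
        ∃ w ∈ centerSubspace ((A - (α * lam) • D :
          EuclideanSpace ℝ (Fin n) →L[ℝ] EuclideanSpace ℝ (Fin n)) :
          Module.End ℝ (EuclideanSpace ℝ (Fin n))), X = nodeLift v w)
    {X : V → EuclideanSpace ℝ (Fin n)} (Y : centerSubspace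
      (networkJacobian G A α D : Module.End ℝ (V → EuclideanSpace ℝ (Fin n))))
    (h : nodeSum v X = nodeSum v (Y : V → EuclideanSpace ℝ (Fin n))) :
    centerProjL (networkJacobian G A α D) X = Y := by
  set C := centerProjL (networkJacobian G A α D) X with hC
  have h1 : nodeSum v (X - (C : V → EuclideanSpace ℝ (Fin n))) ∈ hyperbolicSubspace ((A - (α * lam) • D :
      EuclideanSpace ℝ (Fin n) →L[ℝ] EuclideanSpace ℝ (Fin n)) :
      Module.End ℝ (EuclideanSpace ℝ (Fin n))) := by
    have h2 := sub_centerProjL_mem (networkJacobian G A α D) X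
    rw [← spectralSubspace_compl_singleton] at h2 ⊢
    exact map_mem_spectralSubspace (nodeSum v).toLinearMap
      (nodeSum_networkJacobian A α D hv) _ h2
  obtain ⟨w, hw, hYC⟩ := (hc _).1 (Y - C).2
  have h2 : nodeSum v (X - (C : V → EuclideanSpace ℝ (Fin n))) = (∑ p, v p * v p) • w := by
    rw [← nodeSum_nodeLift, ← hYC, Submodule.coe_sub, map_sub, map_sub, h]
  have h3 : (∑ p, v p * v p) • w = 0 :=
    Submodule.disjoint_def.1 (isCompl_center_hyperbolic ((A - (α * lam) • D :
      EuclideanSpace ℝ (Fin n) →L[ℝ] EuclideanSpace ℝ (Fin n)) :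
      Module.End ℝ (EuclideanSpace ℝ (Fin n)))).disjoint _ (Submodule.smul_mem _ _ hw) (h2 ▸ h1)
  have h4 : ∑ p, v p * v p ≠ 0 := fun h0 => hv0 (funext fun p => mul_self_eq_zero.1
    ((Finset.sum_eq_zero_iff_of_nonneg fun p _ => mul_self_nonneg (v p)).1 h0 p (Finset.mem_univ p)))
  rw [(smul_eq_zero.1 h3).resolve_left h4, map_zero] at hYC
  exact (sub_eq_zero.1 (Subtype.ext hYC)).symm

omit [DecidableEq V] in
/-- Homogeneous terms of degree `j` of the node dynamics can be chosen such that their weighted sum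
over the nodes is prescribed at the states with `τ (X p) = v p • x`. The part of degree `i` in the
state enters the sum with the factor `∑ p, v p ^ (i + 1)`. -/
theorem exists_multilinear_sum_smul_eq {Y C P : Type*} [NormedAddCommGroup Y] [NormedSpace ℝ Y]
    [NormedAddCommGroup C] [NormedSpace ℝ C] [NormedAddCommGroup P] [NormedSpace ℝ P] {j : ℕ}
    (hv : ∀ i : ℕ, 2 ≤ i → i ≤ j + 1 → ∑ p, v p ^ i ≠ 0) (τ : Y →L[ℝ] C) (κ : C →L[ℝ] Y)
    (M : ContinuousMultilinearMap ℝ (fun _ : Fin j => C × P) C)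
    (hM : ∀ e, (M fun _ => (0, e)) = 0) :
    ∃ c : ContinuousMultilinearMap ℝ (fun _ : Fin j => Y × P) Y, (∀ e, (c fun _ => (0, e)) = 0) ∧
      ∀ (x : C) (X : V → Y) (e : P), (∀ p, τ (X p) = v p • x) →
        ∑ p, v p • (c fun _ => (X p, e)) = κ (M fun _ => (x, e)) := by
  set a : Y × P →L[ℝ] C × P :=
    (ContinuousLinearMap.inl ℝ C P).comp (τ.comp (ContinuousLinearMap.fst ℝ Y P)) with ha
  set b : Y × P →L[ℝ] C × P :=
    (ContinuousLinearMap.inr ℝ C P).comp (ContinuousLinearMap.snd ℝ Y P) with hb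
  -- the part of the new term in which the state is inserted at the places in `s`
  set t : Finset (Fin j) → ContinuousMultilinearMap ℝ (fun _ : Fin j => Y × P) Y := fun s =>
    κ.compContinuousMultilinearMap (M.compContinuousLinearMap fun i => if i ∈ s then a else b)
    with ht
  have htapp : ∀ s z, (t s fun _ => z) = κ (M fun i => (if i ∈ s then a else b) z) :=
    fun s z => rfl
  refine ⟨∑ s ∈ Finset.univ.erase ∅, (∑ p, v p ^ (s.card + 1))⁻¹ • t s, fun e => ?_,
    fun x X e hX => ?_⟩
  · rw [sum_apply]
    refine Finset.sum_eq_zero fun s hs => ?_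
    obtain ⟨i, hi⟩ := Finset.nonempty_iff_ne_empty.2 (Finset.ne_of_mem_erase hs)
    rw [smul_apply, htapp, M.map_coord_zero i (by simp [hi, ha]), map_zero, smul_zero]
  · set m : Finset (Fin j) → Fin j → C × P := fun s =>
      s.piecewise (fun _ => (x, 0)) fun _ => (0, e) with hm
    have h1 : ∀ s p, (t s fun _ => (X p, e)) = v p ^ s.card • κ (M (m s)) := by
      intro s p
      have h2 : (fun i => (if i ∈ s then a else b) (X p, e)) =
          s.piecewise (fun i => v p • m s i) (m s) := by
        funext i
        by_cases hi : i ∈ s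
        · simp [hi, hm, ha, hX]
        · simp [hi, hm, hb]
      rw [htapp, h2, M.map_piecewise_smul (fun _ => v p), Finset.prod_const, map_smul]
    have h2 : (M fun _ => (x, e)) = ∑ s ∈ Finset.univ.erase ∅, M (m s) := by
      rw [Finset.sum_erase _ (by simpa [hm] using hM e), ← M.map_add_univ]
      congr 1
      funext i
      simp
    rw [h2, map_sum]
    simp only [sum_apply, smul_apply, h1, Finset.smul_sum]
    rw [Finset.sum_comm]
    refine Finset.sum_congr rfl fun s hs => ?_
    have h3 : s.card ≤ j := by simpa using s.card_le_univ
    have h4 : 0 < s.card :=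
      Finset.card_pos.2 (Finset.nonempty_iff_ne_empty.2 (Finset.ne_of_mem_erase hs))
    have h5 := hv (s.card + 1) (by omega) (by omega)
    simp only [smul_smul, ← Finset.sum_smul]
    convert one_smul ℝ _
    rw [← inv_mul_cancel₀ h5, Finset.mul_sum]
    exact Finset.sum_congr rfl fun p _ => by ring

/-- Every homogeneous term on the center subspace is the center component of a homogeneous term of
the node dynamics. -/
theorem IsVersatile.exists_node_multilinear (h : IsVersatile G ρ lam v)
    (hc : ∀ X, X ∈ centerSubspace
          (networkJacobian G A α D : Module.End ℝ (V → EuclideanSpace ℝ (Fin n))) ↔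
        ∃ w ∈ centerSubspace ((A - (α * lam) • D :
          EuclideanSpace ℝ (Fin n) →L[ℝ] EuclideanSpace ℝ (Fin n)) :
          Module.End ℝ (EuclideanSpace ℝ (Fin n))), X = nodeLift v w) {j : ℕ} (hj : j ≤ ρ)
    (M : ContinuousMultilinearMap ℝ (fun _ : Fin j => centerSubspace
        (networkJacobian G A α D : Module.End ℝ (V → EuclideanSpace ℝ (Fin n))) ×
          EuclideanSpace ℝ (Fin d))
      (centerSubspace (networkJacobian G A α D : Module.End ℝ (V → EuclideanSpace ℝ (Fin n)))))
    (hM : ∀ e, (M fun _ => (0, e)) = 0) :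
    ∃ c : ContinuousMultilinearMap ℝ
        (fun _ : Fin j => EuclideanSpace ℝ (Fin n) × EuclideanSpace ℝ (Fin d))
        (EuclideanSpace ℝ (Fin n)), (∀ e, (c fun _ => (0, e)) = 0) ∧
      ∀ (x : centerSubspace
          (networkJacobian G A α D : Module.End ℝ (V → EuclideanSpace ℝ (Fin n)))) e,
        (centerProjL (networkJacobian G A α D)
          fun p => c fun _ => ((x : V → EuclideanSpace ℝ (Fin n)) p, e)) = M fun _ => (x, e) := by
  obtain ⟨c, hc0, hcM⟩ := exists_multilinear_sum_smul_eq
    (fun i h2 hi => h.power_sums i h2 (by omega))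
    ((centerProjL (networkJacobian G A α D)).comp (nodeLift v))
    ((nodeSum v).comp (Submodule.subtypeL _)) M hM
  refine ⟨c, hc0, fun x e => ?_⟩
  refine centerProjL_networkJacobian_eq h.ne_zero h.eigenvector hc _ ?_
  rw [nodeSum_apply]
  refine hcM x x e fun p => ?_
  obtain ⟨w, hw, hx⟩ := (hc x).1 x.2
  rw [hx, nodeLift_apply, map_smul, ContinuousLinearMap.comp_apply, ← hx, centerProjL_coe]

/-- The prescription of the Taylor coefficients degree by degree: terms of degree `l + 1` of the
node dynamics do not influence the terms of the reduced vector field of degree up to `l`, and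
influence those of degree `l + 1` through their center component. -/
theorem IsVersatile.exists_taylorTerms_eq (h : IsVersatile G ρ lam v)
    (hc : ∀ X, X ∈ centerSubspace
          (networkJacobian G A α D : Module.End ℝ (V → EuclideanSpace ℝ (Fin n))) ↔
        ∃ w ∈ centerSubspace ((A - (α * lam) • D :
          EuclideanSpace ℝ (Fin n) →L[ℝ] EuclideanSpace ℝ (Fin n)) :
          Module.End ℝ (EuclideanSpace ℝ (Fin n))), X = nodeLift v w)
    (hf : IsNodeFamily U Ω f A)
    (c : (j : ℕ) → ContinuousMultilinearMap ℝ (fun _ : Fin j => centerSubspace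
        (networkJacobian G A α D : Module.End ℝ (V → EuclideanSpace ℝ (Fin n))) ×
          EuclideanSpace ℝ (Fin d))
      (centerSubspace (networkJacobian G A α D : Module.End ℝ (V → EuclideanSpace ℝ (Fin n)))))
    (hc0 : ∀ j ∈ Finset.Icc 2 ρ, ∀ e, (c j fun _ => (0, e)) = 0) {l : ℕ} (hl : 1 ≤ l)
    (hlρ : l ≤ ρ) :
    ∃ q : EuclideanSpace ℝ (Fin n) × EuclideanSpace ℝ (Fin d) → EuclideanSpace ℝ (Fin n),
      IsPolyMap l q ∧ (∀ e, q (0, e) = 0) ∧ ∀ k : ℕ, ρ ≤ k → ∀ Ψ,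
        IsParamCenterManifold k (networkField G (f + q) α D) (networkJacobian G A α D) Ψ →
        ∀ w, taylorTerms l (reducedField (networkField G (f + q) α D)
          (networkJacobian G A α D) Ψ) w = ∑ j ∈ Finset.Icc 2 l, c j fun _ => w := by
  induction l, hl using Nat.le_induction with
  | base => exact ⟨0, ⟨0, fun w => by simp⟩, fun e => rfl, fun k hk Ψ hΨ w => by simp [taylorTerms]⟩
  | succ l hl ih =>
    obtain ⟨q, hq, hq0, hqk⟩ := ih (by omega)
    have hfq := hf.add_isPolyMap hq hq0
    have hH := hfq.isEquilibriumFamily G α D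
    -- the defect in degree `l + 1` is measured on one center manifold of the system found so far
    obtain ⟨Ψ₀, hΨ₀⟩ := hH.exists_isParamCenterManifold ρ
    set R₀ := reducedField (networkField G (f + q) α D) (networkJacobian G A α D) Ψ₀ with hR₀
    have hR₀s : ContDiffAt ℝ (l + 1 : ℕ) R₀ 0 :=
      (hΨ₀.contDiffAt_reducedField hH).of_le (by exact_mod_cast hlρ)
    obtain ⟨M, hM0, hM⟩ := h.exists_node_multilinear hc hlρ
      (c (l + 1) - ((l + 1).factorial : ℝ)⁻¹ • iteratedFDeriv ℝ (l + 1) R₀ 0) (fun e => by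
        have h1 : Tendsto (fun s : ℝ => s • e) (𝓝 0) (𝓝 0) :=
          (continuous_id.smul continuous_const).tendsto' _ _ (zero_smul ℝ e)
        have h2 := iteratedFDeriv_eq_zero_of_eventually hR₀s (w := (0, e))
          ((h1.eventually (hΨ₀.eventually_reducedField_eq_zero hH)).mono fun s hs => by
            simpa using hs)
        rw [sub_apply, smul_apply, h2, hc0 _ (Finset.mem_Icc.2 ⟨by omega, hlρ⟩), smul_zero,
          sub_zero])
    have hq' : IsPolyMap (l + 1) (q + fun z => M fun _ => z) := hq.add_homogeneous hl M
    have hq0' : ∀ e, (q + fun z => M fun _ => z) (0, e) = 0 := fun e => by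
      rw [Pi.add_apply, hq0, hM0, add_zero]
    refine ⟨_, hq', hq0', fun k hk Ψ hΨ w => ?_⟩
    have hH' := (hf.add_isPolyMap hq' hq0').isEquilibriumFamily G α D
    have h1 := hΨ₀.reducedField_sub_isLittleO hΨ hH hH' hl (by omega) (by omega)
      (ContinuousMultilinearMap.pi fun p => M.compContinuousLinearMap fun _ =>
        ((ContinuousLinearMap.proj p).comp (ContinuousLinearMap.fst ℝ _ _)).prod
          (ContinuousLinearMap.snd ℝ _ _)) (fun z => by
        rw [← add_assoc, networkField_add]
        rfl)
    have h2 := taylorTerms_succ_of_sub_isLittleO hl hR₀s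
      ((hΨ.contDiffAt_reducedField hH').of_le (by exact_mod_cast hlρ.trans hk)) _
      (h1.congr_left fun z => by
        have := hM z.1 z.2
        rw [← this]
        rfl) w
    rw [h2, hqk ρ le_rfl Ψ₀ hΨ₀, Finset.sum_Icc_succ_top (by omega), sub_apply, smul_apply,
      add_sub_cancel]

end Prescription

/-! ### Center manifolds of networks -/

/-- The restriction of `J` to the center subspace is nilpotent if `J` is nilpotent there. -/
theorem isNilpotent_centerProjL_comp {Z : Type*} [NormedAddCommGroup Z] [NormedSpace ℝ Z]
    [FiniteDimensional ℝ Z] {J : Z →L[ℝ] Z} {m : ℕ}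
    (h : ∀ x ∈ centerSubspace (J : Module.End ℝ Z), (J ^ m) x = 0) :
    IsNilpotent
      ((centerProjL J).comp (J.comp (centerSubspace (J : Module.End ℝ Z)).subtypeL)) := by
  refine ⟨m, ContinuousLinearMap.ext fun x => Subtype.ext ?_⟩
  have h1 : ∀ i : ℕ, ((((centerProjL J).comp
      (J.comp (centerSubspace (J : Module.End ℝ Z)).subtypeL)) ^ i) x : Z) = (J ^ i) x := by
    intro i
    induction i with
    | zero => rfl
    | succ i ih =>
      rw [pow_succ', pow_succ', mul_apply_eq_comp, mul_apply_eq_comp, ← ih]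
      exact (centerProjL_map J _).trans (congrArg (fun c : centerSubspace (J : Module.End ℝ Z) => J c)
        (centerProjL_coe J _))
  exact (h1 m).trans (h x x.2)

theorem theorem2p1 {V : Type*} [Fintype V] [DecidableEq V] [Nontrivial V]
    (G : SimpleGraph V) [DecidableRel G.Adj] (hG : G.Connected) (n d m : ℕ)
    (A : EuclideanSpace ℝ (Fin n) →L[ℝ] EuclideanSpace ℝ (Fin n))
    (x : Fin m → EuclideanSpace ℝ (Fin n))
    (hx_orth : ∀ i j, i ≠ j → inner ℝ (x i) (x j) = 0)
    (hx_pos : ∀ i, 0 < inner ℝ (x i) (A (x i))) :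
    -- a parameterized center manifold of dimension at least `m`
    (∃ (D : EuclideanSpace ℝ (Fin n) →L[ℝ] EuclideanSpace ℝ (Fin n)) (α : ℝ),
      IsPosDefOp D ∧ 0 < α ∧
      m ≤ Module.finrank ℝ (centerSubspace
        (networkJacobian G A α D : Module.End ℝ (V → EuclideanSpace ℝ (Fin n)))) ∧
      ∀ (U : Set (EuclideanSpace ℝ (Fin n))) (Ω : Set (EuclideanSpace ℝ (Fin d)))
        (f : EuclideanSpace ℝ (Fin n) × EuclideanSpace ℝ (Fin d) → EuclideanSpace ℝ (Fin n)),
        IsNodeFamily U Ω f A → ∀ k : ℕ, 1 ≤ k →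
        ∃ Ψ, IsParamCenterManifold k (networkField G f α D) (networkJacobian G A α D) Ψ) ∧
    -- versatile graphs
    (∀ (ρ : ℕ) (lam : ℝ) (v : V → ℝ), IsVersatile G ρ lam v → ∀ δ : ℝ, 0 < δ →
      ∃ A' : EuclideanSpace ℝ (Fin n) →L[ℝ] EuclideanSpace ℝ (Fin n), ‖A' - A‖ < δ ∧
      ∃ (D : EuclideanSpace ℝ (Fin n) →L[ℝ] EuclideanSpace ℝ (Fin n)) (α : ℝ),
        IsPosDefOp D ∧ 0 < α ∧
        Module.finrank ℝ (centerSubspace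
          (networkJacobian G A' α D : Module.End ℝ (V → EuclideanSpace ℝ (Fin n)))) = m ∧
        ∀ (U : Set (EuclideanSpace ℝ (Fin n))) (Ω : Set (EuclideanSpace ℝ (Fin d)))
          (f : EuclideanSpace ℝ (Fin n) × EuclideanSpace ℝ (Fin d) → EuclideanSpace ℝ (Fin n)),
          IsNodeFamily U Ω f A' →
          -- existence of the center manifold
          (∀ k : ℕ, 1 ≤ k →
            ∃ Ψ, IsParamCenterManifold k (networkField G f α D) (networkJacobian G A' α D) Ψ) ∧
          -- constant and linear terms of the reduced vector field
          (∀ k : ℕ, 1 ≤ k → ∀ Ψ,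
            IsParamCenterManifold k (networkField G f α D) (networkJacobian G A' α D) Ψ →
            ContDiffAt ℝ k
              (reducedField (networkField G f α D) (networkJacobian G A' α D) Ψ) 0 ∧
            (∀ᶠ e in 𝓝 (0 : EuclideanSpace ℝ (Fin d)),
              reducedField (networkField G f α D) (networkJacobian G A' α D) Ψ (0, e) = 0) ∧
            IsNilpotent (fderiv ℝ (fun c =>
              reducedField (networkField G f α D) (networkJacobian G A' α D) Ψ (c, 0)) 0)) ∧
          -- higher order terms of the reduced vector field
          (∀ P : centerSubspace
                (networkJacobian G A' α D : Module.End ℝ (V → EuclideanSpace ℝ (Fin n))) ×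
                EuclideanSpace ℝ (Fin d) →
              centerSubspace
                (networkJacobian G A' α D : Module.End ℝ (V → EuclideanSpace ℝ (Fin n))),
            IsPolyMap ρ P → (∀ e, P (0, e) = 0) →
            ∃ q : EuclideanSpace ℝ (Fin n) × EuclideanSpace ℝ (Fin d) →
                EuclideanSpace ℝ (Fin n),
              IsPolyMap ρ q ∧ (∀ e, q (0, e) = 0) ∧ IsNodeFamily U Ω (f + q) A' ∧
              ∀ k : ℕ, ρ ≤ k → ∀ Ψ,
                IsParamCenterManifold k (networkField G (f + q) α D)
                  (networkJacobian G A' α D) Ψ →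
                taylorTerms ρ (reducedField (networkField G (f + q) α D)
                  (networkJacobian G A' α D) Ψ) = P)) := by
  refine ⟨?_, fun ρ lam v h δ hδ => ?_⟩
  · obtain ⟨lam, v, hlam, hv0, hv⟩ := exists_pos_eigenvalue_lapMatrix hG
    obtain ⟨D, hD, hdim, -⟩ := exists_posDef_nilpotent_sub A x hx_orth hx_pos
    refine ⟨D, 1 / lam, hD, by positivity, ?_, fun U Ω f hf k _ =>
      (hf.isEquilibriumFamily G (1 / lam) D).exists_isParamCenterManifold k⟩
    have h1 := finrank_centerSubspace_le_networkJacobian A (1 / lam) D hv0 hv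
    rwa [one_div_mul_cancel hlam.ne', one_smul, hdim] at h1
  · obtain ⟨A', D, hA', hD, hdim, hnil, hc⟩ :=
      exists_network_parameters A h x hx_orth hx_pos hδ
    have hlam := h.pos_eigenvalue
    refine ⟨A', hA', D, 1 / lam, hD, by positivity, ?_, fun U Ω f hf => ⟨fun k _ =>
      (hf.isEquilibriumFamily G (1 / lam) D).exists_isParamCenterManifold k,
      fun k _ Ψ hΨ => ?_, fun P hP hP0 => ?_⟩⟩
    · rw [← hdim]
      refine le_antisymm ?_
        (finrank_centerSubspace_le_networkJacobian A' (1 / lam) D h.ne_zero h.eigenvector)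
      have h1 := (Submodule.equivMapOfInjective (nodeLift (n := n) v).toLinearMap
        (nodeLift_injective h.ne_zero) (centerSubspace ((A' - (1 / lam * lam) • D :
          EuclideanSpace ℝ (Fin n) →L[ℝ] EuclideanSpace ℝ (Fin n)) :
          Module.End ℝ (EuclideanSpace ℝ (Fin n))))).finrank_eq
      rw [h1]
      refine Submodule.finrank_mono fun X hX => ?_
      obtain ⟨w, hw, rfl⟩ := (hc X).1 hX
      exact ⟨w, hw, rfl⟩
    · have hH := hf.isEquilibriumFamily G (1 / lam) D
      refine ⟨hΨ.contDiffAt_reducedField hH, hΨ.eventually_reducedField_eq_zero hH, ?_⟩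
      rw [(hΨ.hasFDerivAt_reducedField hH).fderiv]
      refine isNilpotent_centerProjL_comp (m := m) fun X hX => ?_
      obtain ⟨w, hw, rfl⟩ := (hc X).1 hX
      have h1 : ∀ (i : ℕ) (y : EuclideanSpace ℝ (Fin n)),
          (networkJacobian G A' (1 / lam) D ^ i) (nodeLift v y) =
            nodeLift v (((A' - (1 / lam * lam) • D) ^ i) y) := by
        intro i
        induction i with
        | zero => exact fun _ => rfl
        | succ i ih =>
          intro y
          rw [pow_succ, pow_succ, mul_apply_eq_comp, mul_apply_eq_comp,
            networkJacobian_nodeLift A' (1 / lam) D h.eigenvector, ih]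
      rw [h1, hnil w hw, map_zero]
    · obtain ⟨c, hcP⟩ := hP
      obtain ⟨q, hq, hq0, hqk⟩ := h.exists_taylorTerms_eq hc hf c (fun j hj e =>
        ContinuousMultilinearMap.diag_eq_zero_of_sum c (w := (0, e)) (fun s => by
          rw [← hcP, Prod.smul_mk, smul_zero, hP0]) hj) h.pos_order le_rfl
      refine ⟨q, hq, hq0, hf.add_isPolyMap hq hq0, fun k hk Ψ hΨ => funext fun w => ?_⟩
      rw [hqk k hk Ψ hΨ, hcP]
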